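/- \textbf{Setting.} Let $\Omega\subset\mathbb R^2$ be a bounded polygonal domain (open, connected) with Lipschitz boundary, $\varepsilon>0$, $\mathbf X:=H^1(\Omega)^2$ with $\|\Phi\|_1=(\|\varphi_1\|_{H^1}^2+\|\varphi_2\|_{H^1}^2)^{1/2}$, $\mathbf V:=H^1_0(\Omega)^2$ (vanishing trace on $\partial\Omega$), and, for boundary data $\mathbf g$, $\mathcal X:=\{w\in\mathbf X: w=\mathbf g\text{ on }\partial\Omega\}$. Put $$A(\Theta,\Phi)=\int_\Omega\nabla\Theta\cdot\nabla\Phi\,dx,\qquad C(\Theta,\Phi)=-2\varepsilon^{-2}\int_\Omega\Theta\cdot\Phi\,dx,$$ $$B(\Xi,\eta,\Theta,\Phi)=\frac{2}{3\varepsilon^2}\int_\Omega\big((\Xi\cdot\eta)(\Theta\cdot\Phi)+2(\Xi\cdot\Theta)(\eta\cdot\Phi)\big)\,dx,$$ $$\langle N(\eta),\Phi\rangle=A(\eta,\Phi)+B(\eta,\eta,\eta,\Phi)+C(\eta,\Phi),\qquad \langle DN(\eta)\Theta,\Phi\rangle=A(\Theta,\Phi)+3B(\eta,\eta,\Theta,\Phi)+C(\Theta,\Phi)$$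 for $\eta,\Theta\in\mathbf X$ and $\Phi\in\mathbf V$. A \emph{regular solution} is a $\Psi\in\mathcal X$ with $\langle N(\Psi),\Phi\rangle=0$ for all $\Phi\in\mathbf V$ such that $$\beta:=\inf_{\Theta\in\mathbf V,\|\Theta\|_1=1}\ \sup_{\Phi\in\mathbf V,\|\Phi\|_1=1}\langle DN(\Psi)\Theta,\Phi\rangle>0$$ and the same holds with the roles of $\Theta$ and $\Phi$ exchanged. For a conforming triangulation $\mathcal T$ of $\Omega$ and a penalty parameter $\sigma>0$ let $$|||\Phi|||_h^2=\sum_{i=1}^2\Big(\int_\Omega|\nabla\varphi_i|^2dx+\sum_{E}\frac{\sigma}{h_E}\int_E\varphi_i^2\,ds\Big),$$ where $E$ runs over the boundary edges of $\mathcal T$ and $h_E$ is the length of $E$. Let $\mathfrak F$ be a nonempty family of conforming triangulations of $\Omega$ (for instance a single one, or a shape-regular family). A number $C_P$ is called a Poincar\'e constant for $\mathfrak F$ if $\|\Phi\|_{L^2(\Omega)^2}\le C_P|||\Phi|||_h$ for all $\Phi\in\mathbf X$ and all $\mathcal T\in\mathfrak F$. Let $B(\Psi,R)$ be the open ball of radius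 $R$ about $\Psi$ in $\mathbf X$, taken either with respect to $\|\cdot\|_1$ or with respect to $|||\cdot|||_h$; the theorem holds for both choices. \textbf{Theorem (an abstract estimate).} Let $\Psi$ be a regular solution. Then $N(\eta)\in\mathbf V^*$ and $DN(\eta)\in\mathcal L(\mathbf X,\mathbf V^*)$ for all $\eta\in\mathbf X$, a Poincar\'e constant for $\mathfrak F$ exists, and for every $R_0>0$ the following hold. The map $DN$ is Lipschitz continuous on $B(\Psi,R_0)$ as a map from $(\mathbf X,\|\cdot\|_1)$ to $\mathcal L(\mathbf X,\mathbf V^*)$, with a Lipschitz constant independent of $\mathcal T\in\mathfrak F$. (a) $$\gamma:=\sup_{\mathcal T\in\mathfrak F}\ \sup_{\eta\in B(\Psi,R_0)\setminus\{\Psi\}}\frac{\|DN(\eta)-DN(\Psi)\|_{\mathcal L(\mathbf X,\mathbf V^*)}}{|||\eta-\Psi|||_h}<\infty .$$ (b) For every Poincar\'e constant $C_P$ for $\mathfrak F$ there is an $R>0$, independent of $\mathcal T\in\mathfrak F$, such that for all $\mathcal T\in\mathfrak F$, all $\eta_h\in B(\Psi,R)$ and all $\Psi_{\mathbf g}\in\mathcal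 X$, $$|||\Psi-\eta_h|||_h\le K\Big(\|N(\eta_h)\|_{\mathbf V^*}+\big(1+\|DN(\eta_h)\|_{\mathcal L(\mathbf X,\mathbf V^*)}\big)\,|||\Psi_{\mathbf g}-\eta_h|||_h\Big),$$ where the constant $K=K(\gamma,\beta,C_P)$ depends only on $\gamma$, $\beta$ and $C_P$. -/

import Mathlib

open MeasureTheory Filter Topology Set
open scoped ENNReal NNReal ContDiff Gradient

noncomputable section

namespace LdG

/-- The Euclidean plane. -/
abbrev Plane : Type := EuclideanSpace ℝ (Fin 2)

/-- Near each of its boundary points, `Ω` is, after a rigid motion, the region above the graph of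
a Lipschitz function. -/
def HasLipschitzBoundary (Ω : Set Plane) : Prop :=
  ∀ x ∈ frontier Ω, ∃ (Q : Plane ≃ₗᵢ[ℝ] Plane) (K : ℝ≥0) (f : ℝ → ℝ) (r : ℝ),
    LipschitzWith K f ∧ 0 < r ∧
      ∀ y ∈ Metric.ball x r, y ∈ Ω ↔ f (Q (y - x) 0) < Q (y - x) 1

/-- A bounded polygonal domain with Lipschitz boundary. -/
structure IsPolygonalDomain (Ω : Set Plane) : Prop where
  isOpen : IsOpen Ω
  isConnected : IsConnected Ω
  isBounded : Bornology.IsBounded Ω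
  polygonal : ∃ S : Finset (Plane × Plane), frontier Ω = ⋃ s ∈ S, segment ℝ s.1 s.2
  lipschitz : HasLipschitzBoundary Ω

/-! ### The Sobolev space `H¹(Ω)` and traces -/

/-- Arc length on `∂Ω`. -/
def bdry (Ω : Set Plane) : Measure Plane := (Measure.hausdorffMeasure 1).restrict (frontier Ω)

/-- Pairs `(u, G)` in `L²(Ω) × L²(Ω; ℝ²)` with the Hilbert norm `(‖u‖² + ‖G‖²)^(1/2)`. -/
abbrev L2Pair (Ω : Set Plane) : Type :=
  WithLp 2 (Lp ℝ 2 (volume.restrict Ω) × Lp Plane 2 (volume.restrict Ω))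

/-- `G` is the weak gradient of `u` in `Ω`. -/
def IsWeakGradient (Ω : Set Plane) (u : Plane → ℝ) (G : Plane → Plane) : Prop :=
  ∀ φ : Plane → ℝ, ContDiff ℝ ∞ φ → HasCompactSupport φ → tsupport φ ⊆ Ω →
    ∫ x in Ω, u x • ∇ φ x = - ∫ x in Ω, φ x • G x

lemma gradient_add_of_contDiff {f g : Plane → ℝ} (hf : ContDiff ℝ 1 f) (hg : ContDiff ℝ 1 g)
    (x : Plane) : ∇ (f + g) x = ∇ f x + ∇ g x := by
  have h1 := hf.differentiable one_ne_zero x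
  have h2 := hg.differentiable one_ne_zero x
  simp [gradient, fderiv_add h1 h2]

lemma gradient_smul_of_contDiff (c : ℝ) {f : Plane → ℝ} (hf : ContDiff ℝ 1 f)
    (x : Plane) : ∇ (c • f) x = c • ∇ f x := by
  have h1 := hf.differentiable one_ne_zero x
  simp [gradient, fderiv_const_smul h1]

lemma continuous_gradient_of_contDiff {f : Plane → ℝ} (hf : ContDiff ℝ 1 f) :
    Continuous (∇ f) :=
  (InnerProductSpace.toDual ℝ Plane).symm.continuous.comp (hf.continuous_fderiv one_ne_zero)

lemma memLp_test {φ : Plane → ℝ} (hφ : ContDiff ℝ ∞ φ) (hc : HasCompactSupport φ)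
    (μ : Measure Plane) [IsFiniteMeasureOnCompacts μ] : MemLp φ 2 μ :=
  hφ.continuous.memLp_of_hasCompactSupport hc

lemma memLp_grad_test {φ : Plane → ℝ} (hφ : ContDiff ℝ ∞ φ) (hc : HasCompactSupport φ)
    (μ : Measure Plane) [IsFiniteMeasureOnCompacts μ] : MemLp (∇ φ) 2 μ := by
  refine (continuous_gradient_of_contDiff (hφ.of_le (by simp))).memLp_of_hasCompactSupport ?_
  exact (hc.fderiv (𝕜 := ℝ)).comp_left (g := (InnerProductSpace.toDual ℝ Plane).symm) (by simp)

/-- The pairs `(u, ∇u)` of a function in `L²(Ω)` and its weak gradient in `L²(Ω; ℝ²)`. -/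
def sobolevPairs (Ω : Set Plane) : Submodule ℝ (L2Pair Ω) where
  carrier := {p | IsWeakGradient Ω p.fst p.snd}
  zero_mem' := by
    intro φ _ _ _
    have h1 : ∫ x in Ω, (⇑(0 : L2Pair Ω).fst : Plane → ℝ) x • ∇ φ x = 0 := by
      refine integral_eq_zero_of_ae ?_
      filter_upwards [Lp.coeFn_zero ℝ 2 (volume.restrict Ω)] with x hx
      rw [WithLp.zero_fst, hx]
      simp
    have h2 : ∫ x in Ω, φ x • ((0 : L2Pair Ω).snd : Plane → Plane) x = 0 := by
      refine integral_eq_zero_of_ae ?_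
      filter_upwards [Lp.coeFn_zero Plane 2 (volume.restrict Ω)] with x hx
      rw [WithLp.zero_snd, hx]
      simp
    rw [h1, h2, neg_zero]
  add_mem' := by
    intro p q hp hq φ h1 h2 h3
    have ig : ∀ w : Lp ℝ 2 (volume.restrict Ω),
        Integrable (fun x => w x • ∇ φ x) (volume.restrict Ω) := fun w =>
      memLp_one_iff_integrable.1 ((memLp_grad_test h1 h2 (volume.restrict Ω)).smul (Lp.memLp w))
    have iv : ∀ w : Lp Plane 2 (volume.restrict Ω),
        Integrable (fun x => φ x • w x) (volume.restrict Ω) := fun w =>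
      memLp_one_iff_integrable.1 ((Lp.memLp w).smul (memLp_test h1 h2 (volume.restrict Ω)))
    have e1 : ∫ x in Ω, ((p + q).fst : Plane → ℝ) x • ∇ φ x =
        ∫ x in Ω, ((p.fst : Plane → ℝ) x • ∇ φ x + (q.fst : Plane → ℝ) x • ∇ φ x) := by
      refine integral_congr_ae ?_
      filter_upwards [Lp.coeFn_add p.fst q.fst] with x hx
      rw [WithLp.add_fst, hx, Pi.add_apply, add_smul]
    have e2 : ∫ x in Ω, φ x • ((p + q).snd : Plane → Plane) x =
        ∫ x in Ω, (φ x • (p.snd : Plane → Plane) x + φ x • (q.snd : Plane → Plane) x) := by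
      refine integral_congr_ae ?_
      filter_upwards [Lp.coeFn_add p.snd q.snd] with x hx
      rw [WithLp.add_snd, hx, Pi.add_apply, smul_add]
    rw [e1, e2, integral_add (ig p.fst) (ig q.fst), integral_add (iv p.snd) (iv q.snd),
      hp φ h1 h2 h3, hq φ h1 h2 h3, neg_add]
  smul_mem' := by
    intro c p hp φ h1 h2 h3
    have e1 : ∫ x in Ω, ((c • p).fst : Plane → ℝ) x • ∇ φ x =
        ∫ x in Ω, c • ((p.fst : Plane → ℝ) x • ∇ φ x) := by
      refine integral_congr_ae ?_
      filter_upwards [Lp.coeFn_smul c p.fst] with x hx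
      rw [WithLp.smul_fst, hx, Pi.smul_apply, smul_assoc]
    have e2 : ∫ x in Ω, φ x • ((c • p).snd : Plane → Plane) x =
        ∫ x in Ω, c • (φ x • (p.snd : Plane → Plane) x) := by
      refine integral_congr_ae ?_
      filter_upwards [Lp.coeFn_smul c p.snd] with x hx
      rw [WithLp.smul_snd, hx, Pi.smul_apply, smul_comm]
    rw [e1, e2, integral_smul, integral_smul, hp φ h1 h2 h3, smul_neg]

variable {Ω : Set Plane}

/-- `H¹(Ω)`: an element is a function in `L²(Ω)` together with its weak gradient in `L²(Ω; ℝ²)`;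
the inherited norm is the usual `H¹` norm `(‖u‖² + ‖∇u‖²)^(1/2)`. -/
def H1 (Ω : Set Plane) : Type := sobolevPairs Ω

instance : NormedAddCommGroup (H1 Ω) := inferInstanceAs (NormedAddCommGroup (sobolevPairs Ω))

instance : NormedSpace ℝ (H1 Ω) := inferInstanceAs (NormedSpace ℝ (sobolevPairs Ω))

/-- The underlying function of an element of `H¹(Ω)`. -/
def fn (u : H1 Ω) : Lp ℝ 2 (volume.restrict Ω) := u.1.fst

/-- The weak gradient of an element of `H¹(Ω)`. -/
def wgrad (u : H1 Ω) : Lp Plane 2 (volume.restrict Ω) := u.1.snd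

/-- `t` is the trace of `u` on `∂Ω`: it is the `L²(∂Ω)` limit of the boundary values of functions
that are `C¹` up to the boundary and converge to `u` in `H¹(Ω)`. -/
def IsTrace (u : H1 Ω) (t : Lp ℝ 2 (bdry Ω)) : Prop :=
  ∃ w : ℕ → Plane → ℝ, (∀ n, ContDiff ℝ 1 (w n)) ∧
    Tendsto (fun n => eLpNorm (w n - ⇑(fn u)) 2 (volume.restrict Ω)) atTop (𝓝 0) ∧
    Tendsto (fun n => eLpNorm (∇ (w n) - ⇑(wgrad u)) 2 (volume.restrict Ω)) atTop (𝓝 0) ∧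
    Tendsto (fun n => eLpNorm (w n - ⇑t) 2 (bdry Ω)) atTop (𝓝 0)

open Classical in
/-- The trace of `u`. On a bounded Lipschitz domain every `u` in `H¹(Ω)` has exactly one trace. -/
def trace (u : H1 Ω) : Lp ℝ 2 (bdry Ω) :=
  if h : ∃ t, IsTrace u t then h.choose else 0

lemma tendsto_eLpNorm_add {E : Type*} [NormedAddCommGroup E] {μ : Measure Plane}
    {f g : ℕ → Plane → E} {a b c : Lp E 2 μ} (hc : c = a + b)
    (hf : ∀ n, Continuous (f n)) (hg : ∀ n, Continuous (g n))
    [SecondCountableTopology E]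
    (h1 : Tendsto (fun n => eLpNorm (f n - ⇑a) 2 μ) atTop (𝓝 0))
    (h2 : Tendsto (fun n => eLpNorm (g n - ⇑b) 2 μ) atTop (𝓝 0)) :
    Tendsto (fun n => eLpNorm (f n + g n - ⇑c) 2 μ) atTop (𝓝 0) := by
  have h3 := h1.add h2
  rw [add_zero] at h3
  refine tendsto_of_tendsto_of_tendsto_of_le_of_le tendsto_const_nhds h3 (fun _ => zero_le) ?_
  intro n
  have e : (f n + g n - ⇑c) =ᵐ[μ] (f n - ⇑a) + (g n - ⇑b) := by
    subst hc
    filter_upwards [Lp.coeFn_add a b] with x hx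
    simp only [Pi.sub_apply, Pi.add_apply, hx, add_sub_add_comm]
  calc eLpNorm (f n + g n - ⇑c) 2 μ
      = eLpNorm ((f n - ⇑a) + (g n - ⇑b)) 2 μ := eLpNorm_congr_ae e
    _ ≤ _ := eLpNorm_add_le ((hf n).aestronglyMeasurable.sub (Lp.aestronglyMeasurable a))
        ((hg n).aestronglyMeasurable.sub (Lp.aestronglyMeasurable b)) (by norm_num)

lemma tendsto_eLpNorm_smul {E : Type*} [NormedAddCommGroup E] [NormedSpace ℝ E]
    {μ : Measure Plane} {f : ℕ → Plane → E} (r : ℝ) {a c : Lp E 2 μ} (hc : c = r • a)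
    (h1 : Tendsto (fun n => eLpNorm (f n - ⇑a) 2 μ) atTop (𝓝 0)) :
    Tendsto (fun n => eLpNorm (r • f n - ⇑c) 2 μ) atTop (𝓝 0) := by
  have h3 : Tendsto (fun n => ‖r‖ₑ * eLpNorm (f n - ⇑a) 2 μ) atTop (𝓝 0) := by
    simpa using ENNReal.Tendsto.const_mul h1 (Or.inr (by simp : ‖r‖ₑ ≠ ⊤))
  refine h3.congr fun n => ?_
  rw [← eLpNorm_const_smul]
  refine eLpNorm_congr_ae ?_
  subst hc
  filter_upwards [Lp.coeFn_smul r a] with x hx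
  simp only [Pi.sub_apply, Pi.smul_apply, hx, smul_sub]

lemma IsTrace.add {u v : H1 Ω} {s t : Lp ℝ 2 (bdry Ω)} (hu : IsTrace u s) (hv : IsTrace v t) :
    IsTrace (u + v) (s + t) := by
  obtain ⟨w, w1, w2, w3, w4⟩ := hu
  obtain ⟨z, z1, z2, z3, z4⟩ := hv
  have hg : ∀ n, ∇ (w n + z n) = ∇ (w n) + ∇ (z n) :=
    fun n => funext fun x => gradient_add_of_contDiff (w1 n) (z1 n) x
  refine ⟨fun n => w n + z n, fun n => (w1 n).add (z1 n), ?_, ?_, ?_⟩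
  · exact tendsto_eLpNorm_add rfl (fun n => (w1 n).continuous) (fun n => (z1 n).continuous) w2 z2
  · simp only [hg]
    exact tendsto_eLpNorm_add rfl (fun n => continuous_gradient_of_contDiff (w1 n))
      (fun n => continuous_gradient_of_contDiff (z1 n)) w3 z3
  · exact tendsto_eLpNorm_add rfl (fun n => (w1 n).continuous) (fun n => (z1 n).continuous) w4 z4

lemma IsTrace.smul (c : ℝ) {u : H1 Ω} {s : Lp ℝ 2 (bdry Ω)} (hu : IsTrace u s) :
    IsTrace (c • u) (c • s) := by
  obtain ⟨w, w1, w2, w3, w4⟩ := hu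
  have hg : ∀ n, ∇ (c • w n) = c • ∇ (w n) :=
    fun n => funext fun x => gradient_smul_of_contDiff c (w1 n) x
  refine ⟨fun n => c • w n, fun n => (w1 n).const_smul c, ?_, ?_, ?_⟩
  · exact tendsto_eLpNorm_smul c rfl w2
  · simp only [hg]
    exact tendsto_eLpNorm_smul c rfl w3
  · exact tendsto_eLpNorm_smul c rfl w4

lemma IsTrace.zero : IsTrace (0 : H1 Ω) 0 := by
  refine ⟨fun _ => 0, fun _ => contDiff_const, ?_, ?_, ?_⟩
  · refine tendsto_const_nhds.congr fun _ => ?_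
    rw [eLpNorm_congr_ae (g := 0), eLpNorm_zero]
    filter_upwards [Lp.coeFn_zero ℝ 2 (volume.restrict Ω)] with x hx
    change (0 : ℝ) - (0 : Lp ℝ 2 (volume.restrict Ω)) x = 0
    rw [hx]; simp
  · refine tendsto_const_nhds.congr fun _ => ?_
    rw [eLpNorm_congr_ae (g := 0), eLpNorm_zero]
    filter_upwards [Lp.coeFn_zero Plane 2 (volume.restrict Ω)] with x hx
    have h0 : ∇ (0 : Plane → ℝ) x = 0 := by simp [gradient]
    change ∇ (0 : Plane → ℝ) x - (0 : Lp Plane 2 (volume.restrict Ω)) x = 0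
    rw [hx, h0]; simp
  · refine tendsto_const_nhds.congr fun _ => ?_
    rw [eLpNorm_congr_ae (g := 0), eLpNorm_zero]
    filter_upwards [Lp.coeFn_zero ℝ 2 (bdry Ω)] with x hx
    change (0 : ℝ) - (0 : Lp ℝ 2 (bdry Ω)) x = 0
    rw [hx]; simp

/-- `X = H¹(Ω) × H¹(Ω)` with the product norm `(‖φ₁‖₁² + ‖φ₂‖₁²)^(1/2)`. -/
def X (Ω : Set Plane) : Type := PiLp 2 (fun _ : Fin 2 => H1 Ω)

instance : NormedAddCommGroup (X Ω) :=
  inferInstanceAs (NormedAddCommGroup (PiLp 2 (fun _ : Fin 2 => H1 Ω)))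

instance : NormedSpace ℝ (X Ω) := inferInstanceAs (NormedSpace ℝ (PiLp 2 (fun _ : Fin 2 => H1 Ω)))

/-- The components of a vector field: `Φ i` for `i : Fin 2`. -/
def X.comp (Φ : X Ω) (i : Fin 2) : H1 Ω := WithLp.ofLp Φ i

instance : CoeFun (X Ω) (fun _ => Fin 2 → H1 Ω) := ⟨X.comp⟩

/-- The subspace of the elements of `X` that vanish on `∂Ω`. -/
def vanishing (Ω : Set Plane) : Submodule ℝ (X Ω) where
  carrier := {Φ | ∀ i, IsTrace (Φ i) 0}
  zero_mem' := fun _ => IsTrace.zero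
  add_mem' := fun ha hb i => by
    have h := (ha i).add (hb i)
    rw [add_zero] at h
    exact h
  smul_mem' := fun c _ ha i => by
    have h := (ha i).smul c
    rw [smul_zero] at h
    exact h

/-- `V = H¹₀(Ω) × H¹₀(Ω)`, the subspace `vanishing Ω` of `X` as a normed space of its own (a
separate type because instance search fails on duals of subspaces of function spaces). -/
def V (Ω : Set Plane) : Type := vanishing Ω

instance : NormedAddCommGroup (V Ω) := inferInstanceAs (NormedAddCommGroup (vanishing Ω))

instance : NormedSpace ℝ (V Ω) := inferInstanceAs (NormedSpace ℝ (vanishing Ω))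

/-- The inclusion of `V` in `X`. -/
def V.incl : V Ω →ₗᵢ[ℝ] X Ω := (vanishing Ω).subtypeₗᵢ

instance : CoeOut (V Ω) (X Ω) := ⟨fun Φ => V.incl Φ⟩

/-- The admissible space `{w ∈ X : w = g on ∂Ω}`. -/
def admissible (g : Fin 2 → Lp ℝ 2 (bdry Ω)) : Set (X Ω) := {w | ∀ i, IsTrace (w i) (g i)}

/-! ### The variational problem -/

/-- The pointwise product `(Ξ · η)(x)` of two vector fields. -/
def dot (Ξ η : X Ω) (x : Plane) : ℝ := ∑ i, fn (Ξ i) x * fn (η i) x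

/-- `A(Θ, Φ) = ∫ ∇Θ · ∇Φ`. -/
def formA (Θ Φ : X Ω) : ℝ := ∑ i, ∫ x in Ω, inner ℝ (wgrad (Θ i) x) (wgrad (Φ i) x)

/-- `B(Ξ, η, Θ, Φ) = 2/(3ε²) ∫ ((Ξ·η)(Θ·Φ) + 2(Ξ·Θ)(η·Φ))`. -/
def formB (ε : ℝ) (Ξ η Θ Φ : X Ω) : ℝ :=
  2 / (3 * ε ^ 2) * ∫ x in Ω, (dot Ξ η x * dot Θ Φ x + 2 * (dot Ξ Θ x * dot η Φ x))

/-- `C(Θ, Φ) = -2ε⁻² ∫ Θ·Φ`. -/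
def formC (ε : ℝ) (Θ Φ : X Ω) : ℝ := -(2 / ε ^ 2) * ∫ x in Ω, dot Θ Φ x

/-- `N(η; Φ) = A(η, Φ) + B(η, η, η, Φ) + C(η, Φ)`. -/
def residualForm (ε : ℝ) (η Φ : X Ω) : ℝ := formA η Φ + formB ε η η η Φ + formC ε η Φ

/-- `⟨DN(η)Θ, Φ⟩ = A(Θ, Φ) + 3B(η, η, Θ, Φ) + C(Θ, Φ)`. -/
def linearizedForm (ε : ℝ) (η Θ Φ : X Ω) : ℝ :=
  formA Θ Φ + 3 * formB ε η η Θ Φ + formC ε Θ Φ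

open Classical in
/-- `N(η)` as an element of `V*`: the bounded functional on `V` given by `residualForm`. -/
def N (ε : ℝ) (η : X Ω) : StrongDual ℝ (V Ω) :=
  if h : ∃ ℓ : StrongDual ℝ (V Ω), ∀ Φ : V Ω, ℓ Φ = residualForm ε η Φ then h.choose else 0

open Classical in
/-- `DN(η)` as an element of `L(X, V*)`: the bounded operator given by `linearizedForm`. -/
def DN (ε : ℝ) (η : X Ω) : X Ω →L[ℝ] StrongDual ℝ (V Ω) :=
  if h : ∃ L : X Ω →L[ℝ] StrongDual ℝ (V Ω), ∀ (Θ : X Ω) (Φ : V Ω),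
    L Θ Φ = linearizedForm ε η Θ Φ then h.choose else 0

/-- The inf-sup constant `β = inf_Θ sup_Φ ⟨DN(Ψ)Θ, Φ⟩` over the unit sphere of `V`. -/
def infSup (ε : ℝ) (Ψ : X Ω) : ℝ :=
  ⨅ Θ : Metric.sphere (0 : V Ω) 1, ⨆ Φ : Metric.sphere (0 : V Ω) 1,
    linearizedForm ε Ψ (Θ : V Ω) (Φ : V Ω)

/-- The transposed inf-sup constant `inf_Φ sup_Θ ⟨DN(Ψ)Θ, Φ⟩`. -/
def infSup' (ε : ℝ) (Ψ : X Ω) : ℝ :=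
  ⨅ Φ : Metric.sphere (0 : V Ω) 1, ⨆ Θ : Metric.sphere (0 : V Ω) 1,
    linearizedForm ε Ψ (Θ : V Ω) (Φ : V Ω)

/-- `Ψ` is a regular (nonsingular) solution: it is admissible, solves the weak formulation, and the
linearization at `Ψ` satisfies both inf-sup conditions. -/
structure IsRegularSolution (ε : ℝ) (g : Fin 2 → Lp ℝ 2 (bdry Ω)) (Ψ : X Ω) : Prop where
  mem : Ψ ∈ admissible g
  solves : ∀ Φ : V Ω, residualForm ε Ψ Φ = 0
  infSup_pos : 0 < infSup ε Ψ
  infSup'_pos : 0 < infSup' ε Ψ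

/-! ### Triangulations and the discrete norm -/

/-- A (conforming) triangulation of `Ω`; each triangle is given by the set of its three vertices. -/
structure Triangulation (Ω : Set Plane) where
  triangles : Finset (Finset Plane)
  card_eq : ∀ T ∈ triangles, T.card = 3
  indep : ∀ T ∈ triangles, AffineIndependent ℝ ((↑) : T → Plane)
  conforming : ∀ T ∈ triangles, ∀ T' ∈ triangles,
    convexHull ℝ (T : Set Plane) ∩ convexHull ℝ (T' : Set Plane) =
      convexHull ℝ ((T : Set Plane) ∩ (T' : Set Plane))
  cover : ⋃ T ∈ triangles, convexHull ℝ (T : Set Plane) = closure Ω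

open Classical in
/-- The boundary edges, each given by the set of its two end points. -/
def Triangulation.boundaryEdges (𝒯 : Triangulation Ω) : Finset (Finset Plane) :=
  (𝒯.triangles.biUnion fun T => T.powersetCard 2).filter
    fun E => convexHull ℝ (E : Set Plane) ⊆ frontier Ω

/-- The squared norm `‖v‖_h² = ∫ |∇v|² + ∑_E (σ / h_E) ∫_E v² ds` over the boundary edges `E`,
where `h_E` is the length of `E`. -/
def hNormSq (𝒯 : Triangulation Ω) (σ : ℝ) (v : H1 Ω) : ℝ :=
  ‖wgrad v‖ ^ 2 + ∑ E ∈ 𝒯.boundaryEdges, σ / Metric.diam (E : Set Plane) *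
    ∫ x in convexHull ℝ (E : Set Plane), (trace v x) ^ 2 ∂(Measure.hausdorffMeasure 1)

/-- The discrete norm `|||Φ|||_h` of a vector field. -/
def hNorm (𝒯 : Triangulation Ω) (σ : ℝ) (Φ : X Ω) : ℝ := √(∑ i, hNormSq 𝒯 σ (Φ i))

/-- The `L²` norm `|||Φ|||_0` of a vector field. -/
def l2Norm (Φ : X Ω) : ℝ := √(∑ i, ‖fn (Φ i)‖ ^ 2)

/-- `c` is a Poincaré constant `C_P` for all triangulations of the family `𝓕`. -/
def IsPoincareConst (𝓕 : Set (Triangulation Ω)) (σ c : ℝ) : Prop :=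
  ∀ 𝒯 ∈ 𝓕, ∀ Φ : X Ω, l2Norm Φ ≤ c * hNorm 𝒯 σ Φ

/-- The balls `B(Ψ, R)` of `X` with respect to the norm of `X`. -/
def xBall (Ψ : X Ω) (_ : Triangulation Ω) (R : ℝ) : Set (X Ω) := Metric.ball Ψ R

/-- The balls `B(Ψ, R)` of `X` with respect to the discrete norm. -/
def hBall (σ : ℝ) (Ψ : X Ω) (𝒯 : Triangulation Ω) (R : ℝ) : Set (X Ω) :=
  {η | hNorm 𝒯 σ (η - Ψ) < R}

/-- The quotients `‖DN(η) - DN(Ψ)‖ / |||η - Ψ|||_h`, for `η ≠ Ψ` in the ball `B(Ψ, R₀)`, whose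
supremum is `γ`. -/
def lipQuotients (𝓕 : Set (Triangulation Ω)) (ε σ : ℝ) (Ψ : X Ω)
    (B : Triangulation Ω → ℝ → Set (X Ω)) (R₀ : ℝ) : Set ℝ :=
  {q | ∃ 𝒯 ∈ 𝓕, ∃ η ∈ B 𝒯 R₀, η ≠ Ψ ∧ q = ‖DN ε η - DN ε Ψ‖ / hNorm 𝒯 σ (η - Ψ)}

end LdG

end

/-!
# A residual-based error estimate near a regular solution

The proof has an analytic part, which provides the functional inequalities on the domain `Ω`, and an
algebraic part, which deduces the estimate from them.

*The domain.* A triangulation gives a cover of `closure Ω` by finitely many parallelograms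
(`Triangulation.exists_isQuadCover`). On a parallelogram the one-dimensional fundamental theorem of
calculus in the two side directions gives the embedding of `W^{1,1}` in `L²` and the trace inequality
in `W^{1,1}`; applied to the square of a function these become the embedding of `H¹` in `L⁴` and the
trace inequality in `H¹`. Following horizontal rays up to the boundary gives in the same way the
Friedrichs inequality `‖u‖ ≤ C (‖∇u‖ + ‖u‖_∂Ω)`. These inequalities are first proved for functions
that are `C¹` up to the boundary. Such functions are dense in `H¹(Ω)` (`exists_smooth_approx`): with a
partition of unity one reduces to a piece of the domain that can be shifted inwards and mollifies
with a kernel supported in a small ball of shifts. Density yields existence and uniqueness of traces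
and the inequalities for all of `H¹(Ω)`, collected in `IsPolygonalDomain.isSobolevDomain`.

*The Poincaré constant.* The boundary edges of a triangulation cover `∂Ω` except for vertices
(`Triangulation.exists_boundaryEdge`): a side shared by two triangles has them on opposite sides, so
its relative interior lies in the interior of `closure Ω`, which is `Ω`. As the edges are no longer
than the diameter of `Ω`, the penalty terms control the norm of the trace in `L²(∂Ω)`, uniformly over
all triangulations, and Friedrichs' inequality gives `exists_isPoincareConst`. A Poincaré constant
`C_P` bounds the norm of `X` by `S = √(1 + C_P²)` times the discrete norm, so the balls of either kind
are contained in comparable balls of `X`.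

*The estimate.* By the embedding in `L⁴` the pointwise product of two vector fields is a continuous
bilinear map `D` into `L²(Ω)`, and the quartic form is an inner product of such products (`IsDot`).
Hence `N` and `DN` are well defined, `DN` is Lipschitz continuous on bounded sets, and `N` has a
quadratic Taylor remainder. For `η` near `Ψ` and admissible `Ψ_g`, the difference `Ψ - Ψ_g` belongs
to `V`, where the inf-sup condition gives
`β ‖Ψ - Ψ_g‖ ≤ ‖DN(Ψ)(Ψ - Ψ_g)‖ ≤ ‖N(η)‖ + M ‖η - Ψ‖² + ‖DN(Ψ)‖ ‖Ψ_g - η‖`.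
On a small ball `M ‖η - Ψ‖²` is at most `β / 2` times the discrete norm of `Ψ - η` and `‖DN(Ψ)‖` is at
most `1 + ‖DN(η)‖`. On `V` the discrete norm is the norm of the gradient, so it is bounded by the norm
of `X`; the triangle inequality and absorption then give the claim with
`K = 2 (1 + (1 + S) / β)` (`hNorm_sub_le_of_norm_sub_le`).
-/

open scoped Manifold

namespace LdG

variable {Ω : Set Plane}

/-! ### Affine coordinates and the fundamental theorem of calculus -/

/-- The affine parametrization `(s, t) ↦ a + s p + t q` of the plane. -/
def par (a p q : Plane) (z : ℝ × ℝ) : Plane := a + (z.1 • p + z.2 • q)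

lemma continuous_par (a p q : Plane) : Continuous (par a p q) := by
  unfold par; fun_prop

lemma exists_equiv_par {p q : Plane} (h : LinearIndependent ℝ ![p, q]) :
    ∃ e : (ℝ × ℝ) ≃L[ℝ] Plane, ∀ a z, par a p q z = a + e z := by
  let f : (ℝ × ℝ) →ₗ[ℝ] Plane :=
    { toFun := fun z => z.1 • p + z.2 • q
      map_add' := fun x y => by simp only [Prod.fst_add, Prod.snd_add]; module
      map_smul' := fun c x => by
        simp only [Prod.smul_fst, Prod.smul_snd, smul_eq_mul, RingHom.id_apply]; module }
  have hinj : Function.Injective f := by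
    rw [← LinearMap.ker_eq_bot, LinearMap.ker_eq_bot']
    intro z hz
    obtain ⟨h1, h2⟩ := LinearIndependent.pair_iff.1 h z.1 z.2 hz
    exact Prod.ext h1 h2
  exact ⟨(LinearEquiv.ofInjectiveOfFinrankEq f hinj (by simp)).toContinuousLinearEquiv,
    fun a z => rfl⟩

lemma measurableEmbedding_par (a : Plane) {p q : Plane} (h : LinearIndependent ℝ ![p, q]) :
    MeasurableEmbedding (par a p q) := by
  obtain ⟨e, he⟩ := exists_equiv_par h
  have : par a p q = ((Homeomorph.addLeft a) ∘ e) := funext fun z => he a z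
  rw [this]
  exact (Homeomorph.addLeft a).measurableEmbedding.comp e.toHomeomorph.measurableEmbedding

/-- The parametrization `par` maps Lebesgue measure to a multiple of Lebesgue measure, by uniqueness
of Haar measure. -/
lemma exists_map_par (a : Plane) {p q : Plane} (h : LinearIndependent ℝ ![p, q]) :
    ∃ c : ℝ≥0, c ≠ 0 ∧ Measure.map (par a p q) volume = (c : ℝ≥0∞) • volume := by
  obtain ⟨e, he⟩ := exists_equiv_par h
  have h1 : (Measure.map e (volume : Measure (ℝ × ℝ))).IsAddHaarMeasure :=
    e.isAddHaarMeasure_map _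
  have h2 := Measure.isAddLeftInvariant_eq_smul (Measure.map e (volume : Measure (ℝ × ℝ)))
    (volume : Measure Plane)
  set c := Measure.addHaarScalarFactor (Measure.map e (volume : Measure (ℝ × ℝ)))
    (volume : Measure Plane) with hc
  refine ⟨c, (Measure.addHaarScalarFactor_pos_of_isAddHaarMeasure _ _).ne', ?_⟩
  have h3 : par a p q = (fun x => a + x) ∘ e := funext fun z => he a z
  have h4 : Measure.map e (volume : Measure (ℝ × ℝ)) = (c : ℝ≥0∞) • (volume : Measure Plane) := h2
  rw [h3, ← Measure.map_map (measurable_const_add a) e.continuous.measurable, h4,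
    Measure.map_smul, map_add_left_eq_self]

/-- Change of variables for the parametrization `par`, on a measurable set of parameters. -/
lemma exists_lintegral_par (a : Plane) {p q : Plane} (h : LinearIndependent ℝ ![p, q]) :
    ∃ c : ℝ≥0, c ≠ 0 ∧ ∀ (S : Set (ℝ × ℝ)) (_ : MeasurableSet S) (F : Plane → ℝ≥0∞),
      ∫⁻ z in S, F (par a p q z) = c * ∫⁻ x in par a p q '' S, F x := by
  obtain ⟨c, hc, hm⟩ := exists_map_par a h
  have he := measurableEmbedding_par a h
  refine ⟨c, hc, fun S hS F => ?_⟩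
  have h1 : (Measure.map (par a p q) volume).restrict (par a p q '' S) =
      Measure.map (par a p q) (volume.restrict S) := by
    rw [he.restrict_map, he.injective.preimage_image]
  rw [← he.lintegral_map, ← h1, hm, Measure.restrict_smul, lintegral_smul_measure]
  rfl

/-- The fundamental theorem of calculus as an inequality between extended norms. -/
lemma enorm_le_add_lintegral_deriv {g g' : ℝ → ℝ} (hg : ∀ t, HasDerivAt g (g' t) t)
    (hg' : Continuous g') (r s : ℝ) :
    ‖g s‖ₑ ≤ ‖g r‖ₑ + ∫⁻ t in uIoc r s, ‖g' t‖ₑ := by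
  have h1 : ∫ t in r..s, g' t = g s - g r :=
    intervalIntegral.integral_eq_sub_of_hasDerivAt (fun t _ => hg t) (hg'.intervalIntegrable _ _)
  have h2 : g s = g r + ∫ t in r..s, g' t := by rw [h1]; ring
  calc ‖g s‖ₑ ≤ ‖g r‖ₑ + ‖∫ t in r..s, g' t‖ₑ := by
        conv_lhs => rw [h2]
        exact enorm_add_le _ _
    _ ≤ _ := by
        gcongr
        have : ‖∫ t in r..s, g' t‖ₑ = ‖∫ t in uIoc r s, g' t‖ₑ := by
          rw [← ofReal_norm, ← ofReal_norm,
            intervalIntegral.norm_intervalIntegral_eq]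
        rw [this]
        exact enorm_integral_le_lintegral_enorm _

/-- On the unit interval, a `C¹` function is bounded by its `W^{1,1}` norm. -/
lemma enorm_le_lintegral_unit {g g' : ℝ → ℝ} (hg : ∀ t, HasDerivAt g (g' t) t)
    (hg' : Continuous g') {s : ℝ} (hs : s ∈ Icc (0 : ℝ) 1) :
    ‖g s‖ₑ ≤ ∫⁻ t in Icc (0 : ℝ) 1, (‖g t‖ₑ + ‖g' t‖ₑ) := by
  have hc : Continuous g := continuous_iff_continuousAt.2 fun t => (hg t).continuousAt
  have h1 : ∀ r ∈ Icc (0 : ℝ) 1, ‖g s‖ₑ ≤ ‖g r‖ₑ + ∫⁻ t in Icc (0 : ℝ) 1, ‖g' t‖ₑ := by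
    intro r hr
    refine (enorm_le_add_lintegral_deriv hg hg' r s).trans ?_
    gcongr
    exact uIoc_subset_uIcc.trans (uIcc_subset_Icc hr hs)
  calc ‖g s‖ₑ = ∫⁻ _ in Icc (0 : ℝ) 1, ‖g s‖ₑ := by simp
    _ ≤ ∫⁻ r in Icc (0 : ℝ) 1, (‖g r‖ₑ + ∫⁻ t in Icc (0 : ℝ) 1, ‖g' t‖ₑ) :=
        setLIntegral_mono' measurableSet_Icc h1
    _ = (∫⁻ r in Icc (0 : ℝ) 1, ‖g r‖ₑ) + ∫⁻ t in Icc (0 : ℝ) 1, ‖g' t‖ₑ := by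
        rw [lintegral_add_left (by fun_prop)]; simp
    _ = _ := by rw [lintegral_add_left (by fun_prop)]

lemma hasDerivAt_comp_line {F : Plane → ℝ} (hF : ContDiff ℝ 1 F) (b v : Plane) (t : ℝ) :
    HasDerivAt (fun t : ℝ => F (b + t • v)) (inner ℝ (∇ F (b + t • v)) v) t := by
  have h1 : HasDerivAt (fun t : ℝ => b + t • v) v t := by
    simpa using ((hasDerivAt_id t).smul_const v).const_add b
  have h2 := (hF.differentiable one_ne_zero (b + t • v)).hasGradientAt.hasFDerivAt
  have h3 := h2.comp_hasDerivAt t h1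
  simpa [Function.comp_def] using h3

lemma continuous_inner_gradient_line {F : Plane → ℝ} (hF : ContDiff ℝ 1 F) (b v : Plane) :
    Continuous (fun t : ℝ => inner ℝ (∇ F (b + t • v)) v) := by
  have := continuous_gradient_of_contDiff hF
  fun_prop

lemma enorm_inner_le_enorm_mul (x v : Plane) : ‖inner ℝ x v‖ₑ ≤ ‖v‖ₑ * ‖x‖ₑ := by
  rw [← ofReal_norm, ← ofReal_norm, ← ofReal_norm,
    ← ENNReal.ofReal_mul (norm_nonneg _), mul_comm]
  exact ENNReal.ofReal_le_ofReal (norm_inner_le_norm x v)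

lemma enorm_line_le_lintegral_unit {F : Plane → ℝ} (hF : ContDiff ℝ 1 F) (b v : Plane) {s : ℝ}
    (hs : s ∈ Icc (0 : ℝ) 1) :
    ‖F (b + s • v)‖ₑ ≤
      ∫⁻ t in Icc (0 : ℝ) 1, (‖F (b + t • v)‖ₑ + ‖v‖ₑ * ‖∇ F (b + t • v)‖ₑ) := by
  refine (enorm_le_lintegral_unit (hasDerivAt_comp_line hF b v)
    (continuous_inner_gradient_line hF b v) hs).trans ?_
  gcongr
  exact enorm_inner_le_enorm_mul _ _

/-! ### Sobolev and trace inequalities on parallelograms -/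

/-- The closed parallelogram with corner `a` spanned by `p` and `q`. -/
def quad (a p q : Plane) : Set Plane := par a p q '' (Icc 0 1 ×ˢ Icc 0 1)

/-- The pointwise `W^{1,1}` density of a function on the plane. -/
noncomputable def sobDensity (F : Plane → ℝ) (x : Plane) : ℝ≥0∞ := ‖F x‖ₑ + ‖∇ F x‖ₑ

lemma measurable_sobDensity {F : Plane → ℝ} (hF : ContDiff ℝ 1 F) : Measurable (sobDensity F) := by
  have h1 := continuous_gradient_of_contDiff hF
  have h2 := hF.continuous
  unfold sobDensity
  fun_prop

lemma add_mul_le_sobDensity (F : Plane → ℝ) (x v : Plane) :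
    ‖F x‖ₑ + ‖v‖ₑ * ‖∇ F x‖ₑ ≤ (1 + ‖v‖ₑ) * sobDensity F x := by
  unfold sobDensity
  calc ‖F x‖ₑ + ‖v‖ₑ * ‖∇ F x‖ₑ ≤ (1 + ‖v‖ₑ) * ‖F x‖ₑ + (1 + ‖v‖ₑ) * ‖∇ F x‖ₑ := by
        gcongr
        · exact le_mul_of_one_le_left zero_le (by simp)
        · simp
    _ = _ := by ring

lemma enorm_line_le_sobDensity {F : Plane → ℝ} (hF : ContDiff ℝ 1 F) (b v : Plane) {s : ℝ}
    (hs : s ∈ Icc (0 : ℝ) 1) :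
    ‖F (b + s • v)‖ₑ ≤ (1 + ‖v‖ₑ) * ∫⁻ t in Icc (0 : ℝ) 1, sobDensity F (b + t • v) := by
  have hm : Measurable fun t : ℝ => sobDensity F (b + t • v) :=
    (measurable_sobDensity hF).comp (by fun_prop)
  refine (enorm_line_le_lintegral_unit hF b v hs).trans ?_
  rw [← lintegral_const_mul _ hm]
  gcongr
  exact add_mul_le_sobDensity F _ v

lemma lintegral_unit_square (G : ℝ × ℝ → ℝ≥0∞) (hG : Measurable G) :
    ∫⁻ z in Icc (0 : ℝ) 1 ×ˢ Icc (0 : ℝ) 1, G z =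
      ∫⁻ s in Icc (0 : ℝ) 1, ∫⁻ t in Icc (0 : ℝ) 1, G (s, t) := by
  rw [Measure.volume_eq_prod, ← Measure.prod_restrict, lintegral_prod _ hG.aemeasurable]

lemma lintegral_unit_square_symm (G : ℝ × ℝ → ℝ≥0∞) (hG : Measurable G) :
    ∫⁻ z in Icc (0 : ℝ) 1 ×ˢ Icc (0 : ℝ) 1, G z =
      ∫⁻ t in Icc (0 : ℝ) 1, ∫⁻ s in Icc (0 : ℝ) 1, G (s, t) := by
  rw [Measure.volume_eq_prod, ← Measure.prod_restrict, lintegral_prod_symm _ hG.aemeasurable]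

/-- The embedding `W^{1,1} ⊂ L²` on a parallelogram: along either side direction the function is
bounded by a one-dimensional integral, and the product of the two bounds separates variables. -/
lemma exists_lintegral_sq_quad_le (a : Plane) {p q : Plane} (h : LinearIndependent ℝ ![p, q]) :
    ∃ C : ℝ≥0, ∀ F : Plane → ℝ, ContDiff ℝ 1 F →
      ∫⁻ x in quad a p q, ‖F x‖ₑ ^ 2 ≤ C * (∫⁻ x in quad a p q, sobDensity F x) ^ 2 := by
  obtain ⟨c, hc, hpar⟩ := exists_lintegral_par a h
  have hS : MeasurableSet (Icc (0 : ℝ) 1 ×ˢ Icc (0 : ℝ) 1) :=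
    measurableSet_Icc.prod measurableSet_Icc
  refine ⟨(1 + ‖p‖₊) * (1 + ‖q‖₊) * c, fun F hF => ?_⟩
  have hm : Measurable fun z : ℝ × ℝ => sobDensity F (par a p q z) :=
    (measurable_sobDensity hF).comp (continuous_par a p q).measurable
  set g₁ : ℝ → ℝ≥0∞ := fun t => ∫⁻ s in Icc (0 : ℝ) 1, sobDensity F (par a p q (s, t)) with hg₁
  set g₂ : ℝ → ℝ≥0∞ := fun s => ∫⁻ t in Icc (0 : ℝ) 1, sobDensity F (par a p q (s, t)) with hg₂
  have hg₁m : Measurable g₁ := hm.lintegral_prod_left'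
  have hg₂m : Measurable g₂ := hm.lintegral_prod_right'
  set J := ∫⁻ z in Icc (0 : ℝ) 1 ×ˢ Icc (0 : ℝ) 1, sobDensity F (par a p q z) with hJ
  have hJ₁ : ∫⁻ t in Icc (0 : ℝ) 1, g₁ t = J := (lintegral_unit_square_symm _ hm).symm
  have hJ₂ : ∫⁻ s in Icc (0 : ℝ) 1, g₂ s = J := (lintegral_unit_square _ hm).symm
  have hpt : ∀ z ∈ Icc (0 : ℝ) 1 ×ˢ Icc (0 : ℝ) 1, ‖F (par a p q z)‖ₑ ^ 2 ≤
      ((1 + ‖p‖ₑ) * (1 + ‖q‖ₑ)) * (g₂ z.1 * g₁ z.2) := by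
    rintro ⟨s, t⟩ ⟨hs, ht⟩
    have e₁ : ‖F (par a p q (s, t))‖ₑ ≤ (1 + ‖p‖ₑ) * g₁ t := by
      have e : ∀ s' : ℝ, par a p q (s', t) = (a + t • q) + s' • p := fun s' => by
        simp only [par]; module
      simp only [hg₁, e]
      exact enorm_line_le_sobDensity hF _ _ hs
    have e₂ : ‖F (par a p q (s, t))‖ₑ ≤ (1 + ‖q‖ₑ) * g₂ s := by
      have e : ∀ t' : ℝ, par a p q (s, t') = (a + s • p) + t' • q := fun t' => by
        simp only [par]; module
      simp only [hg₂, e]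
      exact enorm_line_le_sobDensity hF _ _ ht
    calc ‖F (par a p q (s, t))‖ₑ ^ 2
        ≤ ((1 + ‖p‖ₑ) * g₁ t) * ((1 + ‖q‖ₑ) * g₂ s) := by rw [sq]; gcongr
      _ = _ := by ring
  have key : c * ∫⁻ x in quad a p q, ‖F x‖ₑ ^ 2 ≤
      ((1 + ‖p‖ₑ) * (1 + ‖q‖ₑ)) * (c * ∫⁻ x in quad a p q, sobDensity F x) ^ 2 := by
    have h1 := hpar _ hS fun x => ‖F x‖ₑ ^ 2
    have h2 := hpar _ hS fun x => sobDensity F x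
    rw [quad, ← h1, ← h2]
    calc ∫⁻ z in Icc (0 : ℝ) 1 ×ˢ Icc (0 : ℝ) 1, ‖F (par a p q z)‖ₑ ^ 2
        ≤ ∫⁻ z in Icc (0 : ℝ) 1 ×ˢ Icc (0 : ℝ) 1,
            ((1 + ‖p‖ₑ) * (1 + ‖q‖ₑ)) * (g₂ z.1 * g₁ z.2) := setLIntegral_mono' hS hpt
      _ = ((1 + ‖p‖ₑ) * (1 + ‖q‖ₑ)) * (J * J) := by
          rw [lintegral_const_mul _ (by fun_prop), Measure.volume_eq_prod, ← Measure.prod_restrict,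
            lintegral_prod_mul hg₂m.aemeasurable hg₁m.aemeasurable, hJ₁, hJ₂]
      _ = _ := by rw [sq]
  have hc' : (c : ℝ≥0∞) ≠ 0 := by exact_mod_cast hc
  rw [← ENNReal.mul_le_mul_iff_right hc' ENNReal.coe_ne_top]
  refine key.trans (le_of_eq ?_)
  push_cast
  simp only [enorm_eq_nnnorm]
  ring

/-- Arc length of a parametrized segment is at most the pushed forward Lebesgue measure times the
Lipschitz constant of the parametrization. -/
lemma lintegral_edge_le (a p : Plane) (F : Plane → ℝ≥0∞) (hF : Measurable F) :
    ∫⁻ x in (fun t : ℝ => a + t • p) '' Icc 0 1, F x ∂(Measure.hausdorffMeasure 1) ≤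
      ‖p‖₊ * ∫⁻ t in Icc (0 : ℝ) 1, F (a + t • p) := by
  set φ : ℝ → Plane := fun t => a + t • p with hφ
  have hφc : Continuous φ := by fun_prop
  have hlip : LipschitzWith ‖p‖₊ φ := by
    refine LipschitzWith.of_dist_le_mul fun s t => ?_
    rw [dist_eq_norm, dist_eq_norm, show φ s - φ t = (s - t) • p by simp only [hφ]; module,
      norm_smul, mul_comm]
    rfl
  have hle : (Measure.hausdorffMeasure 1).restrict (φ '' Icc 0 1) ≤
      (‖p‖₊ : ℝ≥0∞) • Measure.map φ (volume.restrict (Icc 0 1)) := by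
    refine Measure.le_iff.2 fun A hA => ?_
    rw [Measure.restrict_apply hA, Measure.smul_apply, Measure.map_apply hφc.measurable hA,
      Measure.restrict_apply (hφc.measurable hA), smul_eq_mul, ← image_preimage_inter]
    have h1 := hlip.hausdorffMeasure_image_le zero_le_one (φ ⁻¹' A ∩ Icc 0 1)
    rw [hausdorffMeasure_real] at h1
    simpa using h1
  calc _ ≤ ∫⁻ x, F x ∂((‖p‖₊ : ℝ≥0∞) • Measure.map φ (volume.restrict (Icc 0 1))) :=
        lintegral_mono' hle le_rfl
    _ = _ := by rw [lintegral_smul_measure, lintegral_map hF hφc.measurable]; rfl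

/-- The trace inequality in `W^{1,1}` on a side of a parallelogram. -/
lemma exists_lintegral_edge_le (a : Plane) {p q : Plane} (h : LinearIndependent ℝ ![p, q]) :
    ∃ C : ℝ≥0, ∀ F : Plane → ℝ, ContDiff ℝ 1 F →
      ∫⁻ x in (fun t : ℝ => a + t • p) '' Icc 0 1, ‖F x‖ₑ ∂(Measure.hausdorffMeasure 1) ≤
        C * ∫⁻ x in quad a p q, sobDensity F x := by
  obtain ⟨c, hc, hpar⟩ := exists_lintegral_par a h
  have hS : MeasurableSet (Icc (0 : ℝ) 1 ×ˢ Icc (0 : ℝ) 1) :=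
    measurableSet_Icc.prod measurableSet_Icc
  refine ⟨‖p‖₊ * (1 + ‖q‖₊) * c, fun F hF => ?_⟩
  have hm : Measurable fun z : ℝ × ℝ => sobDensity F (par a p q z) :=
    (measurable_sobDensity hF).comp (continuous_par a p q).measurable
  refine (lintegral_edge_le a p _ hF.continuous.measurable.enorm).trans ?_
  have h1 : ∀ s : ℝ, ‖F (a + s • p)‖ₑ ≤
      (1 + ‖q‖ₑ) * ∫⁻ t in Icc (0 : ℝ) 1, sobDensity F (par a p q (s, t)) := by
    intro s
    have e : ∀ t' : ℝ, par a p q (s, t') = (a + s • p) + t' • q := fun t' => by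
        simp only [par]; module
    simp only [e]
    simpa using enorm_line_le_sobDensity hF (a + s • p) q (left_mem_Icc.2 zero_le_one)
  have h2 : ∫⁻ s in Icc (0 : ℝ) 1, ‖F (a + s • p)‖ₑ ≤
      (1 + ‖q‖ₑ) * (c * ∫⁻ x in quad a p q, sobDensity F x) := by
    rw [quad, ← hpar _ hS, lintegral_unit_square _ hm,
      ← lintegral_const_mul _ hm.lintegral_prod_right']
    exact lintegral_mono h1
  refine (mul_le_mul_right h2 _).trans (le_of_eq ?_)
  push_cast
  simp only [enorm_eq_nnnorm]
  ring

/-! ### A Friedrichs inequality for smooth functions -/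

/-- Moving in a bounded open set along a direction `v` one meets the boundary, and the segment up to
the first boundary point lies in the set. -/
lemma exists_first_exit {Ω : Set Plane} (ho : IsOpen Ω) (hb : Bornology.IsBounded Ω) {x v : Plane}
    (hx : x ∈ Ω) (hv : v ≠ 0) :
    ∃ T > 0, x + T • v ∈ frontier Ω ∧ ∀ t ∈ Ico (0 : ℝ) T, x + t • v ∈ Ω := by
  have hcont : Continuous fun t : ℝ => x + t • v := by fun_prop
  set S : Set ℝ := {t | 0 ≤ t ∧ x + t • v ∉ Ω} with hS
  have hSc : IsClosed S := isClosed_Ici.inter (ho.isClosed_compl.preimage hcont)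
  have hSb : BddBelow S := ⟨0, fun t ht => ht.1⟩
  have hSn : S.Nonempty := by
    obtain ⟨M, hM⟩ := hb.subset_closedBall x
    have hvn : 0 < ‖v‖ := norm_pos_iff.2 hv
    refine ⟨(|M| + 1) / ‖v‖, by positivity, fun h => ?_⟩
    have h1 := hM h
    rw [Metric.mem_closedBall, dist_eq_norm, add_sub_cancel_left, norm_smul, Real.norm_eq_abs,
      abs_of_nonneg (by positivity), div_mul_cancel₀ _ hvn.ne'] at h1
    linarith [le_abs_self M]
  have hmem := hSc.csInf_mem hSn hSb
  set T := sInf S with hT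
  have hT0 : 0 < T := lt_of_le_of_ne hmem.1 fun h => hmem.2 (by rw [← h]; simpa using hx)
  have hin : ∀ t ∈ Ico (0 : ℝ) T, x + t • v ∈ Ω := by
    intro t ht
    by_contra h
    exact absurd (csInf_le hSb ⟨ht.1, h⟩) (not_le.2 ht.2)
  refine ⟨T, hT0, ?_, hin⟩
  rw [ho.frontier_eq]
  refine ⟨?_, hmem.2⟩
  have h1 : Tendsto (fun t : ℝ => x + t • v) (𝓝[<] T) (𝓝 (x + T • v)) :=
    hcont.continuousAt.continuousWithinAt
  refine mem_closure_of_tendsto h1 ?_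
  filter_upwards [Ioo_mem_nhdsLT hT0] with t ht using hin t ⟨ht.1.le, ht.2⟩

/-- The point of the line through `A` and `B` at height `y`, when `A` and `B` have different
heights. -/
noncomputable def atHeight (A B : Plane) (y : ℝ) : Plane := A + ((y - A 1) / (B 1 - A 1)) • (B - A)

lemma continuous_atHeight (A B : Plane) : Continuous (atHeight A B) := by
  unfold atHeight; fun_prop

lemma atHeight_of_mem_segment {A B x : Plane} (hAB : A 1 ≠ B 1) (hx : x ∈ segment ℝ A B) :
    atHeight A B (x 1) = x := by
  rw [segment_eq_image'] at hx
  obtain ⟨θ, _, rfl⟩ := hx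
  have h : B 1 - A 1 ≠ 0 := sub_ne_zero.2 hAB.symm
  have : ((A + θ • (B - A)) 1 - A 1) / (B 1 - A 1) = θ := by
    simp only [PiLp.add_apply, PiLp.smul_apply, PiLp.sub_apply, smul_eq_mul]
    field_simp
    ring
  rw [atHeight, this]

lemma isCompact_segment_plane (A B : Plane) : IsCompact (segment ℝ A B) := by
  rw [segment_eq_image']
  exact isCompact_Icc.image (by fun_prop)

/-- Integrating over the heights of a segment is dominated by integrating over its arc length, since
the height is a `1`-Lipschitz function. -/
lemma lintegral_atHeight_le {A B : Plane} (hAB : A 1 ≠ B 1) (F : Plane → ℝ≥0∞)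
    (hF : Measurable F) :
    ∫⁻ y in (fun x : Plane => x 1) '' segment ℝ A B, F (atHeight A B y) ≤
      ∫⁻ x in segment ℝ A B, F x ∂(Measure.hausdorffMeasure 1) := by
  set π : Plane → ℝ := fun x => x 1 with hπ
  have hπc : Continuous π := by fun_prop
  have hlip : LipschitzWith 1 π := by
    refine LipschitzWith.of_dist_le_mul fun x y => ?_
    rw [NNReal.coe_one, one_mul, dist_eq_norm, dist_eq_norm]
    exact PiLp.norm_apply_le (x - y) 1
  have hsc : IsCompact (segment ℝ A B) := isCompact_segment_plane _ _
  have hsm : MeasurableSet (segment ℝ A B) := hsc.isClosed.measurableSet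
  have hle : (volume : Measure ℝ).restrict (π '' segment ℝ A B) ≤
      Measure.map π ((Measure.hausdorffMeasure 1).restrict (segment ℝ A B)) := by
    refine Measure.le_iff.2 fun D hD => ?_
    rw [Measure.restrict_apply hD, Measure.map_apply hπc.measurable hD,
      Measure.restrict_apply (hπc.measurable hD), ← image_preimage_inter]
    have h1 := hlip.hausdorffMeasure_image_le zero_le_one (π ⁻¹' D ∩ segment ℝ A B)
    rw [hausdorffMeasure_real] at h1
    simpa using h1
  calc _ ≤ ∫⁻ y, F (atHeight A B y)
          ∂(Measure.map π ((Measure.hausdorffMeasure 1).restrict (segment ℝ A B))) :=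
        lintegral_mono' hle le_rfl
    _ = ∫⁻ x in segment ℝ A B, F (atHeight A B (π x)) ∂(Measure.hausdorffMeasure 1) :=
        lintegral_map (hF.comp (continuous_atHeight A B).measurable) hπc.measurable
    _ = _ := setLIntegral_congr_fun hsm fun x hx => by
        simp only [hπ, atHeight_of_mem_segment hAB hx]

lemma linearIndependent_single :
    LinearIndependent ℝ ![(EuclideanSpace.single 0 1 : Plane), EuclideanSpace.single 1 1] := by
  rw [LinearIndependent.pair_iff]
  intro s t h
  have h0 := congrArg (fun x : Plane => x 0) h
  have h1 := congrArg (fun x : Plane => x 1) h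
  simp at h0 h1
  exact ⟨h0, h1⟩

/-- The Friedrichs inequality in `W^{1,1}`: from each point of `Ω` one follows a horizontal ray up
to the boundary. Rays that meet a horizontal side of the polygon form a null set. -/
lemma exists_lintegral_le_bdry {Ω : Set Plane} (ho : IsOpen Ω) (hb : Bornology.IsBounded Ω)
    (hS : ∃ S : Finset (Plane × Plane), frontier Ω = ⋃ s ∈ S, segment ℝ s.1 s.2) :
    ∃ C : ℝ≥0, ∀ F : Plane → ℝ, ContDiff ℝ 1 F →
      ∫⁻ x in Ω, ‖F x‖ₑ ≤ C * (∫⁻ x, ‖F x‖ₑ ∂(bdry Ω) + ∫⁻ x in Ω, ‖∇ F x‖ₑ) := by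
  classical
  obtain ⟨S, hS⟩ := hS
  obtain ⟨M, hM⟩ := hb.subset_closedBall (0 : Plane)
  set p : Plane := EuclideanSpace.single 0 1 with hp
  set q : Plane := EuclideanSpace.single 1 1 with hq
  obtain ⟨c, hc, hpar⟩ := exists_lintegral_par 0 (p := p) (q := q) linearIndependent_single
  have hemb := measurableEmbedding_par 0 (p := p) (q := q) linearIndependent_single
  have hpn : p ≠ 0 := by simp [hp]
  have hpn1 : ‖p‖ₑ = 1 := by simp [hp, enorm_eq_nnnorm]
  have hsurj : Function.Surjective (par 0 p q) := by
    obtain ⟨e, he⟩ := exists_equiv_par (p := p) (q := q) linearIndependent_single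
    intro x
    exact ⟨e.symm x, by simp [he]⟩
  have hcoord0 : ∀ s t : ℝ, par 0 p q (s, t) 0 = s := fun s t => by simp [par, hp, hq]
  have hcoord1 : ∀ s t : ℝ, par 0 p q (s, t) 1 = t := fun s t => by simp [par, hp, hq]
  set D : Set (ℝ × ℝ) := par 0 p q ⁻¹' Ω with hD
  have hDo : IsOpen D := ho.preimage (continuous_par 0 p q)
  have himg : par 0 p q '' D = Ω := image_preimage_eq _ hsurj
  set S' := S.filter fun s => s.1 1 ≠ s.2 1 with hS'
  set π : Plane → ℝ := fun x => x 1 with hπ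
  refine ⟨c⁻¹ * Real.toNNReal (2 * M) * (S'.card + c), fun F hF => ?_⟩
  have hFm : Measurable fun x => ‖F x‖ₑ := hF.continuous.measurable.enorm
  have hGm : Measurable fun x => ‖∇ F x‖ₑ := (continuous_gradient_of_contDiff hF).measurable.enorm
  set h₁ : ℝ → ℝ≥0∞ := fun y => ∑ s ∈ S', (π '' segment ℝ s.1 s.2).indicator
    (fun y => ‖F (atHeight s.1 s.2 y)‖ₑ) y with hh₁
  set h₂ : ℝ → ℝ≥0∞ := fun y => ∫⁻ t, D.indicator (fun z => ‖∇ F (par 0 p q z)‖ₑ) (t, y) with hh₂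
  have hDm : Measurable (D.indicator fun z => ‖∇ F (par 0 p q z)‖ₑ) :=
    (hGm.comp (continuous_par 0 p q).measurable).indicator hDo.measurableSet
  have hh₂m : Measurable h₂ := hDm.lintegral_prod_left'
  have hsegm : ∀ s : Plane × Plane, MeasurableSet (π '' segment ℝ s.1 s.2) := by
    intro s
    have hsc : IsCompact (segment ℝ s.1 s.2) := isCompact_segment_plane _ _
    exact (hsc.image (by fun_prop)).isClosed.measurableSet
  have hh₁m : Measurable h₁ := by
    refine Finset.measurable_fun_sum _ fun s _ => ?_
    exact (hFm.comp (continuous_atHeight _ _).measurable).indicator (hsegm s)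
  set bad : Set ℝ := (fun s : Plane × Plane => s.1 1) '' (S : Set (Plane × Plane)) with hbad
  have hbad0 : volume bad = 0 := (S.finite_toSet.image _).measure_zero _
  -- the pointwise bound along a horizontal ray
  have hpt : ∀ y ∉ bad, ∀ t, (t, y) ∈ D → ‖F (par 0 p q (t, y))‖ₑ ≤ h₁ y + h₂ y := by
    intro y hy t ht
    obtain ⟨T, hT0, hTf, hTin⟩ := exists_first_exit ho hb (x := par 0 p q (t, y)) ht hpn
    have hline : ∀ τ : ℝ, par 0 p q (t, y) + τ • p = par 0 p q (t + τ, y) := fun τ => by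
      simp only [par]; module
    have hFT : ‖F (par 0 p q (t, y) + T • p)‖ₑ ≤ h₁ y := by
      rw [hS] at hTf
      obtain ⟨s, hs, hxs⟩ := mem_iUnion₂.1 hTf
      have hy1 : (par 0 p q (t, y) + T • p) 1 = y := by rw [hline, hcoord1]
      have hs' : s ∈ S' := by
        refine Finset.mem_filter.2 ⟨hs, fun heq => hy ⟨s, hs, ?_⟩⟩
        rw [segment_eq_image'] at hxs
        obtain ⟨θ, _, h⟩ := hxs
        have h2 := congrArg (fun x : Plane => x 1) h
        simp only [PiLp.add_apply, PiLp.smul_apply, PiLp.sub_apply] at h2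
        rw [heq, sub_self, smul_zero, add_zero, ← heq, ← PiLp.smul_apply, ← PiLp.add_apply, hy1]
          at h2
        exact h2
      have hat := atHeight_of_mem_segment (Finset.mem_filter.1 hs').2 hxs
      rw [hy1] at hat
      have hmem : y ∈ π '' segment ℝ s.1 s.2 := ⟨_, hxs, hy1⟩
      calc ‖F (par 0 p q (t, y) + T • p)‖ₑ = (π '' segment ℝ s.1 s.2).indicator
            (fun y => ‖F (atHeight s.1 s.2 y)‖ₑ) y := by rw [indicator_of_mem hmem, hat]
        _ ≤ h₁ y := Finset.single_le_sum (f := fun s : Plane × Plane =>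
            (π '' segment ℝ s.1 s.2).indicator (fun y => ‖F (atHeight s.1 s.2 y)‖ₑ) y)
            (fun _ _ => zero_le) hs'
    have hFTC := enorm_le_add_lintegral_deriv (hasDerivAt_comp_line hF (par 0 p q (t, y)) p)
      (continuous_inner_gradient_line hF _ p) T 0
    rw [zero_smul, add_zero] at hFTC
    refine hFTC.trans (add_le_add hFT ?_)
    rw [uIoc_of_ge hT0.le, ← restrict_Ioo_eq_restrict_Ioc]
    calc ∫⁻ τ in Ioo 0 T, ‖inner ℝ (∇ F (par 0 p q (t, y) + τ • p)) p‖ₑ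
        ≤ ∫⁻ τ in Ioo 0 T, D.indicator (fun z => ‖∇ F (par 0 p q z)‖ₑ) (t + τ, y) := by
          refine setLIntegral_mono' measurableSet_Ioo fun τ hτ => ?_
          have hmem : (t + τ, y) ∈ D := by
            have := hTin τ ⟨hτ.1.le, hτ.2⟩
            rwa [hline] at this
          rw [indicator_of_mem hmem, hline]
          simpa [hpn1] using enorm_inner_le_enorm_mul (∇ F (par 0 p q (t + τ, y))) p
      _ ≤ ∫⁻ τ, D.indicator (fun z => ‖∇ F (par 0 p q z)‖ₑ) (t + τ, y) :=
          setLIntegral_le_lintegral _ _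
      _ = h₂ y := lintegral_add_left_eq_self
          (fun τ => D.indicator (fun z => ‖∇ F (par 0 p q z)‖ₑ) (τ, y)) t
  have hDsub : D ⊆ Icc (-M) M ×ˢ univ := by
    rintro ⟨t, y⟩ h
    refine ⟨abs_le.1 ?_, mem_univ _⟩
    have h1 := mem_closedBall_zero_iff.1 (hM h)
    have h2 := PiLp.norm_apply_le (par 0 p q (t, y)) 0
    rw [hcoord0] at h2
    exact h2.trans h1
  have hint₁ : ∫⁻ y, h₁ y ≤ S'.card * ∫⁻ x, ‖F x‖ₑ ∂(bdry Ω) := by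
    rw [hh₁, lintegral_finsetSum]
    · rw [← nsmul_eq_mul]
      refine Finset.sum_le_card_nsmul _ _ _ fun s hs => ?_
      rw [lintegral_indicator (hsegm s)]
      refine (lintegral_atHeight_le (Finset.mem_filter.1 hs).2 _ hFm).trans ?_
      refine lintegral_mono_set ?_
      rw [hS]
      exact subset_biUnion_of_mem (u := fun s : Plane × Plane => segment ℝ s.1 s.2)
        (Finset.mem_filter.1 hs).1
    · exact fun s _ => (hFm.comp (continuous_atHeight _ _).measurable).indicator (hsegm s)
  have hint₂ : ∫⁻ y, h₂ y = c * ∫⁻ x in Ω, ‖∇ F x‖ₑ := by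
    have h1 := hpar D hDo.measurableSet fun x => ‖∇ F x‖ₑ
    rw [himg] at h1
    rw [← h1, ← lintegral_indicator hDo.measurableSet, Measure.volume_eq_prod,
      lintegral_prod_symm _ hDm.aemeasurable]
  have hmain : c * ∫⁻ x in Ω, ‖F x‖ₑ ≤ ENNReal.ofReal (2 * M) *
      (S'.card * ∫⁻ x, ‖F x‖ₑ ∂(bdry Ω) + c * ∫⁻ x in Ω, ‖∇ F x‖ₑ) := by
    have h1 := hpar D hDo.measurableSet fun x => ‖F x‖ₑ
    rw [himg] at h1
    rw [← h1]
    calc ∫⁻ z in D, ‖F (par 0 p q z)‖ₑ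
        = ∫⁻ y, ∫⁻ t, D.indicator (fun z => ‖F (par 0 p q z)‖ₑ) (t, y) := by
          rw [← lintegral_indicator hDo.measurableSet, Measure.volume_eq_prod, lintegral_prod_symm]
          exact ((hFm.comp (continuous_par 0 p q).measurable).indicator
            hDo.measurableSet).aemeasurable
      _ ≤ ∫⁻ y, ENNReal.ofReal (2 * M) * (h₁ y + h₂ y) := by
          refine lintegral_mono_ae ?_
          have : ∀ᵐ y, y ∉ bad := measure_eq_zero_iff_ae_notMem.1 hbad0
          filter_upwards [this] with y hy
          calc ∫⁻ t, D.indicator (fun z => ‖F (par 0 p q z)‖ₑ) (t, y)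
              ≤ ∫⁻ t, (Icc (-M) M).indicator (fun _ => h₁ y + h₂ y) t := by
                refine lintegral_mono fun t => ?_
                by_cases ht : (t, y) ∈ D
                · rw [indicator_of_mem ht, indicator_of_mem (hDsub ht).1]
                  exact hpt y hy t ht
                · rw [indicator_of_notMem ht]; exact zero_le
            _ = _ := by
                rw [lintegral_indicator measurableSet_Icc, setLIntegral_const, Real.volume_Icc,
                  mul_comm]
                congr 2; ring
      _ = ENNReal.ofReal (2 * M) * ((∫⁻ y, h₁ y) + ∫⁻ y, h₂ y) := by
          rw [lintegral_const_mul _ (by fun_prop), lintegral_add_left hh₁m]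
      _ ≤ _ := by rw [hint₂]; gcongr
  have hc' : (c : ℝ≥0∞) ≠ 0 := by exact_mod_cast hc
  rw [← ENNReal.mul_le_mul_iff_right hc' ENNReal.coe_ne_top]
  refine hmain.trans ?_
  have hcc : (c : ℝ≥0∞) * (c⁻¹ : ℝ≥0) = 1 := by
    rw [← ENNReal.coe_mul, mul_inv_cancel₀ hc, ENNReal.coe_one]
  push_cast
  set I := ∫⁻ x, ‖F x‖ₑ ∂(bdry Ω)
  set J := ∫⁻ x in Ω, ‖∇ F x‖ₑ
  calc ENNReal.ofReal (2 * M) * (S'.card * I + c * J)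
      ≤ ENNReal.ofReal (2 * M) * ((S'.card + c) * (I + J)) := by
        gcongr
        calc (S'.card : ℝ≥0∞) * I + c * J ≤ (S'.card + c) * I + (S'.card + c) * J := by
              gcongr <;> simp
          _ = _ := by ring
    _ = (c * (c⁻¹ : ℝ≥0)) * (ENNReal.ofReal (2 * M) * ((S'.card + c) * (I + J))) := by
        rw [hcc, one_mul]
    _ = _ := by rw [ENNReal.ofReal]; ring

/-! ### Regularity of polygonal Lipschitz domains and their triangulations -/

/-- A Lipschitz domain lies on one side of its boundary, so it is a regular open set. -/
lemma interior_closure_eq (ho : IsOpen Ω) (hL : HasLipschitzBoundary Ω) :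
    interior (closure Ω) = Ω := by
  refine Subset.antisymm ?_ (interior_maximal subset_closure ho)
  intro x hx
  by_contra hxΩ
  have hxf : x ∈ frontier Ω := by
    rw [ho.frontier_eq]; exact ⟨interior_subset hx, hxΩ⟩
  obtain ⟨Q, K, f, r, hf, hr, hQ⟩ := hL x hxf
  have hf0 : 0 ≤ f 0 := by
    have := (hQ x (Metric.mem_ball_self hr)).not.1 hxΩ
    simpa using this
  set d : Plane := Q.symm (EuclideanSpace.single 1 1) with hd
  have hpath : Continuous fun s : ℝ => x - s • d := by fun_prop
  have hnear : ∀ᶠ s : ℝ in 𝓝[>] 0, x - s • d ∈ interior (closure Ω) ∩ Metric.ball x r := by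
    have h1 : Tendsto (fun s : ℝ => x - s • d) (𝓝[>] 0) (𝓝 x) := by
      have := (hpath.tendsto 0).mono_left (nhdsWithin_le_nhds (s := Ioi 0))
      simpa using this
    exact h1.eventually ((isOpen_interior.inter Metric.isOpen_ball).mem_nhds
      ⟨hx, Metric.mem_ball_self hr⟩)
  obtain ⟨s, ⟨hs1, hs2⟩, hs0⟩ := (hnear.and self_mem_nhdsWithin).exists
  -- the point `x - s d` lies strictly below the graph, as do all points close to it
  set W : Set Plane := {y | Q (y - x) 1 < f (Q (y - x) 0)} ∩ Metric.ball x r with hW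
  have hWo : IsOpen W := by
    refine IsOpen.inter (isOpen_lt ?_ ?_) Metric.isOpen_ball
    · have := Q.continuous
      fun_prop
    · have := Q.continuous
      exact hf.continuous.comp (by fun_prop)
  have hsW : x - s • d ∈ W := by
    refine ⟨?_, hs2⟩
    have : Q (x - s • d - x) = -(s • EuclideanSpace.single 1 1) := by
      rw [sub_sub_cancel_left, map_neg, map_smul, hd, Q.apply_symm_apply]
    simp only [mem_ofPred_eq, this]
    have hs0' : 0 < s := hs0
    simp
    linarith
  have hdisj : Disjoint W Ω := by
    refine disjoint_left.2 fun y hy hyΩ => ?_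
    exact absurd ((hQ y hy.2).1 hyΩ) (not_lt.2 hy.1.le)
  exact disjoint_left.1 (hdisj.closure_right hWo) hsW (interior_subset hs1)

lemma notMem_of_mem_frontier (ho : IsOpen Ω) {x : Plane} (hx : x ∈ frontier Ω) : x ∉ Ω := by
  rw [ho.frontier_eq] at hx; exact hx.2

/-! ### Triangles in barycentric coordinates -/

/-- The vertices of a triangle in a prescribed order, as an affine basis of the plane. -/
lemma exists_affineBasis {T : Finset Plane} (hT : T.card = 3)
    (hi : AffineIndependent ℝ ((↑) : T → Plane)) {a b c : Plane} (ha : a ∈ T) (hb : b ∈ T)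
    (hc : c ∈ T) (hab : a ≠ b) (hbc : b ≠ c) (hac : a ≠ c) :
    ∃ B : AffineBasis (Fin 3) ℝ Plane, B 0 = a ∧ B 1 = b ∧ B 2 = c ∧ T = {a, b, c} ∧
      range B = (T : Set Plane) := by
  classical
  have hTe : T = {a, b, c} := by
    refine (Finset.eq_of_subset_of_card_le ?_ ?_).symm
    · intro x hx
      simp only [Finset.mem_insert, Finset.mem_singleton] at hx
      rcases hx with rfl | rfl | rfl <;> assumption
    · rw [hT, Finset.card_eq_three.2 ⟨a, b, c, hab, hac, hbc, rfl⟩]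
  have hinj : Function.Injective (![⟨a, ha⟩, ⟨b, hb⟩, ⟨c, hc⟩] : Fin 3 → T) := by
    intro i j h
    fin_cases i <;> fin_cases j <;> simp_all [Subtype.ext_iff, eq_comm]
  have h1 := hi.comp_embedding ⟨_, hinj⟩
  have h2 : affineSpan ℝ (range ((fun x : T => (x : Plane)) ∘
      (![⟨a, ha⟩, ⟨b, hb⟩, ⟨c, hc⟩] : Fin 3 → T))) = ⊤ := by
    refine (h1.affineSpan_eq_top_iff_card_eq_finrank_add_one).2 ?_
    simp
  refine ⟨⟨_, h1, h2⟩, rfl, rfl, rfl, hTe, ?_⟩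
  ext x
  have hxT : x ∈ (T : Set Plane) ↔ x = a ∨ x = b ∨ x = c := by rw [hTe]; simp
  rw [hxT]
  change x ∈ range ((fun x : T => (x : Plane)) ∘
      (![⟨a, ha⟩, ⟨b, hb⟩, ⟨c, hc⟩] : Fin 3 → T)) ↔ _
  simp [Fin.exists_fin_succ, eq_comm]

lemma coord_combination (B : AffineBasis (Fin 3) ℝ Plane) {w : Fin 3 → ℝ}
    (hw : w 0 + w 1 + w 2 = 1) (i : Fin 3) :
    B.coord i (w 0 • B 0 + w 1 • B 1 + w 2 • B 2) = w i := by
  have hw' : ∑ i, w i = 1 := by rw [Fin.sum_univ_three, hw]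
  have h := B.coord_apply_combination_of_mem (Finset.mem_univ i) hw'
  rwa [Finset.affineCombination_eq_linear_combination _ _ _ hw', Fin.sum_univ_three] at h

lemma eq_coord_combination (B : AffineBasis (Fin 3) ℝ Plane) (x : Plane) :
    x = B.coord 0 x • B 0 + B.coord 1 x • B 1 + B.coord 2 x • B 2 := by
  have h := B.linear_combination_coord_eq_self x
  rw [Fin.sum_univ_three] at h
  exact h.symm

lemma sum_coord_eq_one (B : AffineBasis (Fin 3) ℝ Plane) (x : Plane) :
    B.coord 0 x + B.coord 1 x + B.coord 2 x = 1 := by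
  rw [← Fin.sum_univ_three (fun i => B.coord i x), B.sum_coord_apply_eq_one]

lemma continuous_coord (B : AffineBasis (Fin 3) ℝ Plane) (i : Fin 3) : Continuous (B.coord i) :=
  (B.coord i).continuous_of_finiteDimensional

lemma convexHull_subset_coord_eq_zero (B : AffineBasis (Fin 3) ℝ Plane) (i : Fin 3) {s : Set Plane}
    (hs : ∀ x ∈ s, B.coord i x = 0) : ∀ x ∈ convexHull ℝ s, B.coord i x = 0 := by
  have h : Convex ℝ {x | B.coord i x = 0} := (convex_singleton (0 : ℝ)).affine_preimage (B.coord i)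
  exact fun x hx => convexHull_min hs h hx

lemma exists_vertices {T : Finset Plane} (hT : T.card = 3) :
    ∃ a b c : Plane, a ∈ T ∧ b ∈ T ∧ c ∈ T ∧ a ≠ b ∧ b ≠ c ∧ a ≠ c := by
  classical
  obtain ⟨a, b, c, hab, hac, hbc, rfl⟩ := Finset.card_eq_three.1 hT
  exact ⟨a, b, c, by simp, by simp, by simp, hab, hbc, hac⟩

/-- A point of a triangle that is not interior lies on one of the sides. -/
lemma exists_mem_side {T : Finset Plane} (hT : T.card = 3)
    (hi : AffineIndependent ℝ ((↑) : T → Plane)) {x : Plane}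
    (hx : x ∈ convexHull ℝ (T : Set Plane)) (hx' : x ∉ interior (convexHull ℝ (T : Set Plane))) :
    ∃ a b c : Plane, a ∈ T ∧ b ∈ T ∧ c ∈ T ∧ a ≠ b ∧ b ≠ c ∧ a ≠ c ∧
      ∃ s ∈ Icc (0 : ℝ) 1, x = (1 - s) • a + s • b := by
  obtain ⟨a, b, c, ha, hb, hc, hab, hbc, hac⟩ := exists_vertices hT
  obtain ⟨B, hB0, hB1, hB2, _, hBr⟩ := exists_affineBasis hT hi ha hb hc hab hbc hac
  rw [← hBr, B.convexHull_eq_nonneg_coord] at hx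
  rw [← hBr, B.interior_convexHull] at hx'
  simp only [mem_ofPred_eq, not_forall, not_lt] at hx hx'
  obtain ⟨i, hi'⟩ := hx'
  have hi0 : B.coord i x = 0 := le_antisymm hi' (hx i)
  have he := eq_coord_combination B x
  have hsum := sum_coord_eq_one B x
  have h0 := hx 0
  have h1 := hx 1
  have h2 := hx 2
  rw [hB0, hB1, hB2] at he
  fin_cases i
  · change B.coord 0 x = 0 at hi0
    rw [hi0] at he hsum
    refine ⟨b, c, a, hb, hc, ha, hbc, hac.symm, hab.symm, B.coord 2 x, ⟨h2, by linarith⟩, ?_⟩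
    rw [show 1 - B.coord 2 x = B.coord 1 x by linarith]
    conv_lhs => rw [he]
    module
  · change B.coord 1 x = 0 at hi0
    rw [hi0] at he hsum
    refine ⟨a, c, b, ha, hc, hb, hac, hbc.symm, hab, B.coord 2 x, ⟨h2, by linarith⟩, ?_⟩
    rw [show 1 - B.coord 2 x = B.coord 0 x by linarith]
    conv_lhs => rw [he]
    module
  · change B.coord 2 x = 0 at hi0
    rw [hi0] at he hsum
    refine ⟨a, b, c, ha, hb, hc, hab, hbc, hac, B.coord 1 x, ⟨h1, by linarith⟩, ?_⟩
    rw [show 1 - B.coord 1 x = B.coord 0 x by linarith]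
    conv_lhs => rw [he]
    module

lemma linearIndependent_half_sides (B : AffineBasis (Fin 3) ℝ Plane) :
    LinearIndependent ℝ ![(2⁻¹ : ℝ) • (B 1 - B 0), (2⁻¹ : ℝ) • (B 2 - B 0)] := by
  rw [LinearIndependent.pair_iff]
  intro s t h
  have h1 : (1 - s / 2 - t / 2) • B 0 + (s / 2) • B 1 + (t / 2) • B 2 = B 0 := by
    calc _ = B 0 + (s • (2⁻¹ : ℝ) • (B 1 - B 0) + t • (2⁻¹ : ℝ) • (B 2 - B 0)) := by module
      _ = B 0 := by rw [h, add_zero]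
  have hc := fun i => coord_combination B (w := ![1 - s / 2 - t / 2, s / 2, t / 2])
    (by simp; ring) i
  simp only [Matrix.cons_val_zero, Matrix.cons_val_one, Matrix.cons_val] at hc
  rw [h1] at hc
  have c1 := hc 1
  have c2 := hc 2
  rw [B.coord_apply_ne (by decide)] at c1 c2
  simp at c1 c2
  exact ⟨by linarith, by linarith⟩

/-- A point of a triangle lies in the parallelogram, spanned by halves of the sides, at a vertex
such that the barycentric coordinates for the two other vertices are at most `1 / 2`. -/
lemma exists_mem_quad {T : Finset Plane} (hT : T.card = 3)
    (hi : AffineIndependent ℝ ((↑) : T → Plane)) {x : Plane}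
    (hx : x ∈ convexHull ℝ (T : Set Plane)) :
    ∃ a b c : Plane, a ∈ T ∧ b ∈ T ∧ c ∈ T ∧ a ≠ b ∧ b ≠ c ∧ a ≠ c ∧
      x ∈ quad a ((2⁻¹ : ℝ) • (b - a)) ((2⁻¹ : ℝ) • (c - a)) := by
  obtain ⟨a, b, c, ha, hb, hc, hab, hbc, hac⟩ := exists_vertices hT
  obtain ⟨B, hB0, hB1, hB2, _, hBr⟩ := exists_affineBasis hT hi ha hb hc hab hbc hac
  rw [← hBr, B.convexHull_eq_nonneg_coord] at hx
  have he := eq_coord_combination B x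
  have hsum := sum_coord_eq_one B x
  have h0 : 0 ≤ B.coord 0 x := hx 0
  have h1 : 0 ≤ B.coord 1 x := hx 1
  have h2 : 0 ≤ B.coord 2 x := hx 2
  rw [hB0, hB1, hB2] at he
  have key : ∀ (a b c : Plane) (u v w : ℝ), u + v + w = 1 → 0 ≤ v → 0 ≤ w → v ≤ 1 / 2 → w ≤ 1 / 2 →
      x = u • a + v • b + w • c → x ∈ quad a ((2⁻¹ : ℝ) • (b - a)) ((2⁻¹ : ℝ) • (c - a)) := by
    intro a b c u v w huvw hv hw hv' hw' hxe
    refine ⟨(2 * v, 2 * w), ⟨⟨by linarith, by linarith⟩, ⟨by linarith, by linarith⟩⟩, ?_⟩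
    obtain rfl : u = 1 - v - w := by linarith
    rw [hxe]
    simp only [par]
    module
  by_cases hv : B.coord 1 x ≤ 1 / 2
  · by_cases hw : B.coord 2 x ≤ 1 / 2
    · exact ⟨a, b, c, ha, hb, hc, hab, hbc, hac, key a b c _ _ _ hsum h1 h2 hv hw he⟩
    · refine ⟨c, a, b, hc, ha, hb, hac.symm, hab, hbc.symm, key c a b (B.coord 2 x) (B.coord 0 x)
        (B.coord 1 x) (by linarith) h0 h1 (by linarith) hv ?_⟩
      conv_lhs => rw [he]
      module
  · refine ⟨b, a, c, hb, ha, hc, hab.symm, hac, hbc, key b a c (B.coord 1 x) (B.coord 0 x)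
      (B.coord 2 x) (by linarith) h0 h2 (by linarith) (by linarith) ?_⟩
    conv_lhs => rw [he]
    module

lemma quad_subset_convexHull {T : Finset Plane} {a b c : Plane} (ha : a ∈ T) (hb : b ∈ T)
    (hc : c ∈ T) :
    quad a ((2⁻¹ : ℝ) • (b - a)) ((2⁻¹ : ℝ) • (c - a)) ⊆ convexHull ℝ (T : Set Plane) := by
  rintro _ ⟨⟨s, t⟩, ⟨⟨hs0, hs1⟩, ht0, ht1⟩, rfl⟩
  have hsub := subset_convexHull ℝ (T : Set Plane)
  have h := (convex_convexHull ℝ (T : Set Plane)).sum_mem (t := Finset.univ)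
    (w := ![1 - s / 2 - t / 2, s / 2, t / 2]) (z := ![a, b, c])
    (fun i _ => by
      simp only at hs0 hs1 ht0 ht1
      fin_cases i
      · change 0 ≤ 1 - s / 2 - t / 2; linarith
      · change 0 ≤ s / 2; linarith
      · change 0 ≤ t / 2; linarith)
    (by simp [Fin.sum_univ_three]; ring)
    (fun i _ => by
      fin_cases i
      · exact hsub ha
      · exact hsub hb
      · exact hsub hc)
  simp only [Fin.sum_univ_three, Matrix.cons_val_zero, Matrix.cons_val_one, Matrix.cons_val] at h
  convert h using 1
  simp only [par]
  module

/-- The data of a cover of `closure Ω` by parallelograms `quad a p q`, which may overlap, such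
that `∂Ω` is covered by the sides from `a` to `a + p`. -/
structure IsQuadCover (Ω : Set Plane) (𝒬 : Set (Plane × Plane × Plane)) : Prop where
  finite : 𝒬.Finite
  indep : ∀ k ∈ 𝒬, LinearIndependent ℝ ![k.2.1, k.2.2]
  subset : ∀ k ∈ 𝒬, quad k.1 k.2.1 k.2.2 ⊆ closure Ω
  cover : closure Ω ⊆ ⋃ k ∈ 𝒬, quad k.1 k.2.1 k.2.2
  cover_frontier : frontier Ω ⊆ ⋃ k ∈ 𝒬, (fun t : ℝ => k.1 + t • k.2.1) '' Icc 0 1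

lemma Triangulation.convexHull_subset (𝒯 : Triangulation Ω) {T : Finset Plane}
    (hT : T ∈ 𝒯.triangles) : convexHull ℝ (T : Set Plane) ⊆ closure Ω := by
  rw [← 𝒯.cover]
  exact subset_biUnion_of_mem (u := fun T : Finset Plane => convexHull ℝ (T : Set Plane)) hT

lemma Triangulation.exists_mem (𝒯 : Triangulation Ω) {x : Plane} (hx : x ∈ closure Ω) :
    ∃ T ∈ 𝒯.triangles, x ∈ convexHull ℝ (T : Set Plane) := by
  rw [← 𝒯.cover] at hx
  simpa using hx

/-- Boundary points lie on the sides of the triangles, because `Ω` is a regular open set. -/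
lemma Triangulation.notMem_interior (ho : IsOpen Ω) (hL : HasLipschitzBoundary Ω)
    (𝒯 : Triangulation Ω) {T : Finset Plane} (hT : T ∈ 𝒯.triangles) {x : Plane}
    (hx : x ∈ frontier Ω) : x ∉ interior (convexHull ℝ (T : Set Plane)) := by
  intro h
  have h1 := interior_mono (𝒯.convexHull_subset hT) h
  rw [interior_closure_eq ho hL] at h1
  exact notMem_of_mem_frontier ho hx h1

/-- Each triangle is the union of the three parallelograms at its vertices whose sides are half as
long as those of the triangle; both orders of the sides are taken, so that the first sides cover the
sides of the triangle. -/
lemma Triangulation.exists_isQuadCover (ho : IsOpen Ω) (hL : HasLipschitzBoundary Ω)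
    (𝒯 : Triangulation Ω) : ∃ 𝒬, IsQuadCover Ω 𝒬 := by
  classical
  set mk : Plane × Plane × Plane → Plane × Plane × Plane :=
    fun v => (v.1, (2⁻¹ : ℝ) • (v.2.1 - v.1), (2⁻¹ : ℝ) • (v.2.2 - v.1)) with hmk
  set 𝒬 : Set (Plane × Plane × Plane) := {k | ∃ T ∈ 𝒯.triangles, ∃ a ∈ T, ∃ b ∈ T, ∃ c ∈ T,
    a ≠ b ∧ b ≠ c ∧ a ≠ c ∧ k = mk (a, b, c)} with h𝒬
  refine ⟨𝒬, ?_, ?_, ?_, ?_, ?_⟩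
  · set U := 𝒯.triangles.biUnion id
    refine ((U ×ˢ U ×ˢ U).finite_toSet.image mk).subset ?_
    rintro _ ⟨T, hT, a, ha, b, hb, c, hc, _, _, _, rfl⟩
    have hU : ∀ v ∈ T, v ∈ U := fun v hv => Finset.mem_biUnion.2 ⟨T, hT, hv⟩
    refine mem_image_of_mem _ ?_
    simp [hU a ha, hU b hb, hU c hc]
  · rintro _ ⟨T, hT, a, ha, b, hb, c, hc, hab, hbc, hac, rfl⟩
    obtain ⟨B, rfl, rfl, rfl, -⟩ := exists_affineBasis (𝒯.card_eq T hT) (𝒯.indep T hT)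
      ha hb hc hab hbc hac
    exact linearIndependent_half_sides B
  · rintro _ ⟨T, hT, a, ha, b, hb, c, hc, hab, hbc, hac, rfl⟩
    exact (quad_subset_convexHull ha hb hc).trans (𝒯.convexHull_subset hT)
  · intro x hx
    obtain ⟨T, hT, hxT⟩ := 𝒯.exists_mem hx
    obtain ⟨a, b, c, ha, hb, hc, hab, hbc, hac, h⟩ := exists_mem_quad (𝒯.card_eq T hT)
      (𝒯.indep T hT) hxT
    exact mem_iUnion₂.2 ⟨mk (a, b, c), ⟨T, hT, a, ha, b, hb, c, hc, hab, hbc, hac, rfl⟩, h⟩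
  · intro x hx
    obtain ⟨T, hT, hxT⟩ := 𝒯.exists_mem (frontier_subset_closure hx)
    obtain ⟨a, b, c, ha, hb, hc, hab, hbc, hac, s, ⟨hs0, hs1⟩, rfl⟩ := exists_mem_side
      (𝒯.card_eq T hT) (𝒯.indep T hT) hxT (𝒯.notMem_interior ho hL hT hx)
    rcases le_total s (1 / 2) with hs | hs
    · refine mem_iUnion₂.2 ⟨mk (a, b, c), ⟨T, hT, a, ha, b, hb, c, hc, hab, hbc, hac, rfl⟩,
        2 * s, ⟨by linarith, by linarith⟩, ?_⟩
      simp only [hmk]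
      module
    · refine mem_iUnion₂.2 ⟨mk (b, a, c), ⟨T, hT, b, hb, a, ha, c, hc, hab.symm, hac, hbc, rfl⟩,
        2 * (1 - s), ⟨by linarith, by linarith⟩, ?_⟩
      simp only [hmk]
      module

lemma Triangulation.volume_frontier (ho : IsOpen Ω) (hL : HasLipschitzBoundary Ω)
    (𝒯 : Triangulation Ω) : volume (frontier Ω) = 0 := by
  have h : frontier Ω ⊆ ⋃ T ∈ 𝒯.triangles, frontier (convexHull ℝ (T : Set Plane)) := by
    intro x hx
    obtain ⟨T, hT, hxT⟩ := 𝒯.exists_mem (frontier_subset_closure hx)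
    exact mem_iUnion₂.2 ⟨T, hT, subset_closure hxT, 𝒯.notMem_interior ho hL hT hx⟩
  refine measure_mono_null h ((measure_biUnion_null_iff 𝒯.triangles.countable_toSet).2 ?_)
  exact fun T _ => (convex_convexHull ℝ _).addHaar_frontier volume

/-! ### Boundary edges of a triangulation -/

lemma coord_side (B : AffineBasis (Fin 3) ℝ Plane) (s : ℝ) :
    B.coord 0 ((1 - s) • B 0 + s • B 1) = 1 - s ∧ B.coord 1 ((1 - s) • B 0 + s • B 1) = s ∧
      B.coord 2 ((1 - s) • B 0 + s • B 1) = 0 := by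
  have h := fun i => coord_combination B (w := ![1 - s, s, 0]) (by simp) i
  simp only [Matrix.cons_val_zero, Matrix.cons_val_one, Matrix.cons_val, zero_smul, add_zero] at h
  exact ⟨h 0, h 1, h 2⟩

/-- Two triangles of a triangulation with a common side lie on opposite sides of it, so that the
open side is interior to their union. -/
lemma Triangulation.mem_interior_of_common_side (𝒯 : Triangulation Ω) {T T' : Finset Plane}
    (hT : T ∈ 𝒯.triangles) (hT' : T' ∈ 𝒯.triangles) (hne : T' ≠ T) {a b c c' : Plane}
    (ha : a ∈ T) (hb : b ∈ T) (hc : c ∈ T) (ha' : a ∈ T') (hb' : b ∈ T') (hc' : c' ∈ T')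
    (hab : a ≠ b) (hbc : b ≠ c) (hac : a ≠ c) (hbc' : b ≠ c') (hac' : a ≠ c') {s : ℝ}
    (hs0 : 0 < s) (hs1 : s < 1) :
    (1 - s) • a + s • b ∈ interior (closure Ω) := by
  classical
  obtain ⟨B, hB0, hB1, hB2, hTe, hBr⟩ := exists_affineBasis (𝒯.card_eq T hT) (𝒯.indep T hT)
    ha hb hc hab hbc hac
  obtain ⟨B', hB0', hB1', hB2', hTe', hBr'⟩ := exists_affineBasis (𝒯.card_eq T' hT')
    (𝒯.indep T' hT') ha' hb' hc' hab hbc' hac'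
  have hcT : c' ∉ T := by
    intro h
    rw [hTe] at h
    simp only [Finset.mem_insert, Finset.mem_singleton] at h
    rcases h with h | h | h
    · exact hac' h.symm
    · exact hbc' h.symm
    · exact hne (by rw [hTe', h, ← hTe])
  set l := B.coord 2 c' with hl
  have hsum := sum_coord_eq_one B c'
  have hc'e := eq_coord_combination B c'
  have hmemT : ∀ y, (∀ i, 0 ≤ B.coord i y) → y ∈ convexHull ℝ (T : Set Plane) := by
    intro y hy; rw [← hBr, B.convexHull_eq_nonneg_coord]; exact hy
  have hmemT' : ∀ y, (∀ i, 0 ≤ B'.coord i y) → y ∈ convexHull ℝ (T' : Set Plane) := by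
    intro y hy; rw [← hBr', B'.convexHull_eq_nonneg_coord]; exact hy
  -- the coordinates of a point with respect to the two triangles
  have hcoord : ∀ u v w : ℝ, u + v + w = 1 →
      B.coord 0 (u • a + v • b + w • c') = u + w * B.coord 0 c' ∧
      B.coord 1 (u • a + v • b + w • c') = v + w * B.coord 1 c' ∧
      B.coord 2 (u • a + v • b + w • c') = w * l := by
    intro u v w huvw
    have h := fun i => coord_combination B
      (w := ![u + w * B.coord 0 c', v + w * B.coord 1 c', w * l])
      (by
        simp only [Matrix.cons_val_zero, Matrix.cons_val_one, Matrix.cons_val]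
        linear_combination huvw + w * hsum) i
    simp only [Matrix.cons_val_zero, Matrix.cons_val_one, Matrix.cons_val] at h
    have he : (u + w * B.coord 0 c') • B 0 + (v + w * B.coord 1 c') • B 1 + (w * l) • B 2 =
        u • a + v • b + w • c' := by
      conv_rhs => rw [hc'e]
      rw [← hB0, ← hB1]
      module
    rw [he] at h
    exact ⟨h 0, h 1, h 2⟩
  have hl_neg : l < 0 := by
    rcases lt_trichotomy l 0 with h | h | h
    · exact h
    · -- `c'` would lie on the line through `a` and `b`
      exfalso
      have h1 : B.coord 0 c' + B.coord 1 c' + 0 = 1 := by linarith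
      have h2 := coord_combination B' (w := ![B.coord 0 c', B.coord 1 c', 0])
        (by simp only [Matrix.cons_val_zero, Matrix.cons_val_one, Matrix.cons_val]; exact h1) 2
      simp only [Matrix.cons_val_zero, Matrix.cons_val_one, Matrix.cons_val] at h2
      have h3 : B.coord 0 c' • B' 0 + B.coord 1 c' • B' 1 + (0 : ℝ) • B' 2 = B' 2 := by
        rw [hB0', hB1', hB2', ← hB0, ← hB1, zero_smul, add_zero]
        conv_rhs => rw [hc'e]
        rw [← hl, h, zero_smul, add_zero]
      rw [h3, B'.coord_apply_eq] at h2
      exact one_ne_zero h2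
    · -- a point near the midpoint of the side would lie in both triangles, off the side
      exfalso
      set α := B.coord 0 c'
      set β := B.coord 1 c'
      set τ : ℝ := 1 / (2 + 2 * |α| + 2 * |β|) with hτ
      have hden : 0 < 2 + 2 * |α| + 2 * |β| := by positivity
      have hτ0 : 0 < τ := by positivity
      have hτe : τ * (2 + 2 * |α| + 2 * |β|) = 1 := by rw [hτ]; field_simp
      have hτα : -(τ * |α|) ≤ τ * α := by
        have := mul_le_mul_of_nonneg_left (neg_abs_le α) hτ0.le
        linarith
      have hτβ : -(τ * |β|) ≤ τ * β := by
        have := mul_le_mul_of_nonneg_left (neg_abs_le β) hτ0.le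
        linarith
      have hpα : 0 ≤ τ * |α| := by positivity
      have hpβ : 0 ≤ τ * |β| := by positivity
      set y := ((1 - τ) / 2) • a + ((1 - τ) / 2) • b + τ • c' with hy
      obtain ⟨y0, y1, y2⟩ := hcoord ((1 - τ) / 2) ((1 - τ) / 2) τ (by ring)
      rw [← hy] at y0 y1 y2
      have hyT : y ∈ convexHull ℝ (T : Set Plane) := by
        refine hmemT y fun i => ?_
        fin_cases i
        · change 0 ≤ B.coord 0 y; rw [y0]; linarith
        · change 0 ≤ B.coord 1 y; rw [y1]; linarith
        · change 0 ≤ B.coord 2 y; rw [y2]; positivity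
      have hyT' : y ∈ convexHull ℝ (T' : Set Plane) := by
        have h2 := fun i => coord_combination B' (w := ![(1 - τ) / 2, (1 - τ) / 2, τ])
          (by simp only [Matrix.cons_val_zero, Matrix.cons_val_one, Matrix.cons_val]; ring) i
        simp only [Matrix.cons_val_zero, Matrix.cons_val_one, Matrix.cons_val] at h2
        rw [hB0', hB1', hB2', ← hy] at h2
        refine hmemT' y fun i => ?_
        rw [h2 i]
        fin_cases i
        · change 0 ≤ (1 - τ) / 2; linarith
        · change 0 ≤ (1 - τ) / 2; linarith
        · exact hτ0.le
      have hyI : y ∈ convexHull ℝ ((T : Set Plane) ∩ T') := by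
        rw [← 𝒯.conforming T hT T' hT']; exact ⟨hyT, hyT'⟩
      have h0 := convexHull_subset_coord_eq_zero B 2 (s := (T : Set Plane) ∩ T') (by
        rintro z ⟨hz, hz'⟩
        rw [hTe'] at hz'
        simp only [Finset.coe_insert, Finset.coe_singleton, mem_insert_iff, mem_singleton_iff]
          at hz'
        rcases hz' with rfl | rfl | rfl
        · rw [← hB0]; exact B.coord_apply_ne (by decide)
        · rw [← hB1]; exact B.coord_apply_ne (by decide)
        · exact absurd hz hcT) y hyI
      rw [y2] at h0
      exact (mul_pos hτ0 h).ne' h0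
  set W : Set Plane := ({y | 0 < B.coord 0 y} ∩ {y | 0 < B.coord 1 y}) ∩
    ({y | 0 < B'.coord 0 y} ∩ {y | 0 < B'.coord 1 y}) with hW
  have hWo : IsOpen W :=
    ((isOpen_lt continuous_const (continuous_coord B 0)).inter
      (isOpen_lt continuous_const (continuous_coord B 1))).inter
    ((isOpen_lt continuous_const (continuous_coord B' 0)).inter
      (isOpen_lt continuous_const (continuous_coord B' 1)))
  have hWsub : W ⊆ closure Ω := by
    rintro y ⟨⟨hy0, hy1⟩, hy0', hy1'⟩
    by_cases hy2 : 0 ≤ B.coord 2 y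
    · refine 𝒯.convexHull_subset hT (hmemT y fun i => ?_)
      fin_cases i
      · exact le_of_lt hy0
      · exact le_of_lt hy1
      · exact hy2
    · refine 𝒯.convexHull_subset hT' (hmemT' y fun i => ?_)
      fin_cases i
      · exact le_of_lt hy0'
      · exact le_of_lt hy1'
      · change 0 ≤ B'.coord 2 y
        have he := eq_coord_combination B' y
        rw [hB0', hB1', hB2'] at he
        have h2 := (hcoord _ _ _ (sum_coord_eq_one B' y)).2.2
        rw [← he] at h2
        by_contra hcon
        exact hy2 (h2 ▸ mul_nonneg_of_nonpos_of_nonpos (not_le.1 hcon).le hl_neg.le)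
  refine interior_mono hWsub (hWo.interior_eq.symm ▸ ?_)
  have h1 := coord_side B s
  have h2 := coord_side B' s
  rw [hB0, hB1] at h1
  rw [hB0', hB1'] at h2
  refine ⟨⟨?_, ?_⟩, ?_, ?_⟩
  · change 0 < B.coord 0 _; rw [h1.1]; linarith
  · change 0 < B.coord 1 _; rw [h1.2.1]; exact hs0
  · change 0 < B'.coord 0 _; rw [h2.1]; linarith
  · change 0 < B'.coord 1 _; rw [h2.2.1]; exact hs0

/-- A side that belongs to one triangle only is contained in the boundary. -/
lemma Triangulation.segment_subset_frontier (ho : IsOpen Ω) (𝒯 : Triangulation Ω) {T : Finset Plane}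
    (hT : T ∈ 𝒯.triangles) {a b c : Plane} (ha : a ∈ T) (hb : b ∈ T) (hc : c ∈ T)
    (hab : a ≠ b) (hbc : b ≠ c) (hac : a ≠ c)
    (honly : ∀ T' ∈ 𝒯.triangles, T' ≠ T → ¬ (a ∈ T' ∧ b ∈ T')) :
    segment ℝ a b ⊆ frontier Ω := by
  classical
  obtain ⟨B, hB0, hB1, hB2, hTe, hBr⟩ := exists_affineBasis (𝒯.card_eq T hT) (𝒯.indep T hT)
    ha hb hc hab hbc hac
  have hopen : openSegment ℝ a b ⊆ frontier Ω := by
    rw [openSegment_eq_image]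
    rintro _ ⟨s, ⟨hs0, hs1⟩, rfl⟩
    simp only
    set z := (1 - s) • a + s • b with hz
    obtain ⟨z0, z1, z2⟩ := coord_side B s
    rw [hB0, hB1, ← hz] at z0 z1 z2
    have hzT : z ∈ convexHull ℝ (T : Set Plane) := by
      rw [← hBr, B.convexHull_eq_nonneg_coord]
      intro i
      fin_cases i
      · change 0 ≤ B.coord 0 z; rw [z0]; linarith
      · change 0 ≤ B.coord 1 z; rw [z1]; exact hs0.le
      · change 0 ≤ B.coord 2 z; rw [z2]
    rw [ho.frontier_eq]
    refine ⟨𝒯.convexHull_subset hT hzT, fun hzΩ => ?_⟩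
    set U : Set Plane := ⋂ T' ∈ 𝒯.triangles.filter (· ≠ T), (convexHull ℝ (T' : Set Plane))ᶜ with hU
    have hUo : IsOpen U := by
      refine isOpen_biInter_finset fun T' _ => ?_
      exact ((T'.finite_toSet).isCompact_convexHull ℝ).isClosed.isOpen_compl
    have hzU : z ∈ U := by
      refine mem_iInter₂.2 fun T' hT' hzT' => ?_
      obtain ⟨hT'1, hT'2⟩ := Finset.mem_filter.1 hT'
      have hzI : z ∈ convexHull ℝ ((T : Set Plane) ∩ T') := by
        rw [← 𝒯.conforming T hT T' hT'1]; exact ⟨hzT, hzT'⟩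
      have hcase : a ∉ T' ∨ b ∉ T' := by
        by_contra! h; exact honly T' hT'1 hT'2 h
      rcases hcase with h | h
      · have h0 := convexHull_subset_coord_eq_zero B 0 (s := (T : Set Plane) ∩ T') (by
          rintro w ⟨hw, hw'⟩
          rw [hTe] at hw
          simp only [Finset.coe_insert, Finset.coe_singleton, mem_insert_iff, mem_singleton_iff]
            at hw
          rcases hw with rfl | rfl | rfl
          · exact absurd hw' h
          · rw [← hB1]; exact B.coord_apply_ne (by decide)
          · rw [← hB2]; exact B.coord_apply_ne (by decide)) z hzI
        rw [z0] at h0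
        linarith
      · have h0 := convexHull_subset_coord_eq_zero B 1 (s := (T : Set Plane) ∩ T') (by
          rintro w ⟨hw, hw'⟩
          rw [hTe] at hw
          simp only [Finset.coe_insert, Finset.coe_singleton, mem_insert_iff, mem_singleton_iff]
            at hw
          rcases hw with rfl | rfl | rfl
          · rw [← hB0]; exact B.coord_apply_ne (by decide)
          · exact absurd hw' h
          · rw [← hB2]; exact B.coord_apply_ne (by decide)) z hzI
        rw [z1] at h0
        linarith
    have hsub : Ω ∩ U ⊆ convexHull ℝ (T : Set Plane) := by
      rintro y ⟨hyΩ, hyU⟩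
      obtain ⟨T', hT', hyT'⟩ := 𝒯.exists_mem (subset_closure hyΩ)
      by_cases h : T' = T
      · rwa [h] at hyT'
      · exact absurd hyT' (mem_iInter₂.1 hyU T' (Finset.mem_filter.2 ⟨hT', h⟩))
    have hint : z ∈ interior (convexHull ℝ (T : Set Plane)) :=
      interior_maximal hsub (ho.inter hUo) ⟨hzΩ, hzU⟩
    rw [← hBr, B.interior_convexHull] at hint
    exact (hint 2).ne' z2
  rw [← closure_openSegment]
  exact closure_minimal hopen isClosed_frontier

/-- The boundary edges of a triangulation cover the boundary, except possibly for vertices. -/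
lemma Triangulation.exists_boundaryEdge (ho : IsOpen Ω) (hL : HasLipschitzBoundary Ω)
    (𝒯 : Triangulation Ω) {x : Plane} (hx : x ∈ frontier Ω)
    (hxv : ∀ T ∈ 𝒯.triangles, x ∉ T) :
    ∃ E ∈ 𝒯.boundaryEdges, x ∈ convexHull ℝ (E : Set Plane) := by
  classical
  obtain ⟨T, hT, hxT⟩ := 𝒯.exists_mem (frontier_subset_closure hx)
  obtain ⟨a, b, c, ha, hb, hc, hab, hbc, hac, s, ⟨hs0, hs1⟩, hxe⟩ := exists_mem_side
    (𝒯.card_eq T hT) (𝒯.indep T hT) hxT (𝒯.notMem_interior ho hL hT hx)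
  have hs0' : 0 < s := by
    refine lt_of_le_of_ne hs0 fun h => hxv T hT ?_
    rw [hxe, ← h]; simpa using ha
  have hs1' : s < 1 := by
    refine lt_of_le_of_ne hs1 fun h => hxv T hT ?_
    rw [hxe, h]; simpa using hb
  have honly : ∀ T' ∈ 𝒯.triangles, T' ≠ T → ¬ (a ∈ T' ∧ b ∈ T') := by
    rintro T' hT' hne ⟨ha', hb'⟩
    obtain ⟨c', hc', hac', hbc'⟩ : ∃ c' ∈ T', a ≠ c' ∧ b ≠ c' := by
      have hcard : 0 < ((T'.erase a).erase b).card := by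
        rw [Finset.card_erase_of_mem (Finset.mem_erase.2 ⟨hab.symm, hb'⟩),
          Finset.card_erase_of_mem ha', 𝒯.card_eq T' hT']
        norm_num
      obtain ⟨c', hc'⟩ := Finset.card_pos.1 hcard
      simp only [Finset.mem_erase] at hc'
      exact ⟨c', hc'.2.2, fun h => hc'.2.1 h.symm, fun h => hc'.1 h.symm⟩
    have h := 𝒯.mem_interior_of_common_side hT hT' hne ha hb hc ha' hb' hc' hab hbc hac hbc' hac'
      hs0' hs1'
    rw [interior_closure_eq ho hL, ← hxe] at h
    exact notMem_of_mem_frontier ho hx h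
  have hseg := 𝒯.segment_subset_frontier ho hT ha hb hc hab hbc hac honly
  refine ⟨{a, b}, Finset.mem_filter.2 ⟨Finset.mem_biUnion.2 ⟨T, hT, ?_⟩, ?_⟩, ?_⟩
  · refine Finset.mem_powersetCard.2 ⟨?_, Finset.card_pair hab⟩
    intro y hy
    simp only [Finset.mem_insert, Finset.mem_singleton] at hy
    rcases hy with rfl | rfl <;> assumption
  · rwa [Finset.coe_pair, convexHull_pair]
  · rw [Finset.coe_pair, convexHull_pair, segment_eq_image]
    exact ⟨s, ⟨hs0, hs1⟩, hxe.symm⟩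

/-! ### Sobolev inequalities for smooth functions on the domain -/

lemma setLIntegral_biUnion_le {ι : Type*} (μ : Measure Plane) (s : Finset ι) (t : ι → Set Plane)
    (f : Plane → ℝ≥0∞) : ∫⁻ x in ⋃ i ∈ s, t i, f x ∂μ ≤ ∑ i ∈ s, ∫⁻ x in t i, f x ∂μ := by
  classical
  induction s using Finset.induction_on with
  | empty => simp
  | insert i s hi ih =>
    rw [Finset.sum_insert hi, Finset.set_biUnion_insert]
    exact (lintegral_union_le f _ _).trans (by gcongr)

lemma IsQuadCover.setLIntegral_quad_le {𝒬 : Set (Plane × Plane × Plane)} (h𝒬 : IsQuadCover Ω 𝒬)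
    (hnull : volume (frontier Ω) = 0) {k : Plane × Plane × Plane} (hk : k ∈ 𝒬)
    (f : Plane → ℝ≥0∞) : ∫⁻ x in quad k.1 k.2.1 k.2.2, f x ≤ ∫⁻ x in Ω, f x := by
  calc ∫⁻ x in quad k.1 k.2.1 k.2.2, f x ≤ ∫⁻ x in Ω ∪ frontier Ω, f x :=
        lintegral_mono_set ((h𝒬.subset k hk).trans (closure_eq_self_union_frontier Ω).le)
    _ ≤ (∫⁻ x in Ω, f x) + ∫⁻ x in frontier Ω, f x := lintegral_union_le _ _ _
    _ = ∫⁻ x in Ω, f x := by rw [setLIntegral_measure_zero _ _ hnull, add_zero]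

/-- The embedding `W^{1,1}(Ω) ⊂ L²(Ω)` for smooth functions. -/
lemma exists_lintegral_sq_le {𝒬 : Set (Plane × Plane × Plane)} (h𝒬 : IsQuadCover Ω 𝒬)
    (hnull : volume (frontier Ω) = 0) :
    ∃ C : ℝ≥0, ∀ F : Plane → ℝ, ContDiff ℝ 1 F →
      ∫⁻ x in Ω, ‖F x‖ₑ ^ 2 ≤ C * (∫⁻ x in Ω, sobDensity F x) ^ 2 := by
  classical
  choose! c hc using fun k (hk : k ∈ 𝒬) => exists_lintegral_sq_quad_le k.1 (h𝒬.indep k hk)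
  refine ⟨∑ k ∈ h𝒬.finite.toFinset, c k, fun F hF => ?_⟩
  have hsub : Ω ⊆ ⋃ k ∈ h𝒬.finite.toFinset, quad k.1 k.2.1 k.2.2 := by
    simpa using subset_closure.trans h𝒬.cover
  calc ∫⁻ x in Ω, ‖F x‖ₑ ^ 2 ≤ ∑ k ∈ h𝒬.finite.toFinset, ∫⁻ x in quad k.1 k.2.1 k.2.2, ‖F x‖ₑ ^ 2 :=
        (lintegral_mono_set hsub).trans (setLIntegral_biUnion_le _ _ _ _)
    _ ≤ ∑ k ∈ h𝒬.finite.toFinset, c k * (∫⁻ x in Ω, sobDensity F x) ^ 2 := by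
        refine Finset.sum_le_sum fun k hk => ?_
        have hk' : k ∈ 𝒬 := by simpa using hk
        refine (hc k hk' F hF).trans ?_
        gcongr _ * ?_ ^ 2
        exact h𝒬.setLIntegral_quad_le hnull hk' _
    _ = _ := by rw [← Finset.sum_mul]; push_cast; rfl

/-- The trace inequality in `W^{1,1}(Ω)` for smooth functions. -/
lemma exists_lintegral_bdry_le {𝒬 : Set (Plane × Plane × Plane)} (h𝒬 : IsQuadCover Ω 𝒬)
    (hnull : volume (frontier Ω) = 0) :
    ∃ C : ℝ≥0, ∀ F : Plane → ℝ, ContDiff ℝ 1 F →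
      ∫⁻ x, ‖F x‖ₑ ∂(bdry Ω) ≤ C * ∫⁻ x in Ω, sobDensity F x := by
  classical
  choose! c hc using fun k (hk : k ∈ 𝒬) => exists_lintegral_edge_le k.1 (h𝒬.indep k hk)
  refine ⟨∑ k ∈ h𝒬.finite.toFinset, c k, fun F hF => ?_⟩
  have hsub : frontier Ω ⊆ ⋃ k ∈ h𝒬.finite.toFinset, (fun t : ℝ => k.1 + t • k.2.1) '' Icc 0 1 := by
    simpa using h𝒬.cover_frontier
  calc ∫⁻ x, ‖F x‖ₑ ∂(bdry Ω) ≤ ∑ k ∈ h𝒬.finite.toFinset,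
        ∫⁻ x in (fun t : ℝ => k.1 + t • k.2.1) '' Icc 0 1, ‖F x‖ₑ ∂(Measure.hausdorffMeasure 1) :=
        (lintegral_mono_set hsub).trans (setLIntegral_biUnion_le _ _ _ _)
    _ ≤ ∑ k ∈ h𝒬.finite.toFinset, c k * ∫⁻ x in Ω, sobDensity F x := by
        refine Finset.sum_le_sum fun k hk => ?_
        have hk' : k ∈ 𝒬 := by simpa using hk
        refine (hc k hk' F hF).trans ?_
        gcongr _ * ?_
        exact h𝒬.setLIntegral_quad_le hnull hk' _
    _ = _ := by rw [← Finset.sum_mul]; push_cast; rfl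

/-- The boundary has finite length, by the trace inequality for the constant function `1`. -/
lemma isFiniteMeasure_bdry {𝒬 : Set (Plane × Plane × Plane)} (h𝒬 : IsQuadCover Ω 𝒬)
    (hnull : volume (frontier Ω) = 0) (hb : Bornology.IsBounded Ω) : IsFiniteMeasure (bdry Ω) := by
  obtain ⟨C, hC⟩ := exists_lintegral_bdry_le h𝒬 hnull
  have h := hC (fun _ => 1) contDiff_const
  have h0 : ∀ x : Plane, ∇ (fun _ : Plane => (1 : ℝ)) x = 0 := fun x => by simp [gradient]
  simp only [sobDensity, h0, enorm_one, enorm_zero, add_zero, lintegral_one,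
    Measure.restrict_apply_univ] at h
  exact ⟨h.trans_lt (ENNReal.mul_lt_top ENNReal.coe_lt_top hb.measure_lt_top)⟩

lemma eLpNorm_two_sq {E : Type*} [NormedAddCommGroup E] (f : Plane → E) (μ : Measure Plane) :
    eLpNorm f 2 μ ^ 2 = ∫⁻ x, ‖f x‖ₑ ^ 2 ∂μ := by
  have h := eLpNorm_nnreal_pow_eq_lintegral (f := f) (μ := μ) (p := 2) two_ne_zero
  simpa using h

lemma eLpNorm_four_pow {E : Type*} [NormedAddCommGroup E] (f : Plane → E) (μ : Measure Plane) :
    eLpNorm f 4 μ ^ 4 = ∫⁻ x, ‖f x‖ₑ ^ 4 ∂μ := by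
  have h := eLpNorm_nnreal_pow_eq_lintegral (f := f) (μ := μ) (p := 4) four_ne_zero
  simpa using h

lemma gradient_sq {w : Plane → ℝ} (hw : ContDiff ℝ 1 w) (x : Plane) :
    ∇ (fun x => w x ^ 2) x = (2 * w x) • ∇ w x := by
  have h := (hw.differentiable one_ne_zero x).hasFDerivAt.pow 2
  have h2 : fderiv ℝ (fun x => w x ^ 2) x = (2 * w x) • fderiv ℝ w x := by
    rw [h.fderiv]; simp
  simp [gradient, h2]

lemma enorm_gradient_sq {w : Plane → ℝ} (hw : ContDiff ℝ 1 w) (x : Plane) :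
    ‖∇ (fun x => w x ^ 2) x‖ₑ = 2 * (‖w x‖ₑ * ‖∇ w x‖ₑ) := by
  have h2 : ‖(2 : ℝ)‖ₑ = 2 := by simp [Real.enorm_eq_ofReal]
  rw [gradient_sq hw, enorm_smul, enorm_mul, h2, mul_assoc]

lemma lintegral_gradient_sq_le {w : Plane → ℝ} (hw : ContDiff ℝ 1 w) (μ : Measure Plane) :
    ∫⁻ x, ‖∇ (fun x => w x ^ 2) x‖ₑ ∂μ ≤ 2 * (eLpNorm w 2 μ * eLpNorm (∇ w) 2 μ) := by
  have hm1 : Measurable fun x => ‖w x‖ₑ := hw.continuous.measurable.enorm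
  have hm2 : Measurable fun x => ‖∇ w x‖ₑ := (continuous_gradient_of_contDiff hw).measurable.enorm
  simp only [enorm_gradient_sq hw]
  rw [lintegral_const_mul _ (by fun_prop)]
  gcongr
  have h := ENNReal.lintegral_mul_le_Lp_mul_Lq μ Real.HolderConjugate.two_two hm1.aemeasurable
    hm2.aemeasurable
  refine h.trans (le_of_eq ?_)
  rw [eLpNorm_eq_lintegral_rpow_enorm_toReal (by norm_num) (by norm_num),
    eLpNorm_eq_lintegral_rpow_enorm_toReal (by norm_num) (by norm_num)]
  norm_num

/-- The square of an `H¹` function is in `W^{1,1}`; this turns the inequalities in `W^{1,1}` into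
inequalities in `H¹`. -/
lemma lintegral_sobDensity_sq_le {w : Plane → ℝ} (hw : ContDiff ℝ 1 w) :
    ∫⁻ x in Ω, sobDensity (fun x => w x ^ 2) x ≤
      (eLpNorm w 2 (volume.restrict Ω) + eLpNorm (∇ w) 2 (volume.restrict Ω)) ^ 2 := by
  have hm1 : Measurable fun x => ‖w x ^ 2‖ₑ := (hw.continuous.pow 2).measurable.enorm
  unfold sobDensity
  rw [lintegral_add_left hm1]
  have h1 : ∫⁻ x in Ω, ‖w x ^ 2‖ₑ = eLpNorm w 2 (volume.restrict Ω) ^ 2 := by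
    rw [eLpNorm_two_sq]; simp only [enorm_pow]
  rw [h1]
  set a := eLpNorm w 2 (volume.restrict Ω)
  set b := eLpNorm (∇ w) 2 (volume.restrict Ω)
  calc a ^ 2 + _ ≤ a ^ 2 + 2 * (a * b) := by gcongr; exact lintegral_gradient_sq_le hw _
    _ ≤ a ^ 2 + 2 * (a * b) + b ^ 2 := le_self_add
    _ = _ := by ring

/-- A constant for estimates of powers gives a constant for the estimates of the quantities. -/
lemma le_coe_mul_of_pow_le {n : ℕ} (hn : n ≠ 0) {C : ℝ≥0} {x y : ℝ≥0∞} (h : x ^ n ≤ C * y ^ n) :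
    x ≤ ((1 + C : ℝ≥0) : ℝ≥0∞) * y := by
  rw [← ENNReal.pow_le_pow_left_iff hn, mul_pow]
  refine h.trans ?_
  gcongr
  have h1 : (1 : ℝ≥0) ≤ 1 + C := le_self_add
  have h2 : C ≤ (1 + C) ^ n := le_add_self.trans (le_self_pow₀ h1 hn)
  exact_mod_cast h2

/-- The embedding `H¹(Ω) ⊂ L⁴(Ω)` for smooth functions. -/
lemma exists_eLpNorm_four_le {𝒬 : Set (Plane × Plane × Plane)} (h𝒬 : IsQuadCover Ω 𝒬)
    (hnull : volume (frontier Ω) = 0) :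
    ∃ C : ℝ≥0, ∀ w : Plane → ℝ, ContDiff ℝ 1 w → eLpNorm w 4 (volume.restrict Ω) ≤
      C * (eLpNorm w 2 (volume.restrict Ω) + eLpNorm (∇ w) 2 (volume.restrict Ω)) := by
  obtain ⟨C, hC⟩ := exists_lintegral_sq_le h𝒬 hnull
  refine ⟨1 + C, fun w hw => le_coe_mul_of_pow_le four_ne_zero ?_⟩
  rw [eLpNorm_four_pow]
  have h := hC (fun x => w x ^ 2) (hw.pow 2)
  simp only [enorm_pow, ← pow_mul] at h
  refine h.trans ?_
  rw [show (4 : ℕ) = 2 * 2 by norm_num, pow_mul]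
  gcongr
  exact lintegral_sobDensity_sq_le hw

/-- The trace inequality in `H¹(Ω)` for smooth functions. -/
lemma exists_eLpNorm_bdry_le {𝒬 : Set (Plane × Plane × Plane)} (h𝒬 : IsQuadCover Ω 𝒬)
    (hnull : volume (frontier Ω) = 0) :
    ∃ C : ℝ≥0, ∀ w : Plane → ℝ, ContDiff ℝ 1 w → eLpNorm w 2 (bdry Ω) ≤
      C * (eLpNorm w 2 (volume.restrict Ω) + eLpNorm (∇ w) 2 (volume.restrict Ω)) := by
  obtain ⟨C, hC⟩ := exists_lintegral_bdry_le h𝒬 hnull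
  refine ⟨1 + C, fun w hw => le_coe_mul_of_pow_le two_ne_zero ?_⟩
  rw [eLpNorm_two_sq]
  have h := hC (fun x => w x ^ 2) (hw.pow 2)
  simp only [enorm_pow] at h
  refine h.trans ?_
  gcongr
  exact lintegral_sobDensity_sq_le hw

/-- The Friedrichs inequality in `H¹(Ω)` for smooth functions. -/
lemma exists_eLpNorm_le_bdry (ho : IsOpen Ω) (hb : Bornology.IsBounded Ω)
    (hS : ∃ S : Finset (Plane × Plane), frontier Ω = ⋃ s ∈ S, segment ℝ s.1 s.2) :
    ∃ C : ℝ≥0, ∀ w : Plane → ℝ, ContDiff ℝ 1 w → eLpNorm w 2 (volume.restrict Ω) ≤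
      C * (eLpNorm (∇ w) 2 (volume.restrict Ω) + eLpNorm w 2 (bdry Ω)) := by
  obtain ⟨C, hC⟩ := exists_lintegral_le_bdry ho hb hS
  refine ⟨1 + 2 * C, fun w hw => ?_⟩
  have h := hC (fun x => w x ^ 2) (hw.pow 2)
  have h' := h.trans (mul_le_mul_right (add_le_add_right (lintegral_gradient_sq_le hw _) _) _)
  simp only [enorm_pow] at h'
  rw [← eLpNorm_two_sq, ← eLpNorm_two_sq] at h'
  set a := eLpNorm w 2 (volume.restrict Ω)
  set b := eLpNorm (∇ w) 2 (volume.restrict Ω)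
  set d := eLpNorm w 2 (bdry Ω)
  have ha : a ≠ ⊤ := by
    obtain ⟨M, hM⟩ := (hb.isCompact_closure.image_of_continuousOn
      hw.continuous.norm.continuousOn).bddAbove
    have : IsFiniteMeasure (volume.restrict Ω) := ⟨by simpa using hb.measure_lt_top⟩
    refine (MemLp.of_bound (p := 2) hw.continuous.aestronglyMeasurable M ?_).eLpNorm_ne_top
    filter_upwards [ae_restrict_mem ho.measurableSet] with x hx
    exact hM (mem_image_of_mem _ (subset_closure hx))
  rcases eq_or_ne b ⊤ with hb' | hb'
  · rw [hb', top_add, ENNReal.mul_top]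
    · exact le_top
    · simp
  rcases eq_or_ne d ⊤ with hd' | hd'
  · rw [hd', add_top, ENNReal.mul_top]
    · exact le_top
    · simp
  clear_value a b d
  lift a to ℝ≥0 using ha
  lift b to ℝ≥0 using hb'
  lift d to ℝ≥0 using hd'
  have h2 : a ^ 2 ≤ C * (d ^ 2 + 2 * (a * b)) := by exact_mod_cast h'
  have h3 : a ≤ (1 + 2 * C) * (b + d) := by
    rw [← NNReal.coe_le_coe] at h2 ⊢
    push_cast at h2 ⊢
    have ha0 := a.coe_nonneg
    have hb0 := b.coe_nonneg
    have hd0 := d.coe_nonneg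
    have hC0 := C.coe_nonneg
    by_contra! hcon
    -- if `a > (1 + 2C)(b + d)` then `C d² ≤ C d a` and the right side is below `a²`
    have hda : (d : ℝ) ≤ a := by nlinarith [mul_nonneg hC0 (add_nonneg hb0 hd0)]
    have h4 : (C : ℝ) * d ^ 2 ≤ C * (d * a) := by
      rw [sq]; exact mul_le_mul_of_nonneg_left (mul_le_mul_of_nonneg_left hda hd0) hC0
    have h5 : (a : ℝ) * a ≤ (a : ℝ) * (2 * C * (b + d)) := by
      nlinarith [mul_nonneg hC0 (mul_nonneg hd0 ha0)]
    have ha1 : 0 < (a : ℝ) := lt_of_le_of_lt (by positivity) hcon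
    have h6 := le_of_mul_le_mul_left h5 ha1
    nlinarith
  exact_mod_cast h3

section Mollification

/-! ### Mollification -/

variable {E : Type*} [NormedAddCommGroup E]

/-- Translations are continuous in `L²`. -/
lemma tendsto_eLpNorm_translate {f : Plane → E} (hf : MemLp f 2 volume) :
    Tendsto (fun y : Plane => eLpNorm (fun x => f (x - y) - f x) 2 volume) (𝓝 0) (𝓝 0) := by
  have : Fact ((2 : ℝ≥0∞) ≠ ⊤) := ⟨by norm_num⟩
  have h1 : Tendsto (fun y : Plane => (DomAddAct.mk (-y) : Planeᵈᵃᵃ) +ᵥ hf.toLp f) (𝓝 0)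
      (𝓝 (hf.toLp f)) := by
    have hc : Continuous fun y : Plane => (DomAddAct.mk (-y) : Planeᵈᵃᵃ) +ᵥ hf.toLp f :=
      (DomAddAct.continuous_mk.comp continuous_neg).vadd continuous_const
    have h := hc.tendsto 0
    simpa using h
  have h2 := tendsto_iff_edist_tendsto_0.1 h1
  refine h2.congr fun y => ?_
  rw [DomAddAct.mk_vadd_toLp, Lp.edist_toLp_toLp]
  refine congrArg (fun g => eLpNorm g 2 volume) (funext fun x => ?_)
  simp [sub_eq_neg_add]

variable [NormedSpace ℝ E] [CompleteSpace E]

/-- Averaging against a probability density supported in a ball changes an `L²` function at most as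
much as the translations by vectors of that ball do. -/
lemma eLpNorm_convolution_sub_le {f : Plane → E} (hf : MemLp f 2 volume)
    (hfm : StronglyMeasurable f) {ρ : Plane → ℝ} (hρc : Continuous ρ) (hρ0 : ∀ x, 0 ≤ ρ x)
    (hρi : ∫ x, ρ x = 1) (hρs : HasCompactSupport ρ) {δ : ℝ}
    (hsupp : ∀ x, ρ x ≠ 0 → x ∈ Metric.ball (0 : Plane) δ) {c : ℝ≥0∞}
    (hc : ∀ y ∈ Metric.ball (0 : Plane) δ, eLpNorm (fun x => f (x - y) - f x) 2 volume ≤ c) :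
    eLpNorm (fun x => (∫ y, ρ y • f (x - y)) - f x) 2 volume ≤ c := by
  set r : Plane → ℝ≥0 := fun y => ⟨ρ y, hρ0 y⟩ with hr
  have hrm : Measurable r := hρc.measurable.subtype_mk
  set ν : Measure Plane := volume.withDensity fun y => (r y : ℝ≥0∞) with hν
  have hρint : Integrable ρ := hρc.integrable_of_hasCompactSupport hρs
  have hν1 : IsProbabilityMeasure ν := by
    refine ⟨?_⟩
    rw [hν, withDensity_apply _ MeasurableSet.univ, setLIntegral_univ]
    have h := ofReal_integral_eq_lintegral_ofReal hρint (Eventually.of_forall hρ0)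
    rw [hρi, ENNReal.ofReal_one] at h
    rw [h]
    refine lintegral_congr fun y => ?_
    rw [hr, ENNReal.ofReal, Real.toNNReal_of_nonneg (hρ0 y)]
    rfl
  have hloc : LocallyIntegrable f volume := hf.locallyIntegrable (by norm_num)
  have hint : ∀ x, Integrable (fun y => ρ y • f (x - y)) := fun x =>
    (hρs.convolutionExists_left (ContinuousLinearMap.lsmul ℝ ℝ) hρc hloc x)
  have hintν : ∀ x, Integrable (fun y => f (x - y)) ν := fun x =>
    (integrable_withDensity_iff_integrable_smul hrm).2 (hint x)
  have hpt : ∀ x, ‖(∫ y, ρ y • f (x - y)) - f x‖ₑ ^ 2 ≤ ∫⁻ y, ‖f (x - y) - f x‖ₑ ^ 2 ∂ν := by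
    intro x
    have e1 : ∫ y, ρ y • f (x - y) = ∫ y, f (x - y) ∂ν :=
      (integral_withDensity_eq_integral_smul hrm _).symm
    have e2 : (∫ y, ρ y • f (x - y)) - f x = ∫ y, (f (x - y) - f x) ∂ν := by
      rw [e1, integral_sub (hintν x) (integrable_const _)]
      simp
    rw [e2, ← eLpNorm_two_sq]
    gcongr
    refine (enorm_integral_le_lintegral_enorm _).trans ?_
    rw [← eLpNorm_one_eq_lintegral_enorm]
    refine eLpNorm_le_eLpNorm_of_exponent_le (by norm_num) ?_
    exact (hintν x).aestronglyMeasurable.sub aestronglyMeasurable_const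
  have hmeas : Measurable fun z : Plane × Plane => ‖f (z.1 - z.2) - f z.1‖ₑ ^ 2 := by
    have h1 : StronglyMeasurable fun z : Plane × Plane => f (z.1 - z.2) :=
      hfm.comp_measurable (measurable_fst.sub measurable_snd)
    have h2 : StronglyMeasurable fun z : Plane × Plane => f z.1 :=
      hfm.comp_measurable measurable_fst
    exact (h1.sub h2).enorm.pow_const 2
  rw [← ENNReal.pow_le_pow_left_iff two_ne_zero, eLpNorm_two_sq]
  calc ∫⁻ x, ‖(∫ y, ρ y • f (x - y)) - f x‖ₑ ^ 2
      ≤ ∫⁻ x, ∫⁻ y, ‖f (x - y) - f x‖ₑ ^ 2 ∂ν := lintegral_mono hpt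
    _ = ∫⁻ y, ∫⁻ x, ‖f (x - y) - f x‖ₑ ^ 2 ∂volume ∂ν :=
        lintegral_lintegral_swap hmeas.aemeasurable
    _ ≤ ∫⁻ _, c ^ 2 ∂ν := by
        refine lintegral_mono_ae ?_
        rw [hν, ae_withDensity_iff hrm.coe_nnreal_ennreal]
        refine Eventually.of_forall fun y hy => ?_
        rw [← eLpNorm_two_sq (fun x => f (x - y) - f x)]
        gcongr
        refine hc y (hsupp y fun h => hy ?_)
        have h0 : r y = 0 := NNReal.eq h
        rw [h0, ENNReal.coe_zero]
    _ = c ^ 2 := by simp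

end Mollification

/-! ### Inward shifts and cut-off functions -/

/-- Around `x₀`, on a neighbourhood of radius `r`, arbitrarily small balls of shifts exist that keep
points of `Ω` inside `Ω`: the uniform cone condition. -/
def HasInwardShifts (Ω : Set Plane) (x₀ : Plane) (r : ℝ) : Prop :=
  ∀ η > 0, ∃ (c : Plane) (s : ℝ), 0 < s ∧ Metric.closedBall c s ⊆ Metric.ball 0 η ∧
    ∀ x ∈ Ω ∩ Metric.ball x₀ r, ∀ z ∈ Metric.closedBall c s, x - z ∈ Ω

/-- A Lipschitz domain satisfies the uniform cone condition locally: near a boundary point one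
shifts along the axis over which the boundary is a graph. -/
lemma exists_hasInwardShifts (ho : IsOpen Ω) (hL : HasLipschitzBoundary Ω) {x₀ : Plane}
    (hx₀ : x₀ ∈ closure Ω) : ∃ r > 0, HasInwardShifts Ω x₀ r := by
  rw [closure_eq_self_union_frontier] at hx₀
  rcases hx₀ with hx₀ | hx₀
  · obtain ⟨R, hR, hsub⟩ := Metric.isOpen_iff.1 ho x₀ hx₀
    refine ⟨R / 2, by positivity, fun η hη => ⟨0, min R η / 2, by positivity, ?_, ?_⟩⟩
    · refine Metric.closedBall_subset_ball ?_
      have := min_le_right R η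
      linarith
    · rintro x ⟨_, hx⟩ z hz
      refine hsub ?_
      rw [Metric.mem_ball, dist_eq_norm] at hx ⊢
      rw [mem_closedBall_zero_iff] at hz
      have h1 := min_le_left R η
      calc ‖x - z - x₀‖ = ‖(x - x₀) - z‖ := by congr 1; abel
        _ ≤ ‖x - x₀‖ + ‖z‖ := norm_sub_le _ _
        _ < R := by linarith
  · obtain ⟨Q, K, f, r, hf, hr, hQ⟩ := hL x₀ hx₀
    refine ⟨r / 2, by positivity, fun η hη => ?_⟩
    set d : Plane := Q.symm (EuclideanSpace.single 1 1) with hd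
    have hdn : ‖d‖ = 1 := by rw [hd, Q.symm.norm_map]; simp
    -- the shifts `-τ v` with `v` in the ball of radius `δ` about the upward direction `d`
    set δ : ℝ := 1 / (2 + K) with hδ
    have hK : (0 : ℝ) ≤ K := K.coe_nonneg
    have hδ0 : 0 < δ := by positivity
    have hδe : δ * (2 + K) = 1 := by rw [hδ]; field_simp
    have hKδ : (K : ℝ) * δ < 1 - δ := by nlinarith
    have hδ1 : δ < 1 := by nlinarith
    set τ : ℝ := min η r / 4 with hτ
    have hτ0 : 0 < τ := by positivity
    have hτη : 4 * τ ≤ η := by have := min_le_left η r; linarith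
    have hτr : 4 * τ ≤ r := by have := min_le_right η r; linarith
    have hznorm : ∀ z ∈ Metric.closedBall (-(τ • d)) (τ * δ), ‖z‖ < 2 * τ := by
      intro z hz
      rw [Metric.mem_closedBall, dist_eq_norm] at hz
      have h1 : ‖τ • d‖ = τ := by rw [norm_smul, hdn, mul_one, Real.norm_of_nonneg hτ0.le]
      calc ‖z‖ = ‖(z - -(τ • d)) - τ • d‖ := by congr 1; abel
        _ ≤ ‖z - -(τ • d)‖ + ‖τ • d‖ := norm_sub_le _ _
        _ < 2 * τ := by rw [h1]; nlinarith
    refine ⟨-(τ • d), τ * δ, by positivity, fun z hz => ?_, ?_⟩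
    · rw [mem_ball_zero_iff]; linarith [hznorm z hz]
    · rintro x ⟨hxΩ, hx⟩ z hz
      have hzn := hznorm z hz
      rw [Metric.mem_ball, dist_eq_norm] at hx
      rw [Metric.mem_closedBall, dist_eq_norm] at hz
      have hxb : x ∈ Metric.ball x₀ r := by
        rw [Metric.mem_ball, dist_eq_norm]; linarith
      have hxzb : x - z ∈ Metric.ball x₀ r := by
        rw [Metric.mem_ball, dist_eq_norm]
        calc ‖x - z - x₀‖ = ‖(x - x₀) - z‖ := by congr 1; abel
          _ ≤ ‖x - x₀‖ + ‖z‖ := norm_sub_le _ _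
          _ < r := by linarith
      have hgx := (hQ x hxb).1 hxΩ
      refine (hQ _ hxzb).2 ?_
      set v := Q (z - -(τ • d)) with hv
      have hvn : ‖v‖ ≤ τ * δ := by rw [hv, Q.norm_map]; exact hz
      have hv0 : |v 0| ≤ τ * δ := (PiLp.norm_apply_le v 0).trans hvn
      have hv1 : |v 1| ≤ τ * δ := (PiLp.norm_apply_le v 1).trans hvn
      have hQz : Q (x - z - x₀) = Q (x - x₀) - v + τ • EuclideanSpace.single 1 1 := by
        have : x - z - x₀ = (x - x₀) - (z - -(τ • d)) + τ • d := by abel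
        rw [this, map_add, map_sub, map_smul, ← hv, hd, Q.apply_symm_apply]
      have h0 : Q (x - z - x₀) 0 = Q (x - x₀) 0 - v 0 := by rw [hQz]; simp
      have h1 : Q (x - z - x₀) 1 = Q (x - x₀) 1 - v 1 + τ := by rw [hQz]; simp
      rw [h0, h1]
      have hlip := hf.dist_le_mul (Q (x - x₀) 0 - v 0) (Q (x - x₀) 0)
      rw [Real.dist_eq, Real.dist_eq, sub_sub_cancel_left, abs_neg] at hlip
      have h2 := (abs_le.1 (hlip.trans (mul_le_mul_of_nonneg_left hv0 hK))).2
      have h3 := (abs_le.1 hv1).2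
      have h4 : (K : ℝ) * (τ * δ) < τ - τ * δ := by nlinarith
      linarith

/-- The gradient of a product of a test function with the reflected and shifted `ρ`. -/
lemma gradient_mul_shift {ρ χ : Plane → ℝ} (hρ : ContDiff ℝ 1 ρ) (hχ : ContDiff ℝ 1 χ)
    (x y : Plane) : ∇ (fun y => ρ (x - y) * χ y) y =
      -(χ y • ∇ ρ (x - y)) + ρ (x - y) • ∇ χ y := by
  have h1 := (hρ.differentiable one_ne_zero (x - y)).hasFDerivAt
  have h2 : HasFDerivAt (fun y : Plane => x - y) (-(ContinuousLinearMap.id ℝ Plane)) y :=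
    (hasFDerivAt_id y).const_sub x
  have h3 := (h1.comp y h2).mul (hχ.differentiable one_ne_zero y).hasFDerivAt
  have h4 : fderiv ℝ (fun y => ρ (x - y) * χ y) y =
      -(χ y • fderiv ℝ ρ (x - y)) + ρ (x - y) • fderiv ℝ χ y := by
    refine HasFDerivAt.fderiv (h3.congr_fderiv ?_)
    ext e
    simp
    ring
  simp [gradient, h4]

lemma gradient_convolution {ρ : Plane → ℝ} (hρ : ContDiff ℝ ∞ ρ) (hρs : HasCompactSupport ρ)
    {v : Plane → ℝ} (hv : LocallyIntegrable v volume) (x : Plane) :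
    ∇ (fun x => ∫ y, ρ y • v (x - y)) x = ∫ y, v y • ∇ ρ (x - y) := by
  have h := hρs.hasFDerivAt_convolution_left (ContinuousLinearMap.lsmul ℝ ℝ)
    (hρ.of_le (by simp)) hv x
  have h1 : fderiv ℝ (fun x => ∫ y, ρ y • v (x - y)) x = ∫ y, v (x - y) • fderiv ℝ ρ y := by
    rw [HasFDerivAt.fderiv (f := fun x => ∫ y, ρ y • v (x - y)) h, convolution_def]
    refine integral_congr_ae (Eventually.of_forall fun y => ?_)
    ext e
    simp [ContinuousLinearMap.precompL_apply, mul_comm]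
  have hgc : Continuous (∇ ρ) := continuous_gradient_of_contDiff (hρ.of_le (by simp))
  have hgs : HasCompactSupport (∇ ρ) :=
    (hρs.fderiv (𝕜 := ℝ)).comp_left (g := (InnerProductSpace.toDual ℝ Plane).symm) (by simp)
  have hint : Integrable fun y => v y • ∇ ρ (x - y) :=
    hv.integrable_smul_right_of_hasCompactSupport (hgc.comp (by fun_prop))
      (hgs.comp_homeomorph (Homeomorph.subLeft x))
  have hint' : Integrable fun y => v (x - y) • fderiv ℝ ρ y :=
    (hρs.fderiv (𝕜 := ℝ)).convolutionExists_left (ContinuousLinearMap.lsmul ℝ ℝ).flip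
      (hρ.continuous_fderiv (by simp)) hv x
  rw [gradient, h1]
  refine ext_inner_right ℝ fun e => ?_
  rw [InnerProductSpace.toDual_symm_apply, ContinuousLinearMap.integral_apply hint',
    real_inner_comm, ← integral_inner hint, ← integral_sub_left_eq_self _ volume x]
  refine integral_congr_ae (Eventually.of_forall fun y => ?_)
  simp only [sub_sub_cancel, smul_apply, smul_eq_mul, real_inner_smul_right]
  rw [gradient, real_inner_comm, InnerProductSpace.toDual_symm_apply]

/-- Inside `Ω` the gradient of the mollification of `χ u` is the mollification of the weak gradient
`χ G + u ∇χ`, as long as the mollification only sees points of `Ω`. -/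
lemma gradient_convolution_cutoff (hΩm : MeasurableSet Ω) {u : Plane → ℝ} {G : Plane → Plane}
    (hu : MemLp u 2 (volume.restrict Ω)) (hG : MemLp G 2 (volume.restrict Ω))
    (hw : IsWeakGradient Ω u G) {ρ χ : Plane → ℝ} (hρ : ContDiff ℝ ∞ ρ)
    (hρs : HasCompactSupport ρ) (hχ : ContDiff ℝ ∞ χ) (hχs : HasCompactSupport χ) {x : Plane}
    (hx : ∀ y, x - y ∈ tsupport ρ → y ∈ tsupport χ → y ∈ Ω)
    (hv : LocallyIntegrable (Ω.indicator fun y => χ y * u y) volume) :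
    ∇ (fun x => ∫ y, ρ y • (Ω.indicator fun y => χ y * u y) (x - y)) x =
      ∫ y, ρ y • (Ω.indicator fun y => χ y • G y + u y • ∇ χ y) (x - y) := by
  have hρ1 : ContDiff ℝ 1 ρ := hρ.of_le (by simp)
  have hχ1 : ContDiff ℝ 1 χ := hχ.of_le (by simp)
  have hsub : ContDiff ℝ ∞ fun y : Plane => x - y := contDiff_const.sub contDiff_id
  have hρx : ContDiff ℝ ∞ fun y => ρ (x - y) := hρ.comp hsub
  set φ : Plane → ℝ := fun y => ρ (x - y) * χ y with hφ
  have hφd : ContDiff ℝ ∞ φ := hρx.mul hχ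
  have hφs : HasCompactSupport φ := hχs.mul_left
  have hφt : tsupport φ ⊆ Ω := by
    intro y hy
    refine hx y ?_ (closure_mono (Function.support_mul_subset_right _ _) hy)
    have h1 : y ∈ tsupport fun y => ρ (x - y) :=
      closure_mono (Function.support_mul_subset_left _ _) hy
    have h2 : IsClosed ((fun y => x - y) ⁻¹' tsupport ρ) :=
      (isClosed_tsupport ρ).preimage (by fun_prop)
    have h3 : (Function.support fun y => ρ (x - y)) ⊆ (fun y => x - y) ⁻¹' tsupport ρ := by
      intro z hz
      have hz' : x - z ∈ Function.support ρ := hz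
      exact mem_preimage.2 (subset_tsupport ρ hz')
    exact closure_minimal h3 h2 h1
  have hweak := hw φ hφd hφs hφt
  have hgρ : Continuous fun y => ∇ ρ (x - y) :=
    (continuous_gradient_of_contDiff hρ1).comp (by fun_prop)
  have hgχ : Continuous (∇ χ) := continuous_gradient_of_contDiff hχ1
  -- the integrability of the products that occur below
  have i1 : Integrable (fun y => u y • (χ y • ∇ ρ (x - y))) (volume.restrict Ω) := by
    have h1 : MemLp (fun y => χ y • ∇ ρ (x - y)) 2 (volume.restrict Ω) :=
      (hχ.continuous.smul hgρ).memLp_of_hasCompactSupport hχs.smul_right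
    exact memLp_one_iff_integrable.1 (h1.smul hu)
  have i2 : Integrable (fun y => u y • (ρ (x - y) • ∇ χ y)) (volume.restrict Ω) := by
    have hgs : HasCompactSupport (∇ χ) :=
      (hχs.fderiv (𝕜 := ℝ)).comp_left (g := (InnerProductSpace.toDual ℝ Plane).symm) (by simp)
    have h1 : MemLp (fun y => ρ (x - y) • ∇ χ y) 2 (volume.restrict Ω) :=
      (hρx.continuous.smul hgχ).memLp_of_hasCompactSupport hgs.smul_left
    exact memLp_one_iff_integrable.1 (h1.smul hu)
  have i3 : Integrable (fun y => φ y • G y) (volume.restrict Ω) :=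
    memLp_one_iff_integrable.1 (hG.smul (memLp_test hφd hφs (volume.restrict Ω)))
  have e1 : ∫ y in Ω, u y • ∇ φ y =
      -(∫ y in Ω, u y • (χ y • ∇ ρ (x - y))) + ∫ y in Ω, u y • (ρ (x - y) • ∇ χ y) := by
    have i1n : Integrable (fun y => -(u y • (χ y • ∇ ρ (x - y)))) (volume.restrict Ω) := i1.neg
    rw [← integral_neg, ← integral_add i1n i2]
    refine integral_congr_ae (Eventually.of_forall fun y => ?_)
    simp only [hφ, gradient_mul_shift hρ1 hχ1, smul_add, smul_neg]
  rw [e1] at hweak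
  rw [gradient_convolution hρ hρs hv]
  have e2 : ∫ y, (Ω.indicator fun y => χ y * u y) y • ∇ ρ (x - y) =
      ∫ y in Ω, u y • (χ y • ∇ ρ (x - y)) := by
    rw [← integral_indicator hΩm]
    refine integral_congr_ae (Eventually.of_forall fun y => ?_)
    by_cases hy : y ∈ Ω
    · simp only [indicator_of_mem hy, smul_smul, mul_comm]
    · simp only [indicator_of_notMem hy, zero_smul]
  have e3 : ∫ y, ρ y • (Ω.indicator fun y => χ y • G y + u y • ∇ χ y) (x - y) =
      (∫ y in Ω, φ y • G y) + ∫ y in Ω, u y • (ρ (x - y) • ∇ χ y) := by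
    rw [← integral_add i3 i2, ← integral_indicator hΩm, ← integral_sub_left_eq_self _ volume x]
    refine integral_congr_ae (Eventually.of_forall fun y => ?_)
    simp only [sub_sub_cancel]
    by_cases hy : y ∈ Ω
    · simp only [indicator_of_mem hy, hφ]
      module
    · simp only [indicator_of_notMem hy, smul_zero]
  rw [e2, e3]
  have h := eq_sub_of_add_eq hweak
  rw [neg_eq_iff_eq_neg] at h
  rw [h]
  abel

/-! ### Density of smooth functions -/

lemma hasCompactSupport_gradient {χ : Plane → ℝ} (hχs : HasCompactSupport χ) :
    HasCompactSupport (∇ χ) :=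
  (hχs.fderiv (𝕜 := ℝ)).comp_left (g := (InnerProductSpace.toDual ℝ Plane).symm) (by simp)

/-- The product of an `H¹` function with a cut-off function that is supported where the uniform cone
condition holds is a limit of smooth functions: one mollifies with a kernel supported in a ball of
inward shifts. -/
lemma exists_approx_cutoff (ho : IsOpen Ω) {x₀ : Plane} {r : ℝ} (hr : HasInwardShifts Ω x₀ r)
    {u : Plane → ℝ} {G : Plane → Plane} (hu : MemLp u 2 (volume.restrict Ω))
    (hG : MemLp G 2 (volume.restrict Ω)) (hum : StronglyMeasurable u) (hGm : StronglyMeasurable G)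
    (hw : IsWeakGradient Ω u G) {χ : Plane → ℝ} (hχ : ContDiff ℝ ∞ χ) (hχs : HasCompactSupport χ)
    (hχt : tsupport χ ⊆ Metric.ball x₀ r) {ε : ℝ≥0} (hε : 0 < ε) :
    ∃ w : Plane → ℝ, ContDiff ℝ 1 w ∧
      eLpNorm (w - fun y => χ y * u y) 2 (volume.restrict Ω) ≤ ε ∧
      eLpNorm (∇ w - fun y => χ y • G y + u y • ∇ χ y) 2 (volume.restrict Ω) ≤ ε := by
  have hχ1 : ContDiff ℝ 1 χ := hχ.of_le (by simp)
  have hgχ : Continuous (∇ χ) := continuous_gradient_of_contDiff hχ1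
  have hΩm := ho.measurableSet
  have hχtop : MemLp χ ⊤ (volume.restrict Ω) := hχ.continuous.memLp_of_hasCompactSupport hχs
  have hgχtop : MemLp (∇ χ) ⊤ (volume.restrict Ω) :=
    hgχ.memLp_of_hasCompactSupport (hasCompactSupport_gradient hχs)
  set f₁ : Plane → ℝ := Ω.indicator fun y => χ y * u y with hf₁
  set f₂ : Plane → Plane := Ω.indicator fun y => χ y • G y + u y • ∇ χ y with hf₂
  have m₁ : MemLp f₁ 2 volume := by
    rw [hf₁, memLp_indicator_iff_restrict hΩm]
    exact hu.smul (p := ⊤) hχtop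
  have m₂ : MemLp f₂ 2 volume := by
    rw [hf₂, memLp_indicator_iff_restrict hΩm]
    exact (hG.smul (p := ⊤) hχtop).add (hgχtop.smul (r := 2) hu)
  have s₁ : StronglyMeasurable f₁ := (hχ.continuous.stronglyMeasurable.mul hum).indicator hΩm
  have s₂ : StronglyMeasurable f₂ :=
    ((hχ.continuous.stronglyMeasurable.smul hGm).add
      (hum.smul hgχ.stronglyMeasurable)).indicator hΩm
  have hε' : (0 : ℝ≥0∞) < ε := by exact_mod_cast hε
  have hev := ((tendsto_eLpNorm_translate m₁).eventually (ge_mem_nhds hε')).and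
    ((tendsto_eLpNorm_translate m₂).eventually (ge_mem_nhds hε'))
  obtain ⟨η₁, hη₁, hball⟩ := Metric.eventually_nhds_iff_ball.1 hev
  obtain ⟨η₂, hη₂, hthick⟩ := IsCompact.exists_thickening_subset_open hχs Metric.isOpen_ball hχt
  obtain ⟨c, s, hs, hcs, hshift⟩ := hr (min η₁ η₂) (lt_min hη₁ hη₂)
  let bump : ContDiffBump c := ⟨s / 2, s, by positivity, by linarith⟩
  set ρ : Plane → ℝ := bump.normed volume with hρ
  have hρd : ContDiff ℝ ∞ ρ := bump.contDiff_normed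
  have hρs : HasCompactSupport ρ := bump.hasCompactSupport_normed
  have hρt : tsupport ρ = Metric.closedBall c s := bump.tsupport_normed_eq
  have hρsupp : ∀ x, ρ x ≠ 0 → x ∈ Metric.ball (0 : Plane) η₁ := by
    intro x hx
    have h1 : x ∈ tsupport ρ := subset_tsupport ρ hx
    rw [hρt] at h1
    exact Metric.ball_subset_ball (min_le_left _ _) (hcs h1)
  have hloc : LocallyIntegrable f₁ volume := m₁.locallyIntegrable (by norm_num)
  set w : Plane → ℝ := fun x => ∫ y, ρ y • f₁ (x - y) with hwdef
  have hwd : ContDiff ℝ 1 w :=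
    (hρs.contDiff_convolution_left (ContinuousLinearMap.lsmul ℝ ℝ) (n := 1)
      (hρd.of_le (by simp)) hloc)
  have hgrad : ∀ x ∈ Ω, ∇ w x = ∫ y, ρ y • f₂ (x - y) := by
    intro x hx
    refine gradient_convolution_cutoff hΩm hu hG hw hρd hρs hχ hχs ?_ hloc
    intro y hy hyχ
    rw [hρt] at hy
    have hxb : x ∈ Metric.ball x₀ r := by
      refine hthick (Metric.mem_thickening_iff.2 ⟨y, hyχ, ?_⟩)
      have h1 := hcs hy
      rw [mem_ball_zero_iff, ← dist_eq_norm] at h1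
      exact h1.trans_le (min_le_right _ _)
    have := hshift x ⟨hx, hxb⟩ (x - y) hy
    rwa [sub_sub_cancel] at this
  have c₁ := eLpNorm_convolution_sub_le m₁ s₁ bump.continuous_normed bump.nonneg_normed
    bump.integral_normed hρs hρsupp fun y hy => (hball y hy).1
  have c₂ := eLpNorm_convolution_sub_le m₂ s₂ bump.continuous_normed bump.nonneg_normed
    bump.integral_normed hρs hρsupp fun y hy => (hball y hy).2
  refine ⟨w, hwd, ?_, ?_⟩
  · refine le_trans (le_of_eq ?_)
      ((eLpNorm_mono_measure _ (Measure.restrict_le_self (s := Ω))).trans c₁)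
    refine eLpNorm_congr_ae ?_
    filter_upwards [ae_restrict_mem hΩm] with x hx
    simp only [Pi.sub_apply, hf₁, indicator_of_mem hx, hwdef]
    rfl
  · refine le_trans (le_of_eq ?_)
      ((eLpNorm_mono_measure _ (Measure.restrict_le_self (s := Ω))).trans c₂)
    refine eLpNorm_congr_ae ?_
    filter_upwards [ae_restrict_mem hΩm] with x hx
    simp only [Pi.sub_apply, hgrad x hx, hf₂, indicator_of_mem hx]
    rfl

/-- A smooth partition of unity on `closure Ω`, subordinate to balls on which the uniform cone
condition holds. -/
lemma exists_partition (ho : IsOpen Ω) (hb : Bornology.IsBounded Ω) (hL : HasLipschitzBoundary Ω) :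
    ∃ (ι : Type) (_ : Fintype ι) (χ : ι → Plane → ℝ),
      (∀ i, ContDiff ℝ ∞ (χ i) ∧ HasCompactSupport (χ i) ∧
        ∃ x₀ r, HasInwardShifts Ω x₀ r ∧ tsupport (χ i) ⊆ Metric.ball x₀ r) ∧
      ∀ x ∈ Ω, ∑ i, χ i x = 1 := by
  choose! r hr hshift using fun x (hx : x ∈ closure Ω) => exists_hasInwardShifts ho hL hx
  obtain ⟨t, ht, hcov⟩ := hb.isCompact_closure.elim_nhds_subcover (fun x => Metric.ball x (r x))
    fun x hx => Metric.ball_mem_nhds x (hr x hx)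
  have hcov' : closure Ω ⊆ ⋃ i : t, Metric.ball (i : Plane) (r i) := by
    rw [iUnion_subtype]; exact hcov
  obtain ⟨f, hf⟩ := SmoothPartitionOfUnity.exists_isSubordinate 𝓘(ℝ, Plane) isClosed_closure
    (fun i : t => Metric.ball (i : Plane) (r i)) (fun _ => Metric.isOpen_ball) hcov'
  let e := t.equivFin
  refine ⟨Fin t.card, inferInstance, fun i => f (e.symm i), fun i => ⟨?_, ?_, ?_⟩, ?_⟩
  · exact (f (e.symm i)).contMDiff.contDiff
  · exact Metric.isBounded_ball.isCompact_closure.of_isClosed_subset (isClosed_tsupport _)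
      ((hf (e.symm i)).trans subset_closure)
  · exact ⟨_, _, hshift _ (ht _ (e.symm i).2), hf (e.symm i)⟩
  · intro x hx
    have h := f.sum_eq_one (subset_closure hx)
    rw [finsum_eq_sum_of_fintype] at h
    rw [← h]
    exact Equiv.sum_comp e.symm fun i => f i x

lemma gradient_fun_sum {ι : Type*} (s : Finset ι) {f : ι → Plane → ℝ} (hf : ∀ i, ContDiff ℝ 1 (f i))
    (x : Plane) : ∇ (fun x => ∑ i ∈ s, f i x) x = ∑ i ∈ s, ∇ (f i) x := by
  simp only [gradient]
  rw [fderiv_fun_sum fun i _ => (hf i).differentiable one_ne_zero x, map_sum]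

/-- On a bounded Lipschitz domain the functions that are smooth up to the boundary are dense in
`H¹`. -/
lemma exists_smooth_approx (ho : IsOpen Ω) (hb : Bornology.IsBounded Ω)
    (hL : HasLipschitzBoundary Ω) (u : H1 Ω) {ε : ℝ≥0} (hε : 0 < ε) :
    ∃ w : Plane → ℝ, ContDiff ℝ 1 w ∧ eLpNorm (w - ⇑(fn u)) 2 (volume.restrict Ω) ≤ ε ∧
      eLpNorm (∇ w - ⇑(wgrad u)) 2 (volume.restrict Ω) ≤ ε := by
  obtain ⟨ι, _, χ, hχ, hsum⟩ := exists_partition ho hb hL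
  choose hχd hχs x₀ r hshift hχt using hχ
  have hε' : 0 < ε / (Fintype.card ι + 1) := by positivity
  have hχ1 : ∀ i, ContDiff ℝ 1 (χ i) := fun i => (hχd i).of_le (by simp)
  choose w hwd hw1 hw2 using fun i => exists_approx_cutoff ho (hshift i) (Lp.memLp (fn u))
    (Lp.memLp (wgrad u)) (Lp.stronglyMeasurable (fn u)) (Lp.stronglyMeasurable (wgrad u)) u.2
    (hχd i) (hχs i) (hχt i) hε'
  have hgsum : ∀ x ∈ Ω, ∑ i, ∇ (χ i) x = 0 := by
    intro x hx
    rw [← gradient_fun_sum _ hχ1]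
    have h1 : (fun x => ∑ i, χ i x) =ᶠ[𝓝 x] fun _ => (1 : ℝ) := by
      filter_upwards [ho.mem_nhds hx] with y hy using hsum y hy
    rw [gradient, h1.fderiv_eq]
    simp
  have hcard : (∑ _i : ι, ((ε / (Fintype.card ι + 1) : ℝ≥0) : ℝ≥0∞)) ≤ ε := by
    rw [Finset.sum_const, nsmul_eq_mul, Finset.card_univ]
    have : (Fintype.card ι : ℝ≥0) * (ε / (Fintype.card ι + 1)) ≤ ε := by
      rw [mul_div_assoc', div_le_iff₀ (by positivity), mul_comm ε]
      gcongr
      simp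
    exact_mod_cast this
  have hum := (Lp.stronglyMeasurable (fn u)).aestronglyMeasurable (μ := volume.restrict Ω)
  have hGm := (Lp.stronglyMeasurable (wgrad u)).aestronglyMeasurable (μ := volume.restrict Ω)
  refine ⟨fun x => ∑ i, w i x, ContDiff.sum fun i _ => hwd i, ?_, ?_⟩
  · have e : ((fun x => ∑ i, w i x) - ⇑(fn u)) =ᵐ[volume.restrict Ω]
        ∑ i, (w i - fun y => χ i y * fn u y) := by
      filter_upwards [ae_restrict_mem ho.measurableSet] with x hx
      simp only [Pi.sub_apply, Finset.sum_apply, Finset.sum_sub_distrib, ← Finset.sum_mul,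
        hsum x hx, one_mul]
    rw [eLpNorm_congr_ae e]
    refine (eLpNorm_sum_le (fun i _ => ?_) (by norm_num)).trans
      ((Finset.sum_le_sum fun i _ => hw1 i).trans hcard)
    exact (hwd i).continuous.aestronglyMeasurable.sub
      ((hχd i).continuous.aestronglyMeasurable.mul hum)
  · have e : (∇ (fun x => ∑ i, w i x) - ⇑(wgrad u)) =ᵐ[volume.restrict Ω]
        ∑ i, (∇ (w i) - fun y => χ i y • wgrad u y + fn u y • ∇ (χ i) y) := by
      filter_upwards [ae_restrict_mem ho.measurableSet] with x hx
      simp only [Pi.sub_apply, Finset.sum_apply, Finset.sum_sub_distrib, Finset.sum_add_distrib,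
        ← Finset.sum_smul, ← Finset.smul_sum, hsum x hx, one_smul, hgsum x hx, smul_zero, add_zero,
        gradient_fun_sum _ hwd]
    rw [eLpNorm_congr_ae e]
    refine (eLpNorm_sum_le (fun i _ => ?_) (by norm_num)).trans
      ((Finset.sum_le_sum fun i _ => hw2 i).trans hcard)
    exact (continuous_gradient_of_contDiff (hwd i)).aestronglyMeasurable.sub
      (((hχd i).continuous.aestronglyMeasurable.smul hGm).add
        (hum.smul (continuous_gradient_of_contDiff (hχ1 i)).aestronglyMeasurable))

/-! ### Traces and inequalities for Sobolev functions -/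

lemma eLpNorm_le_add_sub {E : Type*} [NormedAddCommGroup E] {μ : Measure Plane} {f g : Plane → E}
    (hf : AEStronglyMeasurable f μ) (hg : AEStronglyMeasurable g μ) :
    eLpNorm f 2 μ ≤ eLpNorm g 2 μ + eLpNorm (f - g) 2 μ := by
  have h := eLpNorm_add_le (p := 2) hg (hf.sub hg) (by norm_num)
  rwa [add_sub_cancel] at h

lemma eLpNorm_le_add_sub' {E : Type*} [NormedAddCommGroup E] {μ : Measure Plane} {f g : Plane → E}
    (hf : AEStronglyMeasurable f μ) (hg : AEStronglyMeasurable g μ) :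
    eLpNorm g 2 μ ≤ eLpNorm f 2 μ + eLpNorm (f - g) 2 μ := by
  have h := eLpNorm_le_add_sub hg hf
  rwa [eLpNorm_sub_comm] at h

lemma eLpNorm_sub_le_of_sub {E : Type*} [NormedAddCommGroup E] {μ : Measure Plane}
    {f g h : Plane → E} (hf : AEStronglyMeasurable f μ) (hg : AEStronglyMeasurable g μ)
    (hh : AEStronglyMeasurable h μ) :
    eLpNorm (f - g) 2 μ ≤ eLpNorm (f - h) 2 μ + eLpNorm (g - h) 2 μ := by
  have e : f - g = (f - h) - (g - h) := by abel
  rw [e]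
  exact eLpNorm_sub_le (hf.sub hh) (hg.sub hh) (by norm_num)

lemma gradient_sub_of_contDiff {f g : Plane → ℝ} (hf : ContDiff ℝ 1 f) (hg : ContDiff ℝ 1 g) :
    ∇ (f - g) = ∇ f - ∇ g := by
  funext x
  have h1 := hf.differentiable one_ne_zero x
  have h2 := hg.differentiable one_ne_zero x
  simp [gradient, fderiv_sub h1 h2]

lemma memLp_bdry [IsFiniteMeasure (bdry Ω)] (hb : Bornology.IsBounded Ω) {w : Plane → ℝ}
    (hw : Continuous w) : MemLp w 2 (bdry Ω) := by
  obtain ⟨M, hM⟩ := (hb.isCompact_closure.image_of_continuousOn hw.norm.continuousOn).bddAbove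
  refine MemLp.of_bound hw.aestronglyMeasurable M ?_
  filter_upwards [ae_restrict_mem isClosed_frontier.measurableSet] with x hx
  exact hM (mem_image_of_mem _ (frontier_subset_closure hx))

/-- A trace exists: the trace inequality turns an approximating sequence in `H¹(Ω)` into a Cauchy
sequence of boundary values in `L²(∂Ω)`. -/
lemma exists_isTrace (ho : IsOpen Ω) (hb : Bornology.IsBounded Ω) (hL : HasLipschitzBoundary Ω)
    [IsFiniteMeasure (bdry Ω)] {C : ℝ≥0} (hC : ∀ w : Plane → ℝ, ContDiff ℝ 1 w →
      eLpNorm w 2 (bdry Ω) ≤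
        C * (eLpNorm w 2 (volume.restrict Ω) + eLpNorm (∇ w) 2 (volume.restrict Ω)))
    (u : H1 Ω) : ∃ t, IsTrace u t := by
  have hε : ∀ n : ℕ, (0 : ℝ≥0) < (1 / 2) ^ n := fun n => by positivity
  choose w hwd hw1 hw2 using fun n => exists_smooth_approx ho hb hL u (hε n)
  have hwm : ∀ n, AEStronglyMeasurable (w n) (volume.restrict Ω) := fun n =>
    (hwd n).continuous.aestronglyMeasurable
  have hgm : ∀ n, AEStronglyMeasurable (∇ (w n)) (volume.restrict Ω) := fun n =>
    (continuous_gradient_of_contDiff (hwd n)).aestronglyMeasurable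
  set T : ℕ → Lp ℝ 2 (bdry Ω) := fun n => (memLp_bdry hb (hwd n).continuous).toLp (w n) with hT
  have hhalf : ∀ n : ℕ, (((1 / 2 : ℝ≥0) ^ n : ℝ≥0) : ℝ≥0∞) = (2 ^ n)⁻¹ := by
    intro n
    rw [ENNReal.coe_pow, ENNReal.coe_div two_ne_zero, ENNReal.coe_one, one_div, ENNReal.inv_pow]
    rfl
  have hcauchy : CauchySeq T := by
    refine cauchySeq_of_edist_le_geometric_two (4 * C) (by finiteness) fun n => ?_
    rw [hT, Lp.edist_toLp_toLp]
    refine (hC (w n - w (n + 1)) ((hwd n).sub (hwd (n + 1)))).trans ?_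
    rw [gradient_sub_of_contDiff (hwd n) (hwd (n + 1))]
    have hle : ((1 / 2 : ℝ≥0) ^ (n + 1) : ℝ≥0) ≤ (1 / 2) ^ n :=
      pow_le_pow_of_le_one (by positivity)
        (by rw [one_div]; exact inv_le_one_of_one_le₀ (by norm_num)) (Nat.le_succ n)
    have hle' : (((1 / 2 : ℝ≥0) ^ (n + 1) : ℝ≥0) : ℝ≥0∞) ≤ (((1 / 2) ^ n : ℝ≥0) : ℝ≥0∞) := by
      exact_mod_cast hle
    have e1 := (eLpNorm_sub_le_of_sub (hwm n) (hwm (n + 1)) (Lp.aestronglyMeasurable (fn u))).trans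
      (add_le_add (hw1 n) ((hw1 (n + 1)).trans hle'))
    have e2 := (eLpNorm_sub_le_of_sub (hgm n) (hgm (n + 1))
      (Lp.aestronglyMeasurable (wgrad u))).trans (add_le_add (hw2 n) ((hw2 (n + 1)).trans hle'))
    calc _ ≤ (C : ℝ≥0∞) * (((((1 / 2) ^ n : ℝ≥0) : ℝ≥0∞) + (((1 / 2) ^ n : ℝ≥0) : ℝ≥0∞)) +
          ((((1 / 2) ^ n : ℝ≥0) : ℝ≥0∞) + (((1 / 2) ^ n : ℝ≥0) : ℝ≥0∞))) := by gcongr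
      _ = _ := by rw [hhalf, ENNReal.div_eq_inv_mul]; ring
  obtain ⟨t, ht⟩ := cauchySeq_tendsto_of_complete hcauchy
  have hlim : Tendsto (fun n : ℕ => (((1 / 2 : ℝ≥0) ^ n : ℝ≥0) : ℝ≥0∞)) atTop (𝓝 0) := by
    rw [← ENNReal.coe_zero, ENNReal.tendsto_coe]
    refine NNReal.tendsto_pow_atTop_nhds_zero_of_lt_one ?_
    rw [one_div]
    exact inv_lt_one_of_one_lt₀ (by norm_num)
  refine ⟨t, w, hwd, ?_, ?_, ?_⟩
  · exact tendsto_of_tendsto_of_tendsto_of_le_of_le tendsto_const_nhds hlim (fun _ => zero_le) hw1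
  · exact tendsto_of_tendsto_of_tendsto_of_le_of_le tendsto_const_nhds hlim (fun _ => zero_le) hw2
  · refine (tendsto_iff_edist_tendsto_0.1 ht).congr fun n => ?_
    rw [Lp.edist_def]
    refine eLpNorm_congr_ae ?_
    filter_upwards [MemLp.coeFn_toLp (memLp_bdry hb (hwd n).continuous)] with x hx
    simp only [Pi.sub_apply, hT, hx]

/-- The trace inequality passes to the limit. -/
lemma IsTrace.eLpNorm_le {C : ℝ≥0} (hC : ∀ w : Plane → ℝ, ContDiff ℝ 1 w →
      eLpNorm w 2 (bdry Ω) ≤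
        C * (eLpNorm w 2 (volume.restrict Ω) + eLpNorm (∇ w) 2 (volume.restrict Ω)))
    {u : H1 Ω} {t : Lp ℝ 2 (bdry Ω)} (h : IsTrace u t) : ‖t‖ₑ ≤ C * (‖fn u‖ₑ + ‖wgrad u‖ₑ) := by
  obtain ⟨w, hwd, h1, h2, h3⟩ := h
  have hlim : Tendsto (fun n => C * ((‖fn u‖ₑ + eLpNorm (w n - ⇑(fn u)) 2 (volume.restrict Ω)) +
      (‖wgrad u‖ₑ + eLpNorm (∇ (w n) - ⇑(wgrad u)) 2 (volume.restrict Ω))) +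
      eLpNorm (w n - ⇑t) 2 (bdry Ω)) atTop (𝓝 (C * ((‖fn u‖ₑ + 0) + (‖wgrad u‖ₑ + 0)) + 0)) :=
    (ENNReal.Tendsto.const_mul ((h1.const_add _).add (h2.const_add _))
      (Or.inr ENNReal.coe_ne_top)).add h3
  simp only [add_zero] at hlim
  refine ge_of_tendsto' hlim fun n => ?_
  rw [Lp.enorm_def, Lp.enorm_def, Lp.enorm_def]
  refine (eLpNorm_le_add_sub' (hwd n).continuous.aestronglyMeasurable
    (Lp.aestronglyMeasurable t)).trans ?_
  gcongr
  refine (hC _ (hwd n)).trans ?_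
  gcongr
  · exact eLpNorm_le_add_sub (hwd n).continuous.aestronglyMeasurable (Lp.aestronglyMeasurable _)
  · exact eLpNorm_le_add_sub (continuous_gradient_of_contDiff (hwd n)).aestronglyMeasurable
      (Lp.aestronglyMeasurable _)

/-- The Friedrichs inequality passes to the limit. -/
lemma IsTrace.friedrichs {C : ℝ≥0} (hC : ∀ w : Plane → ℝ, ContDiff ℝ 1 w →
      eLpNorm w 2 (volume.restrict Ω) ≤
        C * (eLpNorm (∇ w) 2 (volume.restrict Ω) + eLpNorm w 2 (bdry Ω)))
    {u : H1 Ω} {t : Lp ℝ 2 (bdry Ω)} (h : IsTrace u t) : ‖fn u‖ₑ ≤ C * (‖wgrad u‖ₑ + ‖t‖ₑ) := by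
  obtain ⟨w, hwd, h1, h2, h3⟩ := h
  have hlim : Tendsto (fun n =>
      C * ((‖wgrad u‖ₑ + eLpNorm (∇ (w n) - ⇑(wgrad u)) 2 (volume.restrict Ω)) +
      (‖t‖ₑ + eLpNorm (w n - ⇑t) 2 (bdry Ω))) + eLpNorm (w n - ⇑(fn u)) 2 (volume.restrict Ω)) atTop
      (𝓝 (C * ((‖wgrad u‖ₑ + 0) + (‖t‖ₑ + 0)) + 0)) :=
    (ENNReal.Tendsto.const_mul ((h2.const_add _).add (h3.const_add _))
      (Or.inr ENNReal.coe_ne_top)).add h1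
  simp only [add_zero] at hlim
  refine ge_of_tendsto' hlim fun n => ?_
  rw [Lp.enorm_def, Lp.enorm_def, Lp.enorm_def]
  refine (eLpNorm_le_add_sub' (hwd n).continuous.aestronglyMeasurable
    (Lp.aestronglyMeasurable _)).trans ?_
  gcongr
  refine (hC _ (hwd n)).trans ?_
  gcongr
  · exact eLpNorm_le_add_sub (continuous_gradient_of_contDiff (hwd n)).aestronglyMeasurable
      (Lp.aestronglyMeasurable _)
  · exact eLpNorm_le_add_sub (hwd n).continuous.aestronglyMeasurable (Lp.aestronglyMeasurable _)

/-- The embedding `H¹(Ω) ⊂ L⁴(Ω)`, by Fatou's lemma along an approximating sequence. -/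
lemma eLpNorm_four_fn_le {C : ℝ≥0} (hC : ∀ w : Plane → ℝ, ContDiff ℝ 1 w →
      eLpNorm w 4 (volume.restrict Ω) ≤
        C * (eLpNorm w 2 (volume.restrict Ω) + eLpNorm (∇ w) 2 (volume.restrict Ω)))
    {u : H1 Ω} {t : Lp ℝ 2 (bdry Ω)} (h : IsTrace u t) :
    eLpNorm (fn u) 4 (volume.restrict Ω) ≤ C * (‖fn u‖ₑ + ‖wgrad u‖ₑ) := by
  obtain ⟨w, hwd, h1, h2, -⟩ := h
  have hwm : ∀ n, AEStronglyMeasurable (w n) (volume.restrict Ω) := fun n =>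
    (hwd n).continuous.aestronglyMeasurable
  have hmeas : TendstoInMeasure (volume.restrict Ω) w atTop (fn u) :=
    tendstoInMeasure_of_tendsto_eLpNorm two_ne_zero hwm (Lp.aestronglyMeasurable _) h1
  obtain ⟨ns, hns, hae⟩ := hmeas.exists_seq_tendsto_ae
  refine (Lp.eLpNorm_lim_le_liminf_eLpNorm (fun n => hwm (ns n)) _ hae).trans ?_
  have hlim : Tendsto (fun n => C * ((‖fn u‖ₑ + eLpNorm (w n - ⇑(fn u)) 2 (volume.restrict Ω)) +
      (‖wgrad u‖ₑ + eLpNorm (∇ (w n) - ⇑(wgrad u)) 2 (volume.restrict Ω)))) atTop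
      (𝓝 (C * ((‖fn u‖ₑ + 0) + (‖wgrad u‖ₑ + 0)))) :=
    ENNReal.Tendsto.const_mul ((h1.const_add _).add (h2.const_add _)) (Or.inr ENNReal.coe_ne_top)
  simp only [add_zero] at hlim
  rw [← (hlim.comp hns.tendsto_atTop).liminf_eq]
  refine liminf_le_liminf (Eventually.of_forall fun n => (hC _ (hwd (ns n))).trans ?_)
  simp only [Function.comp_apply]
  rw [Lp.enorm_def, Lp.enorm_def]
  gcongr
  · exact eLpNorm_le_add_sub (hwm _) (Lp.aestronglyMeasurable _)
  · exact eLpNorm_le_add_sub (continuous_gradient_of_contDiff (hwd _)).aestronglyMeasurable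
      (Lp.aestronglyMeasurable _)

lemma fn_add (u v : H1 Ω) : fn (u + v) = fn u + fn v := rfl
lemma fn_smul (c : ℝ) (u : H1 Ω) : fn (c • u) = c • fn u := rfl
lemma wgrad_add (u v : H1 Ω) : wgrad (u + v) = wgrad u + wgrad v := rfl
lemma wgrad_smul (c : ℝ) (u : H1 Ω) : wgrad (c • u) = c • wgrad u := rfl

lemma norm_sq_H1 (u : H1 Ω) : ‖u‖ ^ 2 = ‖fn u‖ ^ 2 + ‖wgrad u‖ ^ 2 :=
  WithLp.prod_norm_sq_eq_of_L2 u.1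

lemma norm_fn_le (u : H1 Ω) : ‖fn u‖ ≤ ‖u‖ := by
  refine le_of_sq_le_sq ?_ (norm_nonneg u)
  rw [norm_sq_H1]; nlinarith [sq_nonneg ‖wgrad u‖]

lemma norm_wgrad_le (u : H1 Ω) : ‖wgrad u‖ ≤ ‖u‖ := by
  refine le_of_sq_le_sq ?_ (norm_nonneg u)
  rw [norm_sq_H1]; nlinarith [sq_nonneg ‖fn u‖]

/-- The analytic facts about `Ω` on which the estimate rests: traces exist and are unique, a
Friedrichs inequality holds, and `H¹(Ω)` embeds in `L⁴(Ω)`. -/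
structure IsSobolevDomain (Ω : Set Plane) : Prop where
  exists_trace : ∀ u : H1 Ω, ∃ t, IsTrace u t
  trace_unique : ∀ (u : H1 Ω) (s t : Lp ℝ 2 (bdry Ω)), IsTrace u s → IsTrace u t → s = t
  friedrichs : ∃ C : ℝ, 0 ≤ C ∧ ∀ (u : H1 Ω) (t : Lp ℝ 2 (bdry Ω)), IsTrace u t →
    ‖fn u‖ ≤ C * (‖wgrad u‖ + ‖t‖)
  embedding : ∃ C : ℝ≥0, ∀ u : H1 Ω, eLpNorm (fn u) 4 (volume.restrict Ω) ≤ C * ‖u‖ₑ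

/-- The triangulation enters through the cover of `closure Ω` by parallelograms. -/
lemma IsPolygonalDomain.isSobolevDomain (hΩ : IsPolygonalDomain Ω) (𝒯 : Triangulation Ω) :
    IsSobolevDomain Ω := by
  have hnull := 𝒯.volume_frontier hΩ.isOpen hΩ.lipschitz
  obtain ⟨𝒬, h𝒬⟩ := 𝒯.exists_isQuadCover hΩ.isOpen hΩ.lipschitz
  have hfin := isFiniteMeasure_bdry h𝒬 hnull hΩ.isBounded
  obtain ⟨C₁, hC₁⟩ := exists_eLpNorm_four_le h𝒬 hnull
  obtain ⟨C₂, hC₂⟩ := exists_eLpNorm_bdry_le h𝒬 hnull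
  obtain ⟨C₃, hC₃⟩ := exists_eLpNorm_le_bdry hΩ.isOpen hΩ.isBounded hΩ.polygonal
  have hex := exists_isTrace hΩ.isOpen hΩ.isBounded hΩ.lipschitz hC₂
  refine ⟨hex, fun u s t hs ht => ?_, ⟨C₃, C₃.coe_nonneg, fun u t ht => ?_⟩, ⟨C₁ * 2, fun u => ?_⟩⟩
  · have h0 := (hs.add (ht.smul (-1))).eLpNorm_le hC₂
    rw [fn_add, fn_smul, wgrad_add, wgrad_smul, neg_smul, one_smul, neg_smul, one_smul, neg_smul,
      one_smul, add_neg_cancel, add_neg_cancel, enorm_zero, enorm_zero, add_zero, mul_zero] at h0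
    exact add_neg_eq_zero.1 (enorm_eq_zero.1 (le_antisymm h0 zero_le))
  · have h := ht.friedrichs hC₃
    simp only [enorm_eq_nnnorm] at h
    exact_mod_cast h
  · obtain ⟨t, ht⟩ := hex u
    refine (eLpNorm_four_fn_le hC₁ ht).trans ?_
    rw [ENNReal.coe_mul, mul_assoc, ENNReal.coe_ofNat, two_mul]
    gcongr
    · exact enorm_le_iff_norm_le.2 (norm_fn_le u)
    · exact enorm_le_iff_norm_le.2 (norm_wgrad_le u)

/-! ### The discrete norm -/

lemma IsSobolevDomain.isTrace_trace (hΩ : IsSobolevDomain Ω) (u : H1 Ω) : IsTrace u (trace u) := by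
  have h := hΩ.exists_trace u
  rw [trace, dif_pos h]
  exact h.choose_spec

lemma IsSobolevDomain.trace_eq (hΩ : IsSobolevDomain Ω) {u : H1 Ω} {t : Lp ℝ 2 (bdry Ω)}
    (h : IsTrace u t) : trace u = t :=
  hΩ.trace_unique u _ _ (hΩ.isTrace_trace u) h

lemma IsSobolevDomain.trace_add (hΩ : IsSobolevDomain Ω) (u v : H1 Ω) :
    trace (u + v) = trace u + trace v :=
  hΩ.trace_eq ((hΩ.isTrace_trace u).add (hΩ.isTrace_trace v))

/-- The arc length measure on an edge. -/
noncomputable def edgeMeasure (E : Finset Plane) : Measure Plane :=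
  (Measure.hausdorffMeasure 1).restrict (convexHull ℝ (E : Set Plane))

lemma Triangulation.subset_frontier_of_mem_boundaryEdges (𝒯 : Triangulation Ω) {E : Finset Plane}
    (hE : E ∈ 𝒯.boundaryEdges) : convexHull ℝ (E : Set Plane) ⊆ frontier Ω := by
  classical
  rw [Triangulation.boundaryEdges] at hE
  exact (Finset.mem_filter.1 hE).2

lemma Triangulation.card_of_mem_boundaryEdges (𝒯 : Triangulation Ω) {E : Finset Plane}
    (hE : E ∈ 𝒯.boundaryEdges) : E.card = 2 := by
  classical
  rw [Triangulation.boundaryEdges] at hE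
  obtain ⟨T, _, hET⟩ := Finset.mem_biUnion.1 (Finset.mem_filter.1 hE).1
  exact (Finset.mem_powersetCard.1 hET).2

lemma Triangulation.edgeMeasure_le (𝒯 : Triangulation Ω) {E : Finset Plane}
    (hE : E ∈ 𝒯.boundaryEdges) : edgeMeasure E ≤ bdry Ω :=
  Measure.restrict_mono (𝒯.subset_frontier_of_mem_boundaryEdges hE) le_rfl

lemma Triangulation.memLp_edge (𝒯 : Triangulation Ω) {E : Finset Plane}
    (hE : E ∈ 𝒯.boundaryEdges) (t : Lp ℝ 2 (bdry Ω)) : MemLp t 2 (edgeMeasure E) :=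
  (Lp.memLp t).mono_measure (𝒯.edgeMeasure_le hE)

lemma integral_sq_eq_eLpNorm {f : Plane → ℝ} {μ : Measure Plane} (hf : MemLp f 2 μ) :
    ∫ x, f x ^ 2 ∂μ = (eLpNorm f 2 μ).toReal ^ 2 := by
  rw [← ENNReal.toReal_pow, eLpNorm_two_sq,
    integral_eq_lintegral_of_nonneg_ae (Eventually.of_forall fun x => sq_nonneg (f x))
      (hf.aestronglyMeasurable.pow 2)]
  congr 1
  refine lintegral_congr fun x => ?_
  rw [Real.enorm_eq_ofReal_abs, ← ENNReal.ofReal_pow (abs_nonneg _), sq_abs]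

/-- The square roots of the summands of the squared discrete norm. The index `(i, none)` stands for
the gradient of the component `i`, the index `(i, some E)` for the penalty term on the edge `E`. -/
noncomputable def hPart (σ : ℝ) (Φ : X Ω) : Fin 2 × Option (Finset Plane) → ℝ
  | (i, none) => ‖wgrad (Φ i)‖
  | (i, some E) => √(σ / Metric.diam (E : Set Plane)) *
      (eLpNorm (trace (Φ i)) 2 (edgeMeasure E)).toReal

/-- The index set of the summands of the squared discrete norm. -/
noncomputable def hIndex (𝒯 : Triangulation Ω) : Finset (Fin 2 × Option (Finset Plane)) :=
  Finset.univ ×ˢ Finset.insertNone 𝒯.boundaryEdges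

lemma hNorm_eq (𝒯 : Triangulation Ω) {σ : ℝ} (hσ : 0 < σ) (Φ : X Ω) :
    hNorm 𝒯 σ Φ = √(∑ k ∈ hIndex 𝒯, hPart σ Φ k ^ 2) := by
  rw [hNorm, hIndex, Finset.sum_product]
  congr 1
  refine Finset.sum_congr rfl fun i _ => ?_
  rw [Finset.sum_insertNone, hNormSq]
  congr 1
  refine Finset.sum_congr rfl fun E hE => ?_
  have h := integral_sq_eq_eLpNorm (𝒯.memLp_edge hE (trace (Φ i)))
  rw [edgeMeasure] at h
  rw [h, hPart, mul_pow, Real.sq_sqrt (div_nonneg hσ.le Metric.diam_nonneg)]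
  rfl

lemma hPart_nonneg (σ : ℝ) (Φ : X Ω) (k : Fin 2 × Option (Finset Plane)) : 0 ≤ hPart σ Φ k := by
  rcases k with ⟨i, _ | E⟩
  · exact norm_nonneg _
  · exact mul_nonneg (Real.sqrt_nonneg _) ENNReal.toReal_nonneg

lemma comp_add (Φ Θ : X Ω) (i : Fin 2) : (Φ + Θ) i = Φ i + Θ i := rfl

lemma hPart_add_le (hΩ : IsSobolevDomain Ω) (𝒯 : Triangulation Ω) (σ : ℝ) (Φ Θ : X Ω)
    {k : Fin 2 × Option (Finset Plane)} (hk : k ∈ hIndex 𝒯) :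
    hPart σ (Φ + Θ) k ≤ hPart σ Φ k + hPart σ Θ k := by
  rcases k with ⟨i, _ | E⟩
  · simp only [hPart, comp_add, wgrad_add]
    exact norm_add_le _ _
  · have hE : E ∈ 𝒯.boundaryEdges := by simpa [hIndex] using hk
    simp only [hPart, comp_add, hΩ.trace_add, ← mul_add]
    refine mul_le_mul_of_nonneg_left ?_ (Real.sqrt_nonneg _)
    have m₁ := 𝒯.memLp_edge hE (trace (Φ i))
    have m₂ := 𝒯.memLp_edge hE (trace (Θ i))
    rw [← ENNReal.toReal_add m₁.eLpNorm_ne_top m₂.eLpNorm_ne_top]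
    refine ENNReal.toReal_mono (ENNReal.add_ne_top.2 ⟨m₁.eLpNorm_ne_top, m₂.eLpNorm_ne_top⟩) ?_
    have hae : ⇑(trace (Φ i) + trace (Θ i)) =ᵐ[edgeMeasure E] ⇑(trace (Φ i)) + ⇑(trace (Θ i)) :=
      (Measure.absolutelyContinuous_of_le (𝒯.edgeMeasure_le hE)).ae_eq (Lp.coeFn_add _ _)
    rw [eLpNorm_congr_ae hae]
    exact eLpNorm_add_le m₁.aestronglyMeasurable m₂.aestronglyMeasurable (by norm_num)

/-- Minkowski's inequality for finite sums of squares. -/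
lemma sqrt_sum_sq_le_add {ι : Type*} (s : Finset ι) {a b c : ι → ℝ} (ha : ∀ k ∈ s, 0 ≤ a k)
    (hb : ∀ k ∈ s, 0 ≤ b k) (hc : ∀ k ∈ s, 0 ≤ c k) (h : ∀ k ∈ s, c k ≤ a k + b k) :
    √(∑ k ∈ s, c k ^ 2) ≤ √(∑ k ∈ s, a k ^ 2) + √(∑ k ∈ s, b k ^ 2) := by
  have h1 := Real.Lp_add_le_of_nonneg (s := s) (p := 2) (by norm_num) ha hb
  simp only [Real.rpow_two, ← Real.sqrt_eq_rpow] at h1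
  refine le_trans (Real.sqrt_le_sqrt (Finset.sum_le_sum fun k hk => ?_)) h1
  exact pow_le_pow_left₀ (hc k hk) (h k hk) 2

lemma hNorm_nonneg (𝒯 : Triangulation Ω) (σ : ℝ) (Φ : X Ω) : 0 ≤ hNorm 𝒯 σ Φ := Real.sqrt_nonneg _

lemma hNorm_add_le (hΩ : IsSobolevDomain Ω) (𝒯 : Triangulation Ω) {σ : ℝ} (hσ : 0 < σ)
    (Φ Θ : X Ω) : hNorm 𝒯 σ (Φ + Θ) ≤ hNorm 𝒯 σ Φ + hNorm 𝒯 σ Θ := by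
  rw [hNorm_eq 𝒯 hσ, hNorm_eq 𝒯 hσ, hNorm_eq 𝒯 hσ]
  exact sqrt_sum_sq_le_add _ (fun _ _ => hPart_nonneg _ _ _) (fun _ _ => hPart_nonneg _ _ _)
    (fun _ _ => hPart_nonneg _ _ _) fun k hk => hPart_add_le hΩ 𝒯 σ Φ Θ hk

lemma norm_sq_X (Φ : X Ω) : ‖Φ‖ ^ 2 = ∑ i, ‖Φ i‖ ^ 2 :=
  PiLp.norm_sq_eq_of_L2 (fun _ : Fin 2 => H1 Ω) Φ

lemma norm_comp_le (Φ : X Ω) (i : Fin 2) : ‖Φ i‖ ≤ ‖Φ‖ :=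
  PiLp.norm_apply_le (β := fun _ : Fin 2 => H1 Ω) Φ i

lemma hNormSq_nonneg (𝒯 : Triangulation Ω) {σ : ℝ} (hσ : 0 < σ) (v : H1 Ω) :
    0 ≤ hNormSq 𝒯 σ v := by
  refine add_nonneg (sq_nonneg _) (Finset.sum_nonneg fun E _ => ?_)
  exact mul_nonneg (div_nonneg hσ.le Metric.diam_nonneg) (integral_nonneg fun x => sq_nonneg _)

lemma norm_wgrad_sq_le (𝒯 : Triangulation Ω) {σ : ℝ} (hσ : 0 < σ) (v : H1 Ω) :
    ‖wgrad v‖ ^ 2 ≤ hNormSq 𝒯 σ v := by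
  refine le_add_of_nonneg_right (Finset.sum_nonneg fun E _ => ?_)
  exact mul_nonneg (div_nonneg hσ.le Metric.diam_nonneg) (integral_nonneg fun x => sq_nonneg _)

lemma hNorm_sq (𝒯 : Triangulation Ω) {σ : ℝ} (hσ : 0 < σ) (Φ : X Ω) :
    hNorm 𝒯 σ Φ ^ 2 = ∑ i, hNormSq 𝒯 σ (Φ i) :=
  Real.sq_sqrt (Finset.sum_nonneg fun _ _ => hNormSq_nonneg 𝒯 hσ _)

/-- On functions with vanishing trace the discrete norm is the norm of the gradient. -/
lemma hNorm_le_norm_of_vanishing (hΩ : IsSobolevDomain Ω) (𝒯 : Triangulation Ω) {σ : ℝ}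
    (hσ : 0 < σ) {Φ : X Ω} (hΦ : Φ ∈ vanishing Ω) : hNorm 𝒯 σ Φ ≤ ‖Φ‖ := by
  refine le_of_sq_le_sq ?_ (norm_nonneg _)
  rw [hNorm_sq 𝒯 hσ, norm_sq_X]
  refine Finset.sum_le_sum fun i _ => ?_
  have ht : trace (Φ i) = 0 := hΩ.trace_eq (hΦ i)
  have h0 : ∀ E ∈ 𝒯.boundaryEdges, σ / Metric.diam (E : Set Plane) *
      ∫ x in convexHull ℝ (E : Set Plane), (trace (Φ i) x) ^ 2 ∂(Measure.hausdorffMeasure 1) =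
        0 := by
    intro E hE
    rw [ht]
    have hae : ⇑(0 : Lp ℝ 2 (bdry Ω)) =ᵐ[edgeMeasure E] 0 :=
      (Measure.absolutelyContinuous_of_le (𝒯.edgeMeasure_le hE)).ae_eq (Lp.coeFn_zero _ _ _)
    rw [integral_eq_zero_of_ae, mul_zero]
    filter_upwards [hae] with x hx
    rw [hx]; simp
  rw [hNormSq, Finset.sum_eq_zero h0, add_zero]
  exact pow_le_pow_left₀ (norm_nonneg _) (norm_wgrad_le _) 2

/-- The norm of `L²(∂Ω)` is controlled by the penalty terms, since the boundary edges cover `∂Ω`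
except for finitely many points. -/
lemma norm_sq_le_sum_edges (ho : IsOpen Ω) (hL : HasLipschitzBoundary Ω) (𝒯 : Triangulation Ω)
    (t : Lp ℝ 2 (bdry Ω)) :
    ‖t‖ ^ 2 ≤ ∑ E ∈ 𝒯.boundaryEdges,
      ∫ x in convexHull ℝ (E : Set Plane), t x ^ 2 ∂(Measure.hausdorffMeasure 1) := by
  classical
  set U : Finset Plane := 𝒯.triangles.biUnion id with hU
  have hcov : frontier Ω ⊆
      (U : Set Plane) ∪ ⋃ E ∈ 𝒯.boundaryEdges, convexHull ℝ (E : Set Plane) := by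
    intro x hx
    by_cases hxU : x ∈ U
    · exact Or.inl hxU
    · obtain ⟨E, hE, hxE⟩ := 𝒯.exists_boundaryEdge ho hL hx fun T hT hxT =>
        hxU (Finset.mem_biUnion.2 ⟨T, hT, hxT⟩)
      exact Or.inr (mem_iUnion₂.2 ⟨E, hE, hxE⟩)
  have hU0 : (Measure.hausdorffMeasure 1 : Measure Plane) (U : Set Plane) = 0 := by
    have := Measure.nullSingletonClass_hausdorff Plane one_pos
    exact U.measure_zero _
  have h1 : ∫⁻ x, ‖t x‖ₑ ^ 2 ∂(bdry Ω) ≤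
      ∑ E ∈ 𝒯.boundaryEdges, ∫⁻ x, ‖t x‖ₑ ^ 2 ∂(edgeMeasure E) := by
    refine (lintegral_mono_set hcov).trans ((lintegral_union_le _ _ _).trans ?_)
    rw [setLIntegral_measure_zero _ _ hU0, zero_add]
    exact setLIntegral_biUnion_le _ _ _ _
  simp only [← eLpNorm_two_sq] at h1
  have h2 : ∑ E ∈ 𝒯.boundaryEdges, eLpNorm t 2 (edgeMeasure E) ^ 2 ≠ ⊤ :=
    ENNReal.sum_ne_top.2 fun E hE => ENNReal.pow_ne_top (𝒯.memLp_edge hE t).eLpNorm_ne_top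
  have h3 := ENNReal.toReal_mono h2 h1
  rw [ENNReal.toReal_pow, ENNReal.toReal_sum fun E hE =>
    ENNReal.pow_ne_top (𝒯.memLp_edge hE t).eLpNorm_ne_top] at h3
  rw [Lp.norm_def]
  refine h3.trans (Finset.sum_le_sum fun E hE => ?_)
  have h4 := integral_sq_eq_eLpNorm (𝒯.memLp_edge hE t)
  rw [ENNReal.toReal_pow, ← h4]
  rfl

/-- The Poincaré constant is the same for all triangulations, because the length of a boundary edge
is at most the diameter of the domain. -/
lemma exists_isPoincareConst (hΩ : IsPolygonalDomain Ω) (hS : IsSobolevDomain Ω) {σ : ℝ}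
    (hσ : 0 < σ) (𝓕 : Set (Triangulation Ω)) : ∃ c, 0 ≤ c ∧ IsPoincareConst 𝓕 σ c := by
  obtain ⟨C, hC0, hC⟩ := hS.friedrichs
  set d := Metric.diam (closure Ω) with hd
  have hd0 : 0 ≤ d := Metric.diam_nonneg
  set c₀ : ℝ := 2 * C ^ 2 * (1 + d / σ) with hc₀
  have hc₀0 : 0 ≤ c₀ := by positivity
  refine ⟨√c₀, Real.sqrt_nonneg _, fun 𝒯 _ Φ => ?_⟩
  rw [l2Norm, hNorm, ← Real.sqrt_mul hc₀0, Finset.mul_sum]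
  refine Real.sqrt_le_sqrt (Finset.sum_le_sum fun i _ => ?_)
  set u := Φ i
  have h1 := hC u _ (hS.isTrace_trace u)
  have h2 := norm_sq_le_sum_edges hΩ.isOpen hΩ.lipschitz 𝒯 (trace u)
  have h3 : ∑ E ∈ 𝒯.boundaryEdges,
      ∫ x in convexHull ℝ (E : Set Plane), trace u x ^ 2 ∂(Measure.hausdorffMeasure 1) ≤
      d / σ * ∑ E ∈ 𝒯.boundaryEdges, σ / Metric.diam (E : Set Plane) *
        ∫ x in convexHull ℝ (E : Set Plane), trace u x ^ 2 ∂(Measure.hausdorffMeasure 1) := by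
    rw [Finset.mul_sum]
    refine Finset.sum_le_sum fun E hE => ?_
    rw [← mul_assoc]
    refine le_mul_of_one_le_left (integral_nonneg fun x => sq_nonneg _) ?_
    have hcard := 𝒯.card_of_mem_boundaryEdges hE
    have hE2 := 𝒯.subset_frontier_of_mem_boundaryEdges hE
    have hdiam0 : 0 < Metric.diam (E : Set Plane) :=
      Metric.diam_pos (Finset.one_lt_card_iff_nontrivial.1 (by omega)) E.finite_toSet.isBounded
    have hdiam : Metric.diam (E : Set Plane) ≤ d := by
      refine Metric.diam_mono ?_ hΩ.isBounded.isCompact_closure.isBounded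
      exact (subset_convexHull ℝ _).trans (hE2.trans frontier_subset_closure)
    rw [div_mul_div_cancel₀ hσ.ne', one_le_div hdiam0]
    exact hdiam
  set P := ∑ E ∈ 𝒯.boundaryEdges, σ / Metric.diam (E : Set Plane) *
        ∫ x in convexHull ℝ (E : Set Plane), trace u x ^ 2 ∂(Measure.hausdorffMeasure 1) with hP
  have hP0 : 0 ≤ P := Finset.sum_nonneg fun E _ =>
    mul_nonneg (div_nonneg hσ.le Metric.diam_nonneg) (integral_nonneg fun x => sq_nonneg _)
  have h4 : hNormSq 𝒯 σ u = ‖wgrad u‖ ^ 2 + P := rfl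
  rw [h4]
  have h5 : ‖fn u‖ ^ 2 ≤ (C * (‖wgrad u‖ + ‖trace u‖)) ^ 2 := pow_le_pow_left₀ (norm_nonneg _) h1 2
  have h6 : (‖wgrad u‖ + ‖trace u‖) ^ 2 ≤ 2 * (‖wgrad u‖ ^ 2 + ‖trace u‖ ^ 2) := by
    nlinarith [sq_nonneg (‖wgrad u‖ - ‖trace u‖)]
  have h7 : ‖wgrad u‖ ^ 2 + ‖trace u‖ ^ 2 ≤ (1 + d / σ) * (‖wgrad u‖ ^ 2 + P) := by
    have hds : 0 ≤ d / σ := by positivity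
    nlinarith [mul_nonneg hds (sq_nonneg ‖wgrad u‖)]
  calc ‖fn u‖ ^ 2 ≤ C ^ 2 * (‖wgrad u‖ + ‖trace u‖) ^ 2 := by rw [← mul_pow]; exact h5
    _ ≤ C ^ 2 * (2 * ((1 + d / σ) * (‖wgrad u‖ ^ 2 + P))) := by gcongr; linarith
    _ = _ := by rw [hc₀]; ring

/-- A Poincaré constant bounds the norm of `X` by the discrete norm. -/
lemma IsPoincareConst.norm_le {𝓕 : Set (Triangulation Ω)} {σ c : ℝ} (hσ : 0 < σ)
    (hc : IsPoincareConst 𝓕 σ c) {𝒯 : Triangulation Ω} (h𝒯 : 𝒯 ∈ 𝓕) (Φ : X Ω) :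
    ‖Φ‖ ≤ √(1 + c ^ 2) * hNorm 𝒯 σ Φ := by
  refine le_of_sq_le_sq ?_ (mul_nonneg (Real.sqrt_nonneg _) (hNorm_nonneg _ _ _))
  rw [mul_pow, Real.sq_sqrt (by positivity), norm_sq_X]
  have h1 := hc 𝒯 h𝒯 Φ
  have h2 : l2Norm Φ ^ 2 ≤ (c * hNorm 𝒯 σ Φ) ^ 2 := pow_le_pow_left₀ (Real.sqrt_nonneg _) h1 2
  rw [l2Norm, Real.sq_sqrt (Finset.sum_nonneg fun _ _ => sq_nonneg _)] at h2
  have h3 : ∑ i, ‖wgrad (Φ i)‖ ^ 2 ≤ hNorm 𝒯 σ Φ ^ 2 := by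
    rw [hNorm_sq 𝒯 hσ]
    exact Finset.sum_le_sum fun i _ => norm_wgrad_sq_le 𝒯 hσ _
  simp only [norm_sq_H1, Finset.sum_add_distrib]
  linarith

noncomputable section Forms

/-! ### The forms of the variational problem -/

lemma holderTriple_four : ENNReal.HolderTriple 4 4 2 := by
  refine ⟨?_⟩
  have h : (4 : ℝ≥0∞)⁻¹ + 4⁻¹ = 2 * (2 * 2)⁻¹ := by
    rw [← two_mul]; norm_num
  rw [h, ENNReal.mul_inv (Or.inl two_ne_zero) (Or.inl ENNReal.ofNat_ne_top), ← mul_assoc,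
    ENNReal.mul_inv_cancel two_ne_zero ENNReal.ofNat_ne_top, one_mul]

instance fact_one_le_four : Fact ((1 : ℝ≥0∞) ≤ 4) := ⟨by norm_num⟩

/-- The components of a vector field, as continuous linear maps. -/
def compL (i : Fin 2) : X Ω →L[ℝ] H1 Ω :=
  LinearMap.mkContinuous
    { toFun := fun Φ => Φ i
      map_add' := fun _ _ => rfl
      map_smul' := fun _ _ => rfl } 1 fun Φ => by
    rw [one_mul]; exact norm_comp_le Φ i

/-- The inclusion `H¹(Ω) ⊂ L²(Ω)` as a continuous linear map. -/
def fnL : H1 Ω →L[ℝ] Lp ℝ 2 (volume.restrict Ω) :=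
  LinearMap.mkContinuous
    { toFun := fn
      map_add' := fn_add
      map_smul' := fn_smul } 1 fun u => by
    rw [one_mul]; exact norm_fn_le u

/-- The weak gradient as a continuous linear map. -/
def wgradL : H1 Ω →L[ℝ] Lp Plane 2 (volume.restrict Ω) :=
  LinearMap.mkContinuous
    { toFun := wgrad
      map_add' := wgrad_add
      map_smul' := wgrad_smul } 1 fun u => by
    rw [one_mul]; exact norm_wgrad_le u

/-- The inclusion `H¹(Ω) ⊂ L⁴(Ω)` as a continuous linear map. -/
lemma IsSobolevDomain.exists_embedding (hΩ : IsSobolevDomain Ω) :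
    ∃ j : H1 Ω →L[ℝ] Lp ℝ 4 (volume.restrict Ω), ∀ u, j u =ᵐ[volume.restrict Ω] fn u := by
  obtain ⟨C, hC⟩ := hΩ.embedding
  have hmem : ∀ u : H1 Ω, MemLp (fn u) 4 (volume.restrict Ω) := fun u =>
    ⟨Lp.aestronglyMeasurable _, (hC u).trans_lt (by finiteness)⟩
  refine ⟨LinearMap.mkContinuous
    { toFun := fun u => (hmem u).toLp (fn u)
      map_add' := fun u v => ?_
      map_smul' := fun c u => ?_ } C fun u => ?_, fun u => (hmem u).coeFn_toLp⟩
  · rw [← MemLp.toLp_add]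
    exact MemLp.toLp_congr _ _ (by rw [fn_add]; exact Lp.coeFn_add _ _)
  · rw [RingHom.id_apply, ← MemLp.toLp_const_smul]
    exact MemLp.toLp_congr _ _ (by rw [fn_smul]; exact Lp.coeFn_smul _ _)
  · change ‖(hmem u).toLp (fn u)‖ ≤ C * ‖u‖
    rw [Lp.norm_toLp]
    have h := ENNReal.toReal_mono (by finiteness) (hC u)
    simpa using h

lemma exists_sum_comp {F G : Type*} [NormedAddCommGroup F] [NormedSpace ℝ F] [NormedAddCommGroup G]
    [NormedSpace ℝ G] (m : G →L[ℝ] G →L[ℝ] F) (j : H1 Ω →L[ℝ] G) :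
    ∃ D : X Ω →L[ℝ] X Ω →L[ℝ] F, ∀ Ξ η, D Ξ η = m (j (Ξ 0)) (j (η 0)) + m (j (Ξ 1)) (j (η 1)) :=
  ⟨m.bilinearComp (j ∘L compL 0) (j ∘L compL 0) + m.bilinearComp (j ∘L compL 1) (j ∘L compL 1),
    fun _ _ => rfl⟩

/-- The pointwise product of two vector fields in `X`, as a continuous bilinear map into `L²(Ω)`. -/
lemma IsSobolevDomain.exists_dot (hΩ : IsSobolevDomain Ω) :
    ∃ D : X Ω →L[ℝ] X Ω →L[ℝ] Lp ℝ 2 (volume.restrict Ω),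
      ∀ Ξ η, D Ξ η =ᵐ[volume.restrict Ω] dot Ξ η := by
  obtain ⟨j, hj⟩ := hΩ.exists_embedding
  have := holderTriple_four
  obtain ⟨m, hm⟩ : ∃ m : Lp ℝ 4 (volume.restrict Ω) →L[ℝ] Lp ℝ 4 (volume.restrict Ω) →L[ℝ]
      Lp ℝ 2 (volume.restrict Ω), ∀ u v, m u v =ᵐ[volume.restrict Ω] fun x => u x * v x :=
    ⟨(ContinuousLinearMap.mul ℝ ℝ).holderL (volume.restrict Ω) 4 4 2,
      fun u v => (ContinuousLinearMap.mul ℝ ℝ).coeFn_holder (r := 2) u v⟩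
  obtain ⟨D, hD⟩ := exists_sum_comp m j
  refine ⟨D, fun Ξ η => ?_⟩
  have h0 : ∀ i, m (j (Ξ i)) (j (η i)) =ᵐ[volume.restrict Ω]
      fun x => fn (Ξ i) x * fn (η i) x := by
    intro i
    filter_upwards [hm (j (Ξ i)) (j (η i)), hj (Ξ i), hj (η i)] with x hx h2 h3
    rw [hx, h2, h3]
  rw [hD]
  filter_upwards [Lp.coeFn_add (m (j (Ξ 0)) (j (η 0))) (m (j (Ξ 1)) (j (η 1))), h0 0, h0 1]
    with x hx h2 h3
  rw [hx, Pi.add_apply, h2, h3, dot, Fin.sum_univ_two]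

/-- The continuous bilinear form `A + C`. -/
def formAC (ε : ℝ) : X Ω →L[ℝ] X Ω →L[ℝ] ℝ :=
  ∑ i, ((innerSL ℝ).bilinearComp (wgradL ∘L compL i) (wgradL ∘L compL i) -
    (2 / ε ^ 2) • (innerSL ℝ).bilinearComp (fnL ∘L compL i) (fnL ∘L compL i))

lemma formAC_apply (ε : ℝ) (Θ Φ : X Ω) : formAC ε Θ Φ = formA Θ Φ + formC ε Θ Φ := by
  have h1 : formAC ε Θ Φ = ∑ i, (inner ℝ (wgrad (Θ i)) (wgrad (Φ i)) -
      2 / ε ^ 2 * inner ℝ (fn (Θ i)) (fn (Φ i))) := by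
    simp only [formAC, Fin.sum_univ_two]; rfl
  have h2 : ∫ x in Ω, dot Θ Φ x = ∑ i, inner ℝ (fn (Θ i)) (fn (Φ i)) := by
    simp only [dot]
    rw [integral_finsetSum]
    · refine Finset.sum_congr rfl fun i _ => ?_
      rw [L2.inner_def]
      exact integral_congr_ae (Eventually.of_forall fun x => by simp [mul_comm])
    · intro i _
      exact memLp_one_iff_integrable.1 ((Lp.memLp (fn (Φ i))).smul (Lp.memLp (fn (Θ i))))
  rw [h1, formC, h2, Finset.sum_sub_distrib, ← Finset.mul_sum, formA]
  simp only [L2.inner_def]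
  ring

/-- A continuous bilinear map `D` into a Hilbert space that realizes the integrals of products of
four functions as inner products: `D Ξ η` stands for the pointwise product `Ξ · η` in `L²(Ω)`. -/
structure IsDot {F : Type*} [NormedAddCommGroup F] [InnerProductSpace ℝ F]
    (D : X Ω →L[ℝ] X Ω →L[ℝ] F) : Prop where
  integrable : ∀ Ξ η Θ Φ : X Ω, Integrable (fun x => dot Ξ η x * dot Θ Φ x) (volume.restrict Ω)
  inner_eq : ∀ Ξ η Θ Φ : X Ω, inner ℝ (D Ξ η) (D Θ Φ) = ∫ x in Ω, dot Ξ η x * dot Θ Φ x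

lemma IsSobolevDomain.exists_isDot (hΩ : IsSobolevDomain Ω) :
    ∃ D : X Ω →L[ℝ] X Ω →L[ℝ] Lp ℝ 2 (volume.restrict Ω), IsDot D := by
  obtain ⟨D, hD⟩ := hΩ.exists_dot
  have hae : ∀ Ξ η Θ Φ, (fun x => inner ℝ (D Ξ η x) (D Θ Φ x)) =ᵐ[volume.restrict Ω]
      fun x => dot Ξ η x * dot Θ Φ x := by
    intro Ξ η Θ Φ
    filter_upwards [hD Ξ η, hD Θ Φ] with x h1 h2
    rw [h1, h2]
    exact mul_comm _ _
  refine ⟨D, fun Ξ η Θ Φ => ?_, fun Ξ η Θ Φ => ?_⟩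
  · exact (L2.integrable_inner (𝕜 := ℝ) (D Ξ η) (D Θ Φ)).congr (hae Ξ η Θ Φ)
  · rw [L2.inner_def]
    exact integral_congr_ae (hae Ξ η Θ Φ)

variable {F : Type*} [NormedAddCommGroup F] [InnerProductSpace ℝ F] {D : X Ω →L[ℝ] X Ω →L[ℝ] F}

lemma dot_comm (Ξ η : X Ω) (x : Plane) : dot Ξ η x = dot η Ξ x := by
  simp only [dot, mul_comm]

lemma IsDot.symm (hD : IsDot D) (Ξ η : X Ω) : D Ξ η = D η Ξ := by
  rw [← sub_eq_zero, ← inner_self_eq_zero (𝕜 := ℝ)]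
  simp only [inner_sub_left, inner_sub_right, hD.inner_eq, dot_comm η Ξ]
  ring

lemma IsDot.formB_eq (hD : IsDot D) (ε : ℝ) (Ξ η Θ Φ : X Ω) : formB ε Ξ η Θ Φ =
    2 / (3 * ε ^ 2) * (inner ℝ (D Ξ η) (D Θ Φ) + 2 * inner ℝ (D Ξ Θ) (D η Φ)) := by
  rw [formB, hD.inner_eq, hD.inner_eq, integral_add (hD.integrable _ _ _ _)
    ((hD.integrable _ _ _ _).const_mul 2), integral_const_mul]

lemma IsDot.residualForm_eq (hD : IsDot D) (ε : ℝ) (η Φ : X Ω) : residualForm ε η Φ =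
    formAC ε η Φ + 2 / ε ^ 2 * inner ℝ (D η η) (D η Φ) := by
  rw [residualForm, hD.formB_eq, formAC_apply]
  ring

lemma IsDot.linearizedForm_eq (hD : IsDot D) (ε : ℝ) (η Θ Φ : X Ω) : linearizedForm ε η Θ Φ =
    formAC ε Θ Φ + 2 / ε ^ 2 * (inner ℝ (D η η) (D Θ Φ) + 2 * inner ℝ (D η Θ) (D η Φ)) := by
  rw [linearizedForm, hD.formB_eq, formAC_apply]
  ring

lemma IsDot.N_apply (hD : IsDot D) (ε : ℝ) (η : X Ω) (Φ : V Ω) :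
    N ε η Φ = residualForm ε η Φ := by
  have h : ∃ ℓ : StrongDual ℝ (V Ω), ∀ Φ : V Ω, ℓ Φ = residualForm ε η Φ := by
    refine ⟨(formAC ε η + (2 / ε ^ 2) • ((innerSL ℝ (D η η)) ∘L D η)) ∘L
      V.incl.toContinuousLinearMap, fun Φ => ?_⟩
    rw [hD.residualForm_eq]
    rfl
  rw [N, dif_pos h]
  exact h.choose_spec Φ

lemma IsDot.DN_apply (hD : IsDot D) (ε : ℝ) (η Θ : X Ω) (Φ : V Ω) :
    DN ε η Θ Φ = linearizedForm ε η Θ Φ := by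
  have h : ∃ L : X Ω →L[ℝ] StrongDual ℝ (V Ω), ∀ (Θ : X Ω) (Φ : V Ω),
      L Θ Φ = linearizedForm ε η Θ Φ := by
    let Q₁ : X Ω →L[ℝ] X Ω →L[ℝ] ℝ := ContinuousLinearMap.compL ℝ (X Ω) F ℝ (innerSL ℝ (D η η)) ∘L D
    let Q₂ : X Ω →L[ℝ] X Ω →L[ℝ] ℝ := (innerSL ℝ).bilinearComp (D η) (D η)
    refine ⟨(formAC ε + (2 / ε ^ 2) • (Q₁ + (2 : ℝ) • Q₂)).bilinearComp
      (ContinuousLinearMap.id ℝ (X Ω)) V.incl.toContinuousLinearMap, fun Θ Φ => ?_⟩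
    rw [hD.linearizedForm_eq]
    rfl
  rw [DN, dif_pos h]
  exact h.choose_spec Θ Φ

/-- The Lipschitz estimate for `DN`, which is quadratic in its argument. -/
lemma IsDot.norm_DN_sub_le (hD : IsDot D) {ε : ℝ} (hε : 0 < ε) (η ζ : X Ω) :
    ‖DN ε η - DN ε ζ‖ ≤ 6 / ε ^ 2 * ‖D‖ ^ 2 * (‖η‖ + ‖ζ‖) * ‖η - ζ‖ := by
  have hb : ∀ Ξ Θ : X Ω, ‖D Ξ Θ‖ ≤ ‖D‖ * ‖Ξ‖ * ‖Θ‖ := D.le_opNorm₂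
  refine ContinuousLinearMap.opNorm_le_bound₂ _ (by positivity) fun Θ Φ => ?_
  have hΦ : ‖(Φ : X Ω)‖ = ‖Φ‖ := V.incl.norm_map Φ
  set φ : X Ω := (Φ : X Ω) with hφ
  set δ := η - ζ with hδ
  have hη : η = ζ + δ := by rw [hδ]; abel
  have e : (DN ε η - DN ε ζ) Θ Φ = 2 / ε ^ 2 * (inner ℝ (D δ η) (D Θ φ) +
      inner ℝ (D ζ δ) (D Θ φ) + 2 * (inner ℝ (D δ Θ) (D η φ) + inner ℝ (D ζ Θ) (D δ φ))) := by
    have h1 : (DN ε η - DN ε ζ) Θ Φ = DN ε η Θ Φ - DN ε ζ Θ Φ := rfl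
    rw [h1, hD.DN_apply, hD.DN_apply, hD.linearizedForm_eq, hD.linearizedForm_eq, ← hφ, hη]
    simp only [map_add, add_apply, inner_add_left, inner_add_right]
    ring
  have i1 : |inner ℝ (D δ η) (D Θ φ)| ≤ ‖D‖ ^ 2 * ‖η‖ * ‖δ‖ * ‖Θ‖ * ‖φ‖ :=
    calc _ ≤ ‖D δ η‖ * ‖D Θ φ‖ := abs_real_inner_le_norm _ _
      _ ≤ (‖D‖ * ‖δ‖ * ‖η‖) * (‖D‖ * ‖Θ‖ * ‖φ‖) := by gcongr <;> exact hb _ _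
      _ = _ := by ring
  have i2 : |inner ℝ (D ζ δ) (D Θ φ)| ≤ ‖D‖ ^ 2 * ‖ζ‖ * ‖δ‖ * ‖Θ‖ * ‖φ‖ :=
    calc _ ≤ ‖D ζ δ‖ * ‖D Θ φ‖ := abs_real_inner_le_norm _ _
      _ ≤ (‖D‖ * ‖ζ‖ * ‖δ‖) * (‖D‖ * ‖Θ‖ * ‖φ‖) := by gcongr <;> exact hb _ _
      _ = _ := by ring
  have i3 : |inner ℝ (D δ Θ) (D η φ)| ≤ ‖D‖ ^ 2 * ‖η‖ * ‖δ‖ * ‖Θ‖ * ‖φ‖ :=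
    calc _ ≤ ‖D δ Θ‖ * ‖D η φ‖ := abs_real_inner_le_norm _ _
      _ ≤ (‖D‖ * ‖δ‖ * ‖Θ‖) * (‖D‖ * ‖η‖ * ‖φ‖) := by gcongr <;> exact hb _ _
      _ = _ := by ring
  have i4 : |inner ℝ (D ζ Θ) (D δ φ)| ≤ ‖D‖ ^ 2 * ‖ζ‖ * ‖δ‖ * ‖Θ‖ * ‖φ‖ :=
    calc _ ≤ ‖D ζ Θ‖ * ‖D δ φ‖ := abs_real_inner_le_norm _ _
      _ ≤ (‖D‖ * ‖ζ‖ * ‖Θ‖) * (‖D‖ * ‖δ‖ * ‖φ‖) := by gcongr <;> exact hb _ _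
      _ = _ := by ring
  have hpos : 0 ≤ 2 / ε ^ 2 := by positivity
  rw [e, Real.norm_eq_abs, abs_mul, abs_of_nonneg hpos, ← hΦ]
  calc 2 / ε ^ 2 * |_| ≤ 2 / ε ^ 2 * (3 * (‖D‖ ^ 2 * ‖η‖ * ‖δ‖ * ‖Θ‖ * ‖φ‖) +
        3 * (‖D‖ ^ 2 * ‖ζ‖ * ‖δ‖ * ‖Θ‖ * ‖φ‖)) := by
        refine mul_le_mul_of_nonneg_left (abs_le.2 ?_) hpos
        rw [abs_le] at i1 i2 i3 i4
        exact ⟨by linarith [i1.1, i2.1, i3.1, i4.1], by linarith [i1.2, i2.2, i3.2, i4.2]⟩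
    _ = _ := by ring

/-- The second order Taylor remainder of the residual. -/
lemma IsDot.abs_residualForm_sub_le (hD : IsDot D) {ε : ℝ} (hε : 0 < ε) (ζ δ φ : X Ω) :
    |residualForm ε (ζ + δ) φ - residualForm ε ζ φ - linearizedForm ε ζ δ φ| ≤
      2 / ε ^ 2 * ‖D‖ ^ 2 * (3 * ‖ζ‖ + ‖δ‖) * ‖δ‖ ^ 2 * ‖φ‖ := by
  have hb : ∀ Ξ Θ : X Ω, ‖D Ξ Θ‖ ≤ ‖D‖ * ‖Ξ‖ * ‖Θ‖ := D.le_opNorm₂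
  have e : residualForm ε (ζ + δ) φ - residualForm ε ζ φ - linearizedForm ε ζ δ φ =
      2 / ε ^ 2 * (2 * inner ℝ (D ζ δ) (D δ φ) + inner ℝ (D δ δ) (D ζ φ) +
        inner ℝ (D δ δ) (D δ φ)) := by
    rw [hD.residualForm_eq, hD.residualForm_eq, hD.linearizedForm_eq]
    simp only [map_add, add_apply, inner_add_left, inner_add_right, hD.symm δ ζ]
    ring
  have i1 : |inner ℝ (D ζ δ) (D δ φ)| ≤ ‖D‖ ^ 2 * ‖ζ‖ * ‖δ‖ ^ 2 * ‖φ‖ :=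
    calc _ ≤ ‖D ζ δ‖ * ‖D δ φ‖ := abs_real_inner_le_norm _ _
      _ ≤ (‖D‖ * ‖ζ‖ * ‖δ‖) * (‖D‖ * ‖δ‖ * ‖φ‖) := by gcongr <;> exact hb _ _
      _ = _ := by ring
  have i2 : |inner ℝ (D δ δ) (D ζ φ)| ≤ ‖D‖ ^ 2 * ‖ζ‖ * ‖δ‖ ^ 2 * ‖φ‖ :=
    calc _ ≤ ‖D δ δ‖ * ‖D ζ φ‖ := abs_real_inner_le_norm _ _
      _ ≤ (‖D‖ * ‖δ‖ * ‖δ‖) * (‖D‖ * ‖ζ‖ * ‖φ‖) := by gcongr <;> exact hb _ _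
      _ = _ := by ring
  have i3 : |inner ℝ (D δ δ) (D δ φ)| ≤ ‖D‖ ^ 2 * ‖δ‖ * ‖δ‖ ^ 2 * ‖φ‖ :=
    calc _ ≤ ‖D δ δ‖ * ‖D δ φ‖ := abs_real_inner_le_norm _ _
      _ ≤ (‖D‖ * ‖δ‖ * ‖δ‖) * (‖D‖ * ‖δ‖ * ‖φ‖) := by gcongr <;> exact hb _ _
      _ = _ := by ring
  have hpos : 0 ≤ 2 / ε ^ 2 := by positivity
  rw [e, abs_mul, abs_of_nonneg hpos]
  calc 2 / ε ^ 2 * |_| ≤ 2 / ε ^ 2 * (3 * (‖D‖ ^ 2 * ‖ζ‖ * ‖δ‖ ^ 2 * ‖φ‖) +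
        ‖D‖ ^ 2 * ‖δ‖ * ‖δ‖ ^ 2 * ‖φ‖) := by
        refine mul_le_mul_of_nonneg_left (abs_le.2 ?_) hpos
        rw [abs_le] at i1 i2 i3
        exact ⟨by linarith [i1.1, i2.1, i3.1], by linarith [i1.2, i2.2, i3.2]⟩
    _ = _ := by ring

/-- The inf-sup condition as a lower bound for `DN(Ψ)` on `V`. -/
lemma IsDot.infSup_mul_norm_le (hD : IsDot D) {ε : ℝ} {Ψ : X Ω} (hβ : 0 < infSup ε Ψ) (Θ : V Ω) :
    infSup ε Ψ * ‖Θ‖ ≤ ‖DN ε Ψ (Θ : X Ω)‖ := by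
  rcases eq_or_ne Θ 0 with rfl | hΘ
  · simp
  have hn : 0 < ‖Θ‖ := norm_pos_iff.2 hΘ
  set Θ₁ : V Ω := ‖Θ‖⁻¹ • Θ with hΘ₁
  have hΘ₁n : ‖Θ₁‖ = 1 := by
    rw [hΘ₁, norm_smul, norm_inv, norm_norm, inv_mul_cancel₀ hn.ne']
  let s : Metric.sphere (0 : V Ω) 1 := ⟨Θ₁, by simp [hΘ₁n]⟩
  -- an infimum that is not bounded below has the value `0`, contrary to `hβ`
  have hbdd : BddBelow (range fun Θ : Metric.sphere (0 : V Ω) 1 =>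
      ⨆ Φ : Metric.sphere (0 : V Ω) 1, linearizedForm ε Ψ (Θ : V Ω) (Φ : V Ω)) := by
    by_contra h
    rw [infSup, iInf, Real.sInf_of_not_bddBelow h] at hβ
    exact lt_irrefl _ hβ
  have h1 : infSup ε Ψ ≤ ‖DN ε Ψ (Θ₁ : X Ω)‖ := by
    refine (ciInf_le hbdd s).trans ?_
    have : Nonempty (Metric.sphere (0 : V Ω) 1) := ⟨s⟩
    refine ciSup_le fun Φ => ?_
    rw [← hD.DN_apply]
    refine (le_abs_self _).trans ?_
    have h2 := (DN ε Ψ (Θ₁ : X Ω)).le_opNorm (Φ : V Ω)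
    have h3 : ‖(Φ : V Ω)‖ = 1 := mem_sphere_zero_iff_norm.1 Φ.2
    rwa [h3, mul_one] at h2
  have h4 : DN ε Ψ (Θ₁ : X Ω) = ‖Θ‖⁻¹ • DN ε Ψ (Θ : X Ω) := by
    rw [hΘ₁, map_smul, map_smul]
  rw [h4, norm_smul, norm_inv, norm_norm, inv_mul_eq_div, le_div_iff₀ hn] at h1
  exact h1

end Forms

/-! ### The abstract estimate -/

lemma one_le_sqrt_one_add_sq (c : ℝ) : 1 ≤ √(1 + c ^ 2) :=
  Real.one_le_sqrt.2 (le_add_of_nonneg_right (sq_nonneg c))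

/-- A ball of either kind is contained in a ball of `X` whose radius does not depend on the
triangulation. -/
lemma norm_sub_lt_of_mem_ball {𝓕 : Set (Triangulation Ω)} {σ c : ℝ} (hσ : 0 < σ)
    (hc : IsPoincareConst 𝓕 σ c) {Ψ : X Ω} {B : Triangulation Ω → ℝ → Set (X Ω)}
    (hB : B ∈ ({xBall Ψ, hBall σ Ψ} : Set (Triangulation Ω → ℝ → Set (X Ω))))
    {𝒯 : Triangulation Ω} (h𝒯 : 𝒯 ∈ 𝓕) {R : ℝ} (hR : 0 < R) {η : X Ω} (hη : η ∈ B 𝒯 R) :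
    ‖η - Ψ‖ < √(1 + c ^ 2) * R := by
  have h1 := one_le_sqrt_one_add_sq c
  rcases hB with rfl | rfl
  · have h2 : ‖η - Ψ‖ < R := mem_ball_iff_norm.1 hη
    nlinarith
  · have h2 : hNorm 𝒯 σ (η - Ψ) < R := hη
    exact (hc.norm_le hσ h𝒯 _).trans_lt (mul_lt_mul_of_pos_left h2 (by linarith))

section estimate

variable {F : Type*} [NormedAddCommGroup F] [InnerProductSpace ℝ F] {D : X Ω →L[ℝ] X Ω →L[ℝ] F}

/-- `DN` is Lipschitz continuous on bounded sets. -/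
lemma IsDot.norm_DN_sub_le_of_norm_sub_le (hD : IsDot D) {ε : ℝ} (hε : 0 < ε) {Ψ η ζ : X Ω} {r : ℝ}
    (hη : ‖η - Ψ‖ ≤ r) (hζ : ‖ζ - Ψ‖ ≤ r) :
    ‖DN ε η - DN ε ζ‖ ≤ 6 / ε ^ 2 * ‖D‖ ^ 2 * (2 * (‖Ψ‖ + r)) * ‖η - ζ‖ := by
  have h1 : ‖η‖ ≤ ‖Ψ‖ + r := (norm_le_norm_add_norm_sub' η Ψ).trans (by gcongr)
  have h2 : ‖ζ‖ ≤ ‖Ψ‖ + r := (norm_le_norm_add_norm_sub' ζ Ψ).trans (by gcongr)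
  refine (hD.norm_DN_sub_le hε η ζ).trans ?_
  gcongr
  linarith

/-- The residual at `η` differs from `DN(Ψ)(η - Ψ)` by a term of second order. -/
lemma IsDot.norm_DN_apply_sub_le (hD : IsDot D) {ε : ℝ} (hε : 0 < ε) {Ψ : X Ω}
    (hΨ : ∀ Φ : V Ω, residualForm ε Ψ Φ = 0) (η : X Ω) :
    ‖DN ε Ψ (η - Ψ)‖ ≤ ‖N ε η‖ +
      2 / ε ^ 2 * ‖D‖ ^ 2 * (3 * ‖Ψ‖ + ‖η - Ψ‖) * ‖η - Ψ‖ ^ 2 := by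
  refine ContinuousLinearMap.opNorm_le_bound _ (by positivity) fun Φ => ?_
  have h1 := hD.abs_residualForm_sub_le hε Ψ (η - Ψ) (Φ : X Ω)
  have h2 : ‖(Φ : X Ω)‖ = ‖Φ‖ := V.incl.norm_map Φ
  rw [add_sub_cancel, hΨ, sub_zero, ← hD.N_apply, ← hD.DN_apply, h2] at h1
  have h3 := (N ε η).le_opNorm Φ
  rw [Real.norm_eq_abs] at h3 ⊢
  have h4 := abs_sub_abs_le_abs_sub (DN ε Ψ (η - Ψ) Φ) (N ε η Φ)
  rw [abs_sub_comm] at h4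
  linarith

end estimate

/-- Absorption of the term `β / 2 * e` into the left hand side. -/
lemma le_of_absorbed {β S e m n d t : ℝ} (hβ : 0 < β) (hS : 0 ≤ S) (hm : 0 ≤ m) (hn : 0 ≤ n)
    (hd : 0 ≤ d) (h1 : e ≤ t + m) (h2 : β * t ≤ n + β / 2 * e + (1 + d) * (S * m)) :
    e ≤ 2 * (1 + (1 + S) / β) * (n + (1 + d) * m) := by
  have h3 : β * e ≤ 2 * (β * m + n + (1 + d) * (S * m)) := by
    nlinarith [mul_le_mul_of_nonneg_left h1 hβ.le]
  have h4 : β * (2 * (1 + (1 + S) / β) * (n + (1 + d) * m)) =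
      2 * (β + (1 + S)) * (n + (1 + d) * m) := by
    field_simp
  refine le_of_mul_le_mul_left (h3.trans ?_) hβ
  rw [h4]
  have p1 : 0 ≤ β * n := by positivity
  have p2 : 0 ≤ β * (d * m) := by positivity
  have p3 : 0 ≤ S * n := by positivity
  have p4 : 0 ≤ d * m := by positivity
  nlinarith

/-- The error estimate for `η` close to `Ψ`. The difference `Ψ - Ψ_g` lies in `V`, where the inf-sup
condition bounds it by its image under `DN(Ψ)`; this image consists of the residual at `η`, a
remainder that is absorbed since `η` is close to `Ψ`, and the boundary mismatch `Ψ_g - η`. -/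
lemma hNorm_sub_le_of_norm_sub_le (hΩ : IsSobolevDomain Ω) {𝒯 : Triangulation Ω} {σ : ℝ}
    (hσ : 0 < σ) {ε : ℝ} {g : Fin 2 → Lp ℝ 2 (bdry Ω)} {Ψ : X Ω}
    (hΨ : IsRegularSolution ε g Ψ) {F : Type*} [NormedAddCommGroup F] [InnerProductSpace ℝ F]
    {D : X Ω →L[ℝ] X Ω →L[ℝ] F} (hD : IsDot D) {S r : ℝ} (hS : ∀ Φ : X Ω, ‖Φ‖ ≤ S * hNorm 𝒯 σ Φ)
    {η Ψ_g : X Ω} (hg : Ψ_g ∈ admissible g) (hη : ‖DN ε η - DN ε Ψ‖ ≤ 1)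
    (hN : ‖DN ε Ψ (η - Ψ)‖ ≤ ‖N ε η‖ + r * ‖η - Ψ‖) (hS0 : 0 ≤ S) (hr0 : 0 ≤ r)
    (hr : r * S ≤ infSup ε Ψ / 2) :
    hNorm 𝒯 σ (Ψ - η) ≤ 2 * (1 + (1 + S) / infSup ε Ψ) *
      (‖N ε η‖ + (1 + ‖DN ε η‖) * hNorm 𝒯 σ (Ψ_g - η)) := by
  set β := infSup ε Ψ with hβ
  have hβ0 : 0 < β := hΨ.infSup_pos
  have hmem : Ψ - Ψ_g ∈ vanishing Ω := by
    intro i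
    have h := (hΨ.mem i).add ((hg i).smul (-1))
    rw [neg_smul, neg_smul, one_smul, one_smul, add_neg_cancel, ← sub_eq_add_neg] at h
    exact h
  let Θ : V Ω := ⟨Ψ - Ψ_g, hmem⟩
  have hΘ : (Θ : X Ω) = Ψ - Ψ_g := rfl
  have hΘn : ‖Θ‖ = ‖Ψ - Ψ_g‖ := rfl
  set e := hNorm 𝒯 σ (Ψ - η) with he
  set m := hNorm 𝒯 σ (Ψ_g - η) with hm
  have hm0 : 0 ≤ m := hNorm_nonneg _ _ _
  have h1 : β * ‖Ψ - Ψ_g‖ ≤ ‖DN ε Ψ (Ψ - Ψ_g)‖ := by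
    have h := hD.infSup_mul_norm_le hβ0 Θ
    rwa [hΘ, hΘn] at h
  have h2 : DN ε Ψ (Ψ - Ψ_g) = -(DN ε Ψ (η - Ψ) + DN ε Ψ (Ψ_g - η)) := by
    rw [← map_add, ← map_neg]
    congr 1
    abel
  have h3 : ‖DN ε Ψ (Ψ_g - η)‖ ≤ (1 + ‖DN ε η‖) * (S * m) := by
    refine ((DN ε Ψ).le_opNorm _).trans (mul_le_mul ?_ (hS _) (norm_nonneg _) (by positivity))
    have h := norm_le_norm_add_norm_sub (DN ε η) (DN ε Ψ)
    linarith
  have h4 : ‖η - Ψ‖ ≤ S * e := by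
    rw [norm_sub_rev]
    exact hS _
  have h5 : β * ‖Ψ - Ψ_g‖ ≤ ‖N ε η‖ + β / 2 * e + (1 + ‖DN ε η‖) * (S * m) := by
    have he0 : 0 ≤ e := hNorm_nonneg _ _ _
    have h6 : r * ‖η - Ψ‖ ≤ β / 2 * e := by
      calc r * ‖η - Ψ‖ ≤ r * (S * e) := by gcongr
        _ = r * S * e := by ring
        _ ≤ β / 2 * e := by gcongr
    rw [h2, norm_neg] at h1
    linarith [norm_add_le (DN ε Ψ (η - Ψ)) (DN ε Ψ (Ψ_g - η))]
  have h6 : e ≤ ‖Ψ - Ψ_g‖ + m := by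
    have h := hNorm_add_le hΩ 𝒯 hσ (Ψ - Ψ_g) (Ψ_g - η)
    rw [sub_add_sub_cancel] at h
    exact h.trans (by gcongr; exact hNorm_le_norm_of_vanishing hΩ 𝒯 hσ hmem)
  set n := ‖N ε η‖ with hn
  set d := ‖DN ε η‖ with hd
  have hn0 : 0 ≤ n := norm_nonneg _
  have hd0 : 0 ≤ d := norm_nonneg (DN ε η)
  exact le_of_absorbed hβ0 hS0 hm0 hn0 hd0 h6 h5

end LdG

open LdG in
theorem mainTheorem6 :
    ∃ K : ℝ → ℝ → ℝ → ℝ,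
      ∀ (Ω : Set Plane) (_ : IsPolygonalDomain Ω) (𝓕 : Set (Triangulation Ω)) (_ : 𝓕.Nonempty)
        (ε : ℝ) (_ : 0 < ε) (σ : ℝ) (_ : 0 < σ) (g : Fin 2 → Lp ℝ 2 (bdry Ω))
        (Ψ : X Ω) (_ : IsRegularSolution ε g Ψ),
        -- `N` and `DN` are well defined with values in `V*` and in `L(X, V*)`
        (∀ (η : X Ω) (Φ : V Ω), N ε η Φ = residualForm ε η Φ) ∧
        (∀ (η Θ : X Ω) (Φ : V Ω), DN ε η Θ Φ = linearizedForm ε η Θ Φ) ∧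
        (∃ c, IsPoincareConst 𝓕 σ c) ∧
        -- the balls may be taken in either norm
        ∀ B ∈ ({xBall Ψ, hBall σ Ψ} : Set (Triangulation Ω → ℝ → Set (X Ω))), ∀ R₀ > 0,
          (∃ L : ℝ≥0, ∀ 𝒯 ∈ 𝓕, LipschitzOnWith L (DN ε) (B 𝒯 R₀)) ∧
          BddAbove (lipQuotients 𝓕 ε σ Ψ B R₀) ∧
          ∀ C_P, IsPoincareConst 𝓕 σ C_P →
            ∃ R > 0, ∀ 𝒯 ∈ 𝓕, ∀ η ∈ B 𝒯 R, ∀ Ψ_g ∈ admissible g,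
              hNorm 𝒯 σ (Ψ - η) ≤
                K (sSup (lipQuotients 𝓕 ε σ Ψ B R₀)) (infSup ε Ψ) C_P *
                  (‖N ε η‖ + (1 + ‖DN ε η‖) * hNorm 𝒯 σ (Ψ_g - η)) := by
  -- the nonlinearity enters only through the radius `R`, so `K` is constant in its first argument
  refine ⟨fun _ β c => 2 * (1 + (1 + √(1 + c ^ 2)) / β), ?_⟩
  intro Ω hΩ 𝓕 h𝓕 ε hε σ hσ g Ψ hΨ
  obtain ⟨𝒯₀, _⟩ := h𝓕
  have hS := hΩ.isSobolevDomain 𝒯₀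
  obtain ⟨D, hD⟩ := hS.exists_isDot
  obtain ⟨c, -, hc⟩ := exists_isPoincareConst hΩ hS hσ 𝓕
  refine ⟨hD.N_apply ε, hD.DN_apply ε, ⟨c, hc⟩, fun B hB R₀ hR₀ => ?_⟩
  set r := √(1 + c ^ 2) * R₀ with hr
  set L := 6 / ε ^ 2 * ‖D‖ ^ 2 * (2 * (‖Ψ‖ + r)) with hL
  have hL0 : 0 ≤ L := by positivity
  have hball : ∀ 𝒯 ∈ 𝓕, ∀ η ∈ B 𝒯 R₀, ‖η - Ψ‖ ≤ r := fun 𝒯 h𝒯 η hη =>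
    (norm_sub_lt_of_mem_ball hσ hc hB h𝒯 hR₀ hη).le
  refine ⟨⟨⟨L, hL0⟩, fun 𝒯 h𝒯 => LipschitzOnWith.of_dist_le_mul fun η hη ζ hζ => ?_⟩, ?_, ?_⟩
  · rw [dist_eq_norm, dist_eq_norm]
    exact hD.norm_DN_sub_le_of_norm_sub_le hε (hball 𝒯 h𝒯 η hη) (hball 𝒯 h𝒯 ζ hζ)
  · refine ⟨L * √(1 + c ^ 2), ?_⟩
    rintro q ⟨𝒯, h𝒯, η, hη, -, rfl⟩
    refine div_le_of_le_mul₀ (hNorm_nonneg _ _ _) (by positivity) ?_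
    have hΨr : ‖Ψ - Ψ‖ ≤ r := by
      rw [sub_self, norm_zero]
      positivity
    have h := hD.norm_DN_sub_le_of_norm_sub_le hε (hball 𝒯 h𝒯 η hη) hΨr
    rw [← hL] at h
    rw [mul_assoc]
    exact h.trans <| mul_le_mul_of_nonneg_left (hc.norm_le hσ h𝒯 _) hL0
  · intro C hC
    set S := √(1 + C ^ 2) with hSdef
    have hS1 : 1 ≤ S := one_le_sqrt_one_add_sq C
    have hS0 : 0 < S := one_pos.trans_le hS1
    have hβ : 0 < infSup ε Ψ := hΨ.infSup_pos
    set L₁ := 6 / ε ^ 2 * ‖D‖ ^ 2 * (2 * (‖Ψ‖ + 1)) with hL₁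
    have hL₁0 : 0 ≤ L₁ := by positivity
    set M := 2 / ε ^ 2 * ‖D‖ ^ 2 * (3 * ‖Ψ‖ + 1) with hM
    have hM0 : 0 ≤ M := by positivity
    -- on a ball of radius `ρ` the operator `DN` changes by at most `1` and half of the inf-sup
    -- constant absorbs the remainder
    obtain ⟨ρ, hρ0, hρ1, hρL, hρM⟩ : ∃ ρ > 0, ρ ≤ 1 ∧ L₁ * ρ ≤ 1 ∧ M * ρ * S ≤ infSup ε Ψ / 2 := by
      refine ⟨min 1 (min (1 / (L₁ + 1)) (infSup ε Ψ / 2 / (M * S + 1))), by positivity,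
        min_le_left _ _, ?_, ?_⟩
      · calc L₁ * _ ≤ L₁ * (1 / (L₁ + 1)) := by
              gcongr; exact (min_le_right _ _).trans (min_le_left _ _)
          _ ≤ 1 := by rw [mul_one_div, div_le_one (by positivity)]; linarith
      · calc M * _ * S ≤ M * (infSup ε Ψ / 2 / (M * S + 1)) * S := by
              gcongr; exact (min_le_right _ _).trans (min_le_right _ _)
          _ = infSup ε Ψ / 2 * (M * S / (M * S + 1)) := by ring
          _ ≤ infSup ε Ψ / 2 * 1 := by
              gcongr
              rw [div_le_one (by positivity)]
              linarith
          _ = _ := mul_one _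
    refine ⟨ρ / S, by positivity, fun 𝒯 h𝒯 η hη Ψ_g hg => ?_⟩
    have hηρ : ‖η - Ψ‖ < ρ := by
      have h := norm_sub_lt_of_mem_ball hσ hC hB h𝒯 (by positivity) hη
      rwa [← hSdef, mul_div_cancel₀ _ hS0.ne'] at h
    refine hNorm_sub_le_of_norm_sub_le hS hσ hΨ hD (r := M * ρ) (hC.norm_le hσ h𝒯) hg ?_ ?_ hS0.le
      (by positivity) hρM
    · refine (hD.norm_DN_sub_le_of_norm_sub_le hε (hηρ.le.trans hρ1) (by simp)).trans ?_
      exact (mul_le_mul_of_nonneg_left hηρ.le hL₁0).trans hρL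
    · refine (hD.norm_DN_apply_sub_le hε hΨ.solves η).trans (add_le_add_right ?_ _)
      calc 2 / ε ^ 2 * ‖D‖ ^ 2 * (3 * ‖Ψ‖ + ‖η - Ψ‖) * ‖η - Ψ‖ ^ 2
          ≤ M * (ρ * ‖η - Ψ‖) := by
            rw [sq ‖η - Ψ‖, hM]
            gcongr
            exact hηρ.le.trans hρ1
        _ = M * ρ * ‖η - Ψ‖ := (mul_assoc _ _ _).symm
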